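/- **Setting.** Fix an integer $\mathbb K\ge 2$. For each $N$ let $(R,Y,\mathbf X)=(R_N,Y_N,\mathbf X_N)$ be a random vector with values in $\{0,1\}\times\mathbb R\times\mathbb R^{p_N}$; its law (and the dimension $p_N$) may depend on $N$. Write $\mathbb P_{\mathbf X}$ for the law of $\mathbf X$, $\|f\|_{2,\mathbb P_{\mathbf X}}=\{\mathbb E f(\mathbf X)^2\}^{1/2}$, and $$\theta_0=\mathbb E(Y),\quad m(\mathbf x)=\mathbb E(Y\mid \mathbf X=\mathbf x),\quad \pi_N(\mathbf x)=\mathbb E(R\mid \mathbf X=\mathbf x),\quad a_N^{-1}=\mathbb E\{\pi_N^{-1}(\mathbf X)\},$$ with the conventions $1/0=\infty$, $1/\infty=0$ in the definition of $a_N$. Let $(R_i,Y_i,\mathbf X_i)$, $i=1,\dots,N$, be i.i.d. copies of $(R,Y,\mathbf X)$, and let the observed data be $(R_i,R_iY_i,\mathbf X_i)$. Let $\mathcal I_1,\dots,\mathcal I_{\mathbb K}$ be a (possibly random) partition of $\{1,\dots,N\}$ that is independent of the data. Let $\widehat m(\cdot;\mathbb S_{-k})$ and $\widehat\pi_N(\cdot;\mathbb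 S_{-k})$ be any estimators computed from the partition and $\mathbb S_{-k}$, the observed data with index outside $\mathcal I_k$, and put $\widehat m(\mathbf X_i)=\widehat m(\mathbf X_i;\mathbb S_{-k})$, $\widehat\pi_N(\mathbf X_i)=\widehat\pi_N(\mathbf X_i;\mathbb S_{-k})$ for $i\in\mathcal I_k$. Define $$\widehat\theta_{\rm DRSS}=N^{-1}\sum_{i=1}^N\widehat m(\mathbf X_i)+N^{-1}\sum_{i=1}^N\frac{R_i}{\widehat\pi_N(\mathbf X_i)}\{Y_i-\widehat m(\mathbf X_i)\}$$ and, for functions $\mu$ and $e_N$ on $\mathbb R^{p_N}$ ($\mu$ may also depend on $N$), writing $\mathbf Z=(R,Y,\mathbf X)$ and $\mathbf Z_i=(R_i,Y_i,\mathbf X_i)$, $$\psi_{\mu,e}(\mathbf Z)=\mu(\mathbf X)+\frac{R}{e_N(\mathbf X)}\{Y-\mu(\mathbf X)\}-\theta_0,\qquad V_N(\mu,e)=\mathrm{Var}\{\psi_{\mu,e}(\mathbf Z)\}.$$ Equalities between functions of $\mathbf x$, such as $\mu(\cdot)=m(\cdot)$, are understood $\mathbb P_{\mathbf X}$-a.s.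 and for every $N$, except that the indicators $\mathbb 1\{\cdot\}$ below are evaluated for each $N$ separately. $u_N\asymp v_N$ means $c\,v_N<u_N<C\,v_N$ for all large $N$ with constants $c,C>0$. $W_N=O_p(b_N)$ means that for every $\varepsilon>0$ there is $M$ with $\mathbb P(|W_N|>M|b_N|)\le\varepsilon$ for all large $N$. $\mathbb E_{\mathbf X}$ integrates over an independent $\mathbf X\sim\mathbb P_{\mathbf X}$ with the estimators held fixed. **Assumptions.** (i) $R\perp Y\mid\mathbf X$. (ii) $Y$ and $\mathbf X$ have finite second moments, $\mathrm{Var}(\mathbf X)$ is positive definite, and for constants $\sigma_1,\sigma_2>0$ independent of $N$, $\mathbb E[\{Y-m(\mathbf X)\}^2\mid\mathbf X]\ge\sigma_1^2$ and $\mathbb E[\{Y-\mu(\mathbf X)\}^2\mid\mathbf X]\le\sigma_2^2$ a.s., and $\mathrm{Var}(Y)\le\sigma_2^2$. (iii) $Na_N\to\infty$. (iv) There are nonnegative sequences $c_{\mu,N},c_{e,N},r_{\mu,N},r_{e,N}$, all $o(1)$, such that for every $k\le\mathbb K$ $$\mathbb E_{\mathbf X}\Big[\tfrac{a_N}{\pi_N(\mathbf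 X)}\{\widehat m(\mathbf X;\mathbb S_{-k})-\mu(\mathbf X)\}^2\Big]=O_p(c_{\mu,N}^2),\qquad \mathbb E_{\mathbf X}\Big[\tfrac{a_N}{\pi_N(\mathbf X)}\Big\{1-\tfrac{e_N(\mathbf X)}{\widehat\pi_N(\mathbf X;\mathbb S_{-k})}\Big\}^2\Big]=O_p(c_{e,N}^2),$$ $$\mathbb E_{\mathbf X}\{\widehat m(\mathbf X;\mathbb S_{-k})-\mu(\mathbf X)\}^2=O_p(r_{\mu,N}^2),\qquad \mathbb E_{\mathbf X}\Big\{1-\tfrac{e_N(\mathbf X)}{\widehat\pi_N(\mathbf X;\mathbb S_{-k})}\Big\}^2=O_p(r_{e,N}^2).$$ Put $\rho_N=\dfrac{c_{\mu,N}}{\sqrt{Na_N}}+\dfrac{c_{e,N}}{\sqrt{Na_N}}+r_{\mu,N}r_{e,N}$. **(a)** Suppose $\mu(\cdot)=m(\cdot)$ and $e_N(\cdot)=\pi_N(\cdot)$. Then $$\widehat\theta_{\rm DRSS}-\theta_0=N^{-1}\sum_{i=1}^N\psi_{\mu,e}(\mathbf Z_i)+O_p(\rho_N),\qquad V_N(\mu,e)\asymp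 a_N^{-1}.$$ If moreover $r_{\mu,N}r_{e,N}=o\big((Na_N)^{-1/2}\big)$ and, for every $c>0$, $a_N\,\mathbb E\big[\psi_{\mu,\pi}^2(\mathbf Z)\mathbb 1\{|\psi_{\mu,\pi}(\mathbf Z)|>c\sqrt{N/a_N}\}\big]\to0$, then $$(Na_N)^{1/2}(\widehat\theta_{\rm DRSS}-\theta_0)=O_p(1),\qquad N^{1/2}V_N^{-1/2}(\mu,e)(\widehat\theta_{\rm DRSS}-\theta_0)\xrightarrow{d}\mathcal N(0,1).$$ **(b)** Suppose $\mu(\cdot)=m(\cdot)$ or $e_N(\cdot)=\pi_N(\cdot)$, and that there are constants $c,C>0$ such that $c\le\pi_N(\mathbf X)/e_N(\mathbf X)\le C$ a.s. for every $N$ with $e_N(\cdot)\ne\pi_N(\cdot)$. Then $$\widehat\theta_{\rm DRSS}-\theta_0=N^{-1}\sum_{i=1}^N\psi_{\mu,e}(\mathbf Z_i)+O_p(\rho_N)+\widehat\Delta_N,$$ where $$\widehat\Delta_N=N^{-1}\sum_{i=1}^N\Big\{\frac{R_i}{\pi_N(\mathbf X_i)}-\frac{R_i}{\widehat\pi_N(\mathbf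 X_i)}\Big\}\{\mu(\mathbf X_i)-m(\mathbf X_i)\}\quad\text{if } e_N(\cdot)=\pi_N(\cdot),$$ $$\widehat\Delta_N=N^{-1}\sum_{i=1}^N\Big\{\frac{R_i}{\pi_N(\mathbf X_i)}-\frac{R_i}{e_N(\mathbf X_i)}\Big\}\{\widehat m(\mathbf X_i)-m(\mathbf X_i)\}\quad\text{if } \mu(\cdot)=m(\cdot).$$ If in addition, for a constant $C<\infty$ and all $N$, $\|m(\cdot)-\mu(\cdot)\|_{2,\mathbb P_{\mathbf X}}\le C$ in the first case, respectively $\|1-\pi_N(\cdot)/e_N(\cdot)\|_{2,\mathbb P_{\mathbf X}}\le C$ in the second case, then $$\widehat\theta_{\rm DRSS}-\theta_0=O_p\Big(\frac1{\sqrt{Na_N}}+\rho_N\Big)+O_p\big(r_{e,N}\mathbb 1\{\mu(\cdot)\ne m(\cdot)\}+r_{\mu,N}\mathbb 1\{e_N(\cdot)\ne\pi_N(\cdot)\}\big).$$ -/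

import Mathlib

open MeasureTheory ProbabilityTheory Filter Topology
open scoped ENNReal

namespace DRSS

/-- The covariate space `ℝ^p`. -/
abbrev Cov (p : ℕ) : Type := EuclideanSpace ℝ (Fin p)

/-- Triples: `(R, Y, X)` for a (possibly unobserved) full data point, `(R, R Y, X)` for an
observed one. -/
abbrev Triple (p : ℕ) : Type := ℝ × ℝ × Cov p

/-- The labelling indicator `R`. -/
def labelR {p : ℕ} (z : Triple p) : ℝ := z.1

/-- The outcome `Y`. -/
def outcome {p : ℕ} (z : Triple p) : ℝ := z.2.1

/-- The covariate vector `X`. -/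
def covar {p : ℕ} (z : Triple p) : Cov p := z.2.2

theorem measurable_covar {p : ℕ} : Measurable (covar (p := p)) :=
  measurable_snd.comp measurable_snd

/-- The observed part `(R, R Y, X)` of a full data point `(R, Y, X)`. -/
def obs {p : ℕ} (z : Triple p) : Triple p := (labelR z, labelR z * outcome z, covar z)

noncomputable section Population

variable {p : ℕ} (Q : Measure (Triple p)) [IsProbabilityMeasure Q]

/-- The marginal law `P_X` of the covariates. -/
def lawX : Measure (Cov p) := Q.map covar

/-- The propensity score `π(x) = E(R | X = x)`. -/
def propensity (x : Cov p) : ℝ := ∫ r, r ∂(condDistrib labelR covar Q x)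

/-- The outcome regression `m(x) = E(Y | X = x)`. -/
def outcomeMean (x : Cov p) : ℝ := ∫ y, y ∂(condDistrib outcome covar Q x)

/-- `E[{Y - f(X)}² | X = x]`, as an extended nonnegative number. -/
def condSqError (f : Cov p → ℝ) (x : Cov p) : ℝ≥0∞ :=
  ∫⁻ y, ENNReal.ofReal ((y - f x) ^ 2) ∂(condDistrib outcome covar Q x)

/-- The target `θ₀ = E(Y)`. -/
def theta0 : ℝ := ∫ z, outcome z ∂Q

/-- `a`, with `a⁻¹ = E{1/π(X)}`. The expectation is taken in `[0, ∞]` with `1/0 = ∞`, so that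
`a = 0` exactly when `E{1/π(X)} = ∞`. -/
def aRate : ℝ := ((∫⁻ x, (ENNReal.ofReal (propensity Q x))⁻¹ ∂(lawX Q))⁻¹).toReal

/-- Ignorability: `R` and `Y` are independent conditionally on `X`. -/
def Ignorability : Prop :=
  CondIndepFun (MeasurableSpace.comap (covar (p := p)) inferInstance)
    measurable_covar.comap_le labelR outcome Q

/-- Moment conditions: finite second moments, positive definite `Var(X)`,
`E[{Y - m(X)}² | X] ≥ σ₁²`, `E[{Y - μ(X)}² | X] ≤ σ₂²` and `Var(Y) ≤ σ₂²`. -/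
structure BasicAssumption (μ : Cov p → ℝ) (σ₁ σ₂ : ℝ) : Prop where
  memLp_outcome : MemLp outcome 2 Q
  memLp_covar : MemLp covar 2 Q
  posDef_cov :
    (Matrix.of fun i j : Fin p => cov[fun z => covar z i, fun z => covar z j; Q]).PosDef
  lower : ∀ᵐ x ∂(lawX Q), ENNReal.ofReal (σ₁ ^ 2) ≤ condSqError Q (outcomeMean Q) x
  upper : ∀ᵐ x ∂(lawX Q), condSqError Q μ x ≤ ENNReal.ofReal (σ₂ ^ 2)
  var_outcome_le : Var[outcome; Q] ≤ σ₂ ^ 2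

/-- The doubly robust score `ψ_{μ,e}(Z) = μ(X) + R / e(X) {Y - μ(X)} - θ₀`. -/
def score (μ e : Cov p → ℝ) (z : Triple p) : ℝ :=
  μ (covar z) + labelR z / e (covar z) * (outcome z - μ (covar z)) - theta0 Q

/-- `V(μ, e) = Var{ψ_{μ,e}(Z)}`. -/
def scoreVar (μ e : Cov p → ℝ) : ℝ := Var[score Q μ e; Q]

/-- `E_X[(a / π(X)) g(X)²]`, with values in `[0, ∞]`. -/
def weightedSq (g : Cov p → ℝ) : ℝ≥0∞ :=
  ∫⁻ x, ENNReal.ofReal (aRate Q / propensity Q x * g x ^ 2) ∂(lawX Q)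

/-- `E_X[g(X)²]`, with values in `[0, ∞]`. -/
def plainSq (g : Cov p → ℝ) : ℝ≥0∞ := ∫⁻ x, ENNReal.ofReal (g x ^ 2) ∂(lawX Q)

end Population

/-- A rule that, for every assignment `κ` of `N` data points to `K` folds and every fold `k`,
turns the training data (the observed data outside fold `k`) into a function on `ℝ^p`. -/
abbrev Learner (K N p : ℕ) : Type :=
  ∀ (κ : Fin N → Fin K) (k : Fin K), ({i : Fin N // κ i ≠ k} → Triple p) → Cov p → ℝ

noncomputable section Estimation

variable {K N p : ℕ}

/-- The function `x ↦ f̂(x; S₋ₖ)` fitted on the observed data outside fold `k`. -/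
def fit (f : Learner K N p) (κ : Fin N → Fin K) (d : Fin N → Triple p) (k : Fin K) :
    Cov p → ℝ :=
  f κ k (fun i => obs (d i))

/-- The cross-fitted value `f̂(Xᵢ) = f̂(Xᵢ; S₋ₖ₍ᵢ₎)`. -/
def crossFit (f : Learner K N p) (κ : Fin N → Fin K) (d : Fin N → Triple p) (i : Fin N) : ℝ :=
  fit f κ d (κ i) (covar (d i))

/-- The estimator
`N⁻¹ ∑ m̂(Xᵢ) + N⁻¹ ∑ Rᵢ / π̂(Xᵢ) {Yᵢ - m̂(Xᵢ)}`. -/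
def estimator (mhat pihat : Learner K N p) (κ : Fin N → Fin K) (d : Fin N → Triple p) : ℝ :=
  (N : ℝ)⁻¹ * ∑ i, crossFit mhat κ d i
    + (N : ℝ)⁻¹ * ∑ i, labelR (d i) / crossFit pihat κ d i
        * (outcome (d i) - crossFit mhat κ d i)

/-- `N⁻¹ ∑ ψ_{μ,e}(Zᵢ)`. -/
def scoreMean (Q : Measure (Triple p)) (μ e : Cov p → ℝ) (d : Fin N → Triple p) : ℝ :=
  (N : ℝ)⁻¹ * ∑ i, score Q μ e (d i)

/-- `Δ̂` when the propensity model is correct: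
`N⁻¹ ∑ {Rᵢ / π(Xᵢ) - Rᵢ / π̂(Xᵢ)} {μ(Xᵢ) - m(Xᵢ)}`. -/
def deltaPS (Q : Measure (Triple p)) [IsProbabilityMeasure Q] (μ : Cov p → ℝ)
    (pihat : Learner K N p) (κ : Fin N → Fin K) (d : Fin N → Triple p) : ℝ :=
  (N : ℝ)⁻¹ * ∑ i,
    (labelR (d i) / propensity Q (covar (d i)) - labelR (d i) / crossFit pihat κ d i)
      * (μ (covar (d i)) - outcomeMean Q (covar (d i)))

/-- `Δ̂` when the outcome model is correct:
`N⁻¹ ∑ {Rᵢ / π(Xᵢ) - Rᵢ / e(Xᵢ)} {m̂(Xᵢ) - m(Xᵢ)}`. -/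
def deltaOR (Q : Measure (Triple p)) [IsProbabilityMeasure Q] (e : Cov p → ℝ)
    (mhat : Learner K N p) (κ : Fin N → Fin K) (d : Fin N → Triple p) : ℝ :=
  (N : ℝ)⁻¹ * ∑ i,
    (labelR (d i) / propensity Q (covar (d i)) - labelR (d i) / e (covar (d i)))
      * (crossFit mhat κ d i - outcomeMean Q (covar (d i)))

open Classical in
/-- The indicator `1{f(·) ≠ g(·)}`, functions being identified when they agree `ν`-a.e. -/
def neInd (ν : Measure (Cov p)) (f g : Cov p → ℝ) : ℝ := if f =ᵐ[ν] g then 0 else 1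

end Estimation

section Asymptotics

/-- `W_N = O_p(b_N)` for `[0, ∞]`-valued `W_N`. -/
def BigOPENN {Ω : ℕ → Type*} [∀ N, MeasurableSpace (Ω N)] (P : ∀ N, Measure (Ω N))
    (W : ∀ N, Ω N → ℝ≥0∞) (b : ℕ → ℝ) : Prop :=
  ∀ ε : ℝ, 0 < ε → ∃ M : ℝ, ∀ᶠ N in atTop,
    P N {ω | ENNReal.ofReal (M * |b N|) < W N ω} ≤ ENNReal.ofReal ε

/-- `W_N = O_p(b_N)` for real `W_N`. -/
def BigOP {Ω : ℕ → Type*} [∀ N, MeasurableSpace (Ω N)] (P : ∀ N, Measure (Ω N))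
    (W : ∀ N, Ω N → ℝ) (b : ℕ → ℝ) : Prop :=
  ∀ ε : ℝ, 0 < ε → ∃ M : ℝ, ∀ᶠ N in atTop,
    P N {ω | M * |b N| < |W N ω|} ≤ ENNReal.ofReal ε

/-- `u_N ≍ v_N`. -/
def SameOrder (u v : ℕ → ℝ) : Prop :=
  ∃ c C : ℝ, 0 < c ∧ 0 < C ∧ ∀ᶠ N in atTop, c * v N < u N ∧ u N < C * v N

end Asymptotics

end DRSS

/-!
Doubly robust estimation of a mean with labels missing at random and a decaying propensity score.

Write `δm = m̂ - μ` and `δe = 1 - e / π̂` for the errors of the cross-fitted nuisance estimators.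
Pointwise algebra (`estimator_sub_scoreMean_sub_bias`) splits the estimation error minus the
average score `N⁻¹ ∑ ψ(Zᵢ)` into averages of

* `δm(X) {1 - R / π(X)}` and `- R / e(X) δe(X) {Y - m(X)}`,
* `R / e(X) δm(X) δe(X)`,
* the summands of `bias`, which vanish when both models are correct and reduce to those of
  `deltaPS` or `deltaOR` when one of them is.

Conditionally on the partition and on the data outside a fold, the summands of the first kind within
that fold are i.i.d. and centered, by the definition of `π` and by ignorability; their conditional
variance is bounded by a multiple of `a⁻¹` times the weighted squared error of the nuisance
estimator. Their average is therefore of the order `c / √(N a)`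
(`CrossFitSample.bigOP_foldMean_of_sq`). The summands of the second kind are bounded in conditional
first moment by the Cauchy-Schwarz inequality, which yields `r_μ r_e`
(`CrossFitSample.bigOP_product_term`); the same inequality with one factor bounded yields the order
of the bias. Conditioning is carried out by restricting to the event that the conditional moment is
at most `u`, which depends only on the partition and the training data (`setLIntegral_heldOut_le`,
`BigOPENN.of_setLIntegral_le`).

The score is centered when one of the models is correct. As `Y - m(X)` has conditional variance
between two positive constants, the variance of the score is then at most of the order
`E{1 / π(X)} = a⁻¹` (`score_moments`), and exactly of this order when both models are correct
(`le_integral_sq_score`). Asymptotic normality is the Lindeberg theorem for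
triangular arrays with i.i.d. rows (`tendsto_charFun_of_lindeberg`), proved by a second order
expansion of the characteristic function of a summand, followed by Slutsky's argument at the level
of characteristic functions.
-/

namespace DRSS

/-! ### Calculus of stochastic orders -/

section StochasticOrder

variable {Ω : ℕ → Type*} [∀ N, MeasurableSpace (Ω N)] {P : ∀ N, Measure (Ω N)}

theorem BigOPENN.exists_pos {W : ∀ N, Ω N → ℝ≥0∞} {b : ℕ → ℝ} (h : BigOPENN P W b)
    {ε : ℝ} (hε : 0 < ε) : ∃ M : ℝ, 0 < M ∧ ∀ᶠ N in atTop,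
      P N {ω | ENNReal.ofReal (M * |b N|) < W N ω} ≤ ENNReal.ofReal ε := by
  obtain ⟨M, hM⟩ := h ε hε
  refine ⟨max M 1, by positivity, hM.mono fun N hN => (measure_mono fun ω hω => ?_).trans hN⟩
  exact lt_of_le_of_lt (ENNReal.ofReal_le_ofReal (by gcongr; exact le_max_left _ _)) hω

theorem BigOP.exists_pos {W : ∀ N, Ω N → ℝ} {b : ℕ → ℝ} (h : BigOP P W b)
    {ε : ℝ} (hε : 0 < ε) : ∃ M : ℝ, 0 < M ∧ ∀ᶠ N in atTop,
      P N {ω | M * |b N| < |W N ω|} ≤ ENNReal.ofReal ε := by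
  obtain ⟨M, hM⟩ := h ε hε
  refine ⟨max M 1, by positivity, hM.mono fun N hN => (measure_mono fun ω hω => ?_).trans hN⟩
  have : M * |b N| ≤ max M 1 * |b N| := by gcongr; exact le_max_left _ _
  exact lt_of_le_of_lt this hω

theorem BigOPENN.of_le_mul {W W' : ∀ N, Ω N → ℝ≥0∞} {b c : ℕ → ℝ} (h : BigOPENN P W b)
    (hc : ∀ᶠ N in atTop, 0 ≤ c N)
    (hle : ∀ᶠ N in atTop, ∀ ω, W' N ω ≤ ENNReal.ofReal (c N) * W N ω) :
    BigOPENN P W' (fun N => c N * b N) := by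
  intro ε hε
  obtain ⟨M, hM⟩ := h ε hε
  refine ⟨M, ?_⟩
  filter_upwards [hM, hc, hle] with N hN hcN hleN
  refine (measure_mono fun ω hω => ?_).trans hN
  by_contra hcon
  simp only [Set.mem_ofPred_eq, not_lt] at hω hcon
  refine absurd hω (not_lt.2 ((hleN ω).trans ((mul_le_mul_right hcon _).trans ?_)))
  rw [← ENNReal.ofReal_mul hcN, abs_mul, abs_of_nonneg hcN]
  exact ENNReal.ofReal_le_ofReal (le_of_eq (by ring))

/-- Conditional Markov inequality: if `W` has mean at most `u` on every event `{U ≤ u}`, as it does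
when `U` bounds the conditional mean of `W` given some `σ`-algebra, then `W` is of the order
of `U`. -/
theorem BigOPENN.of_setLIntegral_le {U W : ∀ N, Ω N → ℝ≥0∞} {b : ℕ → ℝ} (h : BigOPENN P U b)
    (hW : ∀ N, Measurable (W N))
    (hle : ∀ᶠ N in atTop, ∀ u : ℝ≥0∞, u ≠ ⊤ → ∫⁻ ω in {ω | U N ω ≤ u}, W N ω ∂(P N) ≤ u) :
    BigOPENN P W b := by
  intro ε hε
  obtain ⟨M, hM0, hM⟩ := h.exists_pos (half_pos hε)
  refine ⟨2 * M / ε, ?_⟩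
  filter_upwards [hM, hle] with N hN hleN
  set S : Set (Ω N) := {ω | U N ω ≤ ENNReal.ofReal (M * |b N|)}
  set A : Set (Ω N) := {ω | ENNReal.ofReal (2 * M / ε * |b N|) < W N ω}
  have hA : MeasurableSet A := measurableSet_lt measurable_const (hW N)
  have hint := hleN (ENNReal.ofReal (M * |b N|)) ENNReal.ofReal_ne_top
  have hAS : P N (A ∩ S) ≤ ENNReal.ofReal (ε / 2) := by
    rw [← Measure.restrict_apply hA]
    rcases eq_or_ne (b N) 0 with hb | hb
    · -- the Markov bound is void at threshold `0`, where `W` vanishes a.e. on `S`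
      simp only [hb, abs_zero, mul_zero, ENNReal.ofReal_zero, nonpos_iff_eq_zero] at hint
      have h0 : W N =ᵐ[(P N).restrict S] 0 :=
        (lintegral_eq_zero_iff (hW N)).1 (by simpa [S, hb] using hint)
      have : (P N).restrict S A = 0 := by
        refine measure_mono_null (fun ω hω => ?_) (ae_iff.1 h0)
        simp only [A, hb, abs_zero, mul_zero, ENNReal.ofReal_zero, Set.mem_ofPred_eq] at hω
        exact hω.ne'
      simp [this]
    · have hb' : 0 < |b N| := abs_pos.2 hb
      have h1 := (mul_meas_ge_le_lintegral (μ := (P N).restrict S) (hW N)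
        (ENNReal.ofReal (2 * M / ε * |b N|))).trans hint
      have hpos : 0 < 2 * M / ε * |b N| := by positivity
      have h2 : (P N).restrict S {ω | ENNReal.ofReal (2 * M / ε * |b N|) ≤ W N ω}
          ≤ ENNReal.ofReal (M * |b N|) / ENNReal.ofReal (2 * M / ε * |b N|) := by
        rw [ENNReal.le_div_iff_mul_le (Or.inl (by simpa using hpos))
          (Or.inl ENNReal.ofReal_ne_top), mul_comm]
        exact h1
      have h3 : A ⊆ {ω | ENNReal.ofReal (2 * M / ε * |b N|) ≤ W N ω} := by
        intro ω hω
        simp only [A, Set.mem_ofPred_eq] at hω ⊢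
        exact hω.le
      refine ((measure_mono h3).trans h2).trans (le_of_eq ?_)
      rw [← ENNReal.ofReal_div_of_pos hpos]
      congr 1
      field_simp
  calc P N A ≤ P N (A ∩ S) + P N (A \ S) := measure_le_inter_add_sdiff _ _ _
    _ ≤ ENNReal.ofReal (ε / 2) + ENNReal.ofReal (ε / 2) := by
        refine add_le_add hAS ((measure_mono fun ω hω => ?_).trans hN)
        simpa [S] using hω.2
    _ = ENNReal.ofReal ε := by rw [← ENNReal.ofReal_add (by positivity) (by positivity)]; simp

theorem BigOPENN.of_le_ofReal {W : ∀ N, Ω N → ℝ≥0∞} {b : ℕ → ℝ} {M : ℝ}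
    (h : ∀ᶠ N in atTop, ∀ ω, W N ω ≤ ENNReal.ofReal (M * b N)) (hM : 0 ≤ M) :
    BigOPENN P W b := by
  intro ε _
  refine ⟨M, h.mono fun N hN => ?_⟩
  have : ∀ ω, ¬ ENNReal.ofReal (M * |b N|) < W N ω := fun ω => not_lt.2 <|
    (hN ω).trans (ENNReal.ofReal_le_ofReal (by gcongr; exact le_abs_self _))
  simp [this]

/-- Markov's inequality as a stochastic order. -/
theorem BigOPENN.of_lintegral_le {W : ∀ N, Ω N → ℝ≥0∞} {b : ℕ → ℝ}
    (hW : ∀ N, Measurable (W N))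
    (hle : ∀ᶠ N in atTop, ∫⁻ ω, W N ω ∂(P N) ≤ ENNReal.ofReal (b N)) : BigOPENN P W b := by
  refine BigOPENN.of_setLIntegral_le (U := fun N _ => ENNReal.ofReal (b N)) ?_ hW ?_
  · exact BigOPENN.of_le_ofReal (M := 1) (Eventually.of_forall fun N ω => by rw [one_mul])
      zero_le_one
  · filter_upwards [hle] with N hN u hu
    by_cases h : ENNReal.ofReal (b N) ≤ u
    · exact (setLIntegral_le_lintegral _ _).trans (hN.trans h)
    · simp [h]

theorem BigOPENN.bigOP_of_sq {W : ∀ N, Ω N → ℝ} {b : ℕ → ℝ}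
    (h : BigOPENN P (fun N ω => ENNReal.ofReal (W N ω ^ 2)) (fun N => b N ^ 2)) :
    BigOP P W b := by
  intro ε hε
  obtain ⟨M, hM0, hM⟩ := h.exists_pos hε
  refine ⟨√M, hM.mono fun N hN => (measure_mono fun ω hω => ?_).trans hN⟩
  simp only [Set.mem_ofPred_eq] at hω ⊢
  have h0 : 0 ≤ √M * |b N| := by positivity
  have h1 : (√M * |b N|) ^ 2 < |W N ω| ^ 2 := pow_lt_pow_left₀ hω h0 two_ne_zero
  rw [mul_pow, Real.sq_sqrt hM0.le, sq_abs, sq_abs] at h1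
  rw [abs_of_nonneg (sq_nonneg _)]
  exact (ENNReal.ofReal_lt_ofReal_iff (lt_of_le_of_lt (by positivity) h1)).2 h1

theorem BigOPENN.bigOP_of_abs {W : ∀ N, Ω N → ℝ} {b : ℕ → ℝ}
    (h : BigOPENN P (fun N ω => ENNReal.ofReal |W N ω|) b) : BigOP P W b := by
  intro ε hε
  obtain ⟨M, hM0, hM⟩ := h.exists_pos hε
  refine ⟨M, hM.mono fun N hN => (measure_mono fun ω hω => ?_).trans hN⟩
  simp only [Set.mem_ofPred_eq] at hω ⊢
  exact (ENNReal.ofReal_lt_ofReal_iff (lt_of_le_of_lt (by positivity) hω)).2 hω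

/-- A quantity dominated by the geometric mean of two others, as by the Cauchy-Schwarz inequality, is
of the order of the product of the root rates. -/
theorem BigOPENN.sqrt_mul_sqrt {W₁ W₂ W : ∀ N, Ω N → ℝ≥0∞} {b₁ b₂ : ℕ → ℝ}
    (h₁ : BigOPENN P W₁ (fun N => b₁ N ^ 2)) (h₂ : BigOPENN P W₂ (fun N => b₂ N ^ 2))
    {C : ℝ} (hC : 0 ≤ C)
    (hle : ∀ᶠ N in atTop, ∀ ω, W N ω ≤ ENNReal.ofReal C *
      (W₁ N ω ^ (1 / 2 : ℝ) * W₂ N ω ^ (1 / 2 : ℝ))) :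
    BigOPENN P W (fun N => b₁ N * b₂ N) := by
  intro ε hε
  obtain ⟨M₁, hM₁, h₁⟩ := h₁.exists_pos (half_pos hε)
  obtain ⟨M₂, hM₂, h₂⟩ := h₂.exists_pos (half_pos hε)
  refine ⟨C * (√M₁ * √M₂), ?_⟩
  filter_upwards [h₁, h₂, hle] with N hN₁ hN₂ hleN
  have hroot : ∀ (M b : ℝ) (w : ℝ≥0∞), 0 < M → w ≤ ENNReal.ofReal (M * |b ^ 2|) →
      w ^ (1 / 2 : ℝ) ≤ ENNReal.ofReal (√M * |b|) := by
    intro M b w hM hw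
    refine (ENNReal.rpow_le_rpow hw (by norm_num)).trans (le_of_eq ?_)
    rw [ENNReal.ofReal_rpow_of_nonneg (by positivity) (by norm_num), ← Real.sqrt_eq_rpow,
      Real.sqrt_mul hM.le, abs_pow, Real.sqrt_sq (abs_nonneg b)]
  calc P N {ω | ENNReal.ofReal (C * (√M₁ * √M₂) * |b₁ N * b₂ N|) < W N ω}
      ≤ P N ({ω | ENNReal.ofReal (M₁ * |b₁ N ^ 2|) < W₁ N ω} ∪
          {ω | ENNReal.ofReal (M₂ * |b₂ N ^ 2|) < W₂ N ω}) := by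
        refine measure_mono fun ω hω => ?_
        by_contra hcon
        simp only [Set.mem_union, Set.mem_ofPred_eq, not_or, not_lt] at hcon hω
        refine absurd hω (not_lt.2 ((hleN ω).trans ((mul_le_mul_right (mul_le_mul'
          (hroot _ _ _ hM₁ hcon.1) (hroot _ _ _ hM₂ hcon.2)) _).trans ?_)))
        rw [← ENNReal.ofReal_mul (by positivity), ← ENNReal.ofReal_mul hC, abs_mul]
        exact ENNReal.ofReal_le_ofReal (le_of_eq (by ring))
    _ ≤ ENNReal.ofReal (ε / 2) + ENNReal.ofReal (ε / 2) :=
        (measure_union_le _ _).trans (add_le_add hN₁ hN₂)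
    _ = ENNReal.ofReal ε := by rw [← ENNReal.ofReal_add (by positivity) (by positivity)]; simp

theorem BigOP.of_abs_le {W W' : ∀ N, Ω N → ℝ} {b : ℕ → ℝ} (h : BigOP P W b)
    (hle : ∀ᶠ N in atTop, ∀ᵐ ω ∂(P N), |W' N ω| ≤ |W N ω|) : BigOP P W' b := by
  intro ε hε
  obtain ⟨M, hM⟩ := h ε hε
  refine ⟨M, ?_⟩
  filter_upwards [hM, hle] with N hN hleN
  refine (measure_mono_ae ?_).trans hN
  filter_upwards [hleN] with ω hω h' using lt_of_lt_of_le h' hω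

theorem BigOP.congr {W W' : ∀ N, Ω N → ℝ} {b : ℕ → ℝ} (h : BigOP P W b)
    (heq : ∀ᶠ N in atTop, ∀ᵐ ω ∂(P N), W' N ω = W N ω) : BigOP P W' b :=
  h.of_abs_le (heq.mono fun _ hN => hN.mono fun _ hω => by rw [hω])

theorem BigOP.neg {W : ∀ N, Ω N → ℝ} {b : ℕ → ℝ} (h : BigOP P W b) :
    BigOP P (fun N ω => -W N ω) b :=
  h.of_abs_le (Eventually.of_forall fun _ => ae_of_all _ fun _ => (abs_neg _).le)

theorem BigOP.mono_rate {W : ∀ N, Ω N → ℝ} {b b' : ℕ → ℝ} (h : BigOP P W b) (C : ℝ)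
    (hle : ∀ᶠ N in atTop, |b N| ≤ C * |b' N|) : BigOP P W b' := by
  intro ε hε
  obtain ⟨M, hM0, hM⟩ := h.exists_pos hε
  refine ⟨M * C, ?_⟩
  filter_upwards [hM, hle] with N hN hleN
  refine (measure_mono fun ω hω => ?_).trans hN
  have : M * |b N| ≤ M * C * |b' N| := by rw [mul_assoc]; gcongr
  exact lt_of_le_of_lt this hω

theorem BigOP.zero (b : ℕ → ℝ) : BigOP P (fun _ _ => 0) b := by
  refine fun ε hε => ⟨0, Eventually.of_forall fun N => ?_⟩
  simp

theorem BigOP.add_same {W W' : ∀ N, Ω N → ℝ} {b : ℕ → ℝ} (h : BigOP P W b) (h' : BigOP P W' b) :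
    BigOP P (fun N ω => W N ω + W' N ω) b := by
  intro ε hε
  obtain ⟨M, hM⟩ := h (ε / 2) (half_pos hε)
  obtain ⟨M', hM'⟩ := h' (ε / 2) (half_pos hε)
  refine ⟨M + M', ?_⟩
  filter_upwards [hM, hM'] with N hN hN'
  calc P N {ω | (M + M') * |b N| < |W N ω + W' N ω|}
      ≤ P N ({ω | M * |b N| < |W N ω|} ∪ {ω | M' * |b N| < |W' N ω|}) := by
        refine measure_mono fun ω hω => ?_
        by_contra hcon
        simp only [Set.mem_union, Set.mem_ofPred_eq, not_or, not_lt] at hcon hω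
        have := abs_add_le (W N ω) (W' N ω)
        linarith [hcon.1, hcon.2]
    _ ≤ ENNReal.ofReal (ε / 2) + ENNReal.ofReal (ε / 2) :=
        (measure_union_le _ _).trans (add_le_add hN hN')
    _ = ENNReal.ofReal ε := by rw [← ENNReal.ofReal_add (by positivity) (by positivity)]; simp

theorem BigOP.sum {ι : Type*} (s : Finset ι) {W : ι → ∀ N, Ω N → ℝ} {b : ℕ → ℝ}
    (h : ∀ k, BigOP P (W k) b) : BigOP P (fun N ω => ∑ k ∈ s, W k N ω) b := by
  classical
  induction s using Finset.induction_on with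
  | empty => simpa using BigOP.zero b
  | insert k s hk ih => simpa [Finset.sum_insert hk] using (h k).add_same ih

theorem BigOP.add {W W' : ∀ N, Ω N → ℝ} {b b' : ℕ → ℝ} (h : BigOP P W b) (h' : BigOP P W' b')
    (hb : ∀ᶠ N in atTop, 0 ≤ b N) (hb' : ∀ᶠ N in atTop, 0 ≤ b' N) :
    BigOP P (fun N ω => W N ω + W' N ω) (fun N => b N + b' N) := by
  refine (h.mono_rate 1 ?_).add_same (h'.mono_rate 1 ?_) <;>
  · filter_upwards [hb, hb'] with N h1 h2
    simp only [abs_of_nonneg h1, abs_of_nonneg h2, abs_of_nonneg (add_nonneg h1 h2)]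
    linarith

theorem BigOP.mul_seq {W : ∀ N, Ω N → ℝ} {b : ℕ → ℝ} (h : BigOP P W b) (c : ℕ → ℝ) :
    BigOP P (fun N ω => c N * W N ω) (fun N => c N * b N) := by
  intro ε hε
  obtain ⟨M, hM⟩ := h ε hε
  refine ⟨M, hM.mono fun N hN => (measure_mono fun ω hω => ?_).trans hN⟩
  by_contra hcon
  simp only [Set.mem_ofPred_eq, not_lt, abs_mul] at hω hcon
  have := mul_le_mul_of_nonneg_left hcon (abs_nonneg (c N))
  linarith

theorem BigOP.tendsto_zero {W : ∀ N, Ω N → ℝ} {b : ℕ → ℝ} (h : BigOP P W b)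
    (hb : Tendsto b atTop (𝓝 0)) {ε : ℝ} (hε : 0 < ε) :
    Tendsto (fun N => (P N).real {ω | ε < |W N ω|}) atTop (𝓝 0) := by
  rw [Metric.tendsto_nhds]
  intro η hη
  obtain ⟨M, hM0, hM⟩ := h.exists_pos (half_pos hη)
  have hMb : Tendsto (fun N => M * |b N|) atTop (𝓝 0) := by
    simpa using (hb.abs).const_mul M
  filter_upwards [hM, hMb.eventually_lt_const hε] with N hN hN'
  rw [dist_zero_right, Real.norm_of_nonneg measureReal_nonneg]
  have : P N {ω | ε < |W N ω|} ≤ ENNReal.ofReal (η / 2) := by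
    refine (measure_mono fun ω hω => ?_).trans hN
    exact hN'.trans hω
  have h2 := ENNReal.toReal_mono ENNReal.ofReal_ne_top this
  rw [ENNReal.toReal_ofReal (by positivity)] at h2
  rw [Measure.real]
  linarith

/-- A random quantity is of the order of the sum of the rates of its three parts: an average
score, a bias and a remainder. -/
theorem BigOP.of_sub_sub {W S B : ∀ N, Ω N → ℝ} {s b r : ℕ → ℝ}
    (h : BigOP P (fun N ω => W N ω - S N ω - B N ω) r) (hS : BigOP P S s) (hB : BigOP P B b)
    (hs : ∀ N, 0 ≤ s N) (hb : ∀ N, 0 ≤ b N) (hr : ∀ N, 0 ≤ r N) :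
    BigOP P W (fun N => s N + r N + b N) := by
  have h' := (hS.add h (Eventually.of_forall hs) (Eventually.of_forall hr)).add hB
    (Eventually.of_forall fun N => add_nonneg (hs N) (hr N)) (Eventually.of_forall hb)
  exact h'.congr (Eventually.of_forall fun N => ae_of_all _ fun ω => by ring)

end StochasticOrder

/-! ### Conditional moments of cross-fitted sums -/

section CrossFitting

theorem lintegral_pi_sum_sq {α ι : Type*} [MeasurableSpace α] [Fintype ι] {Q : Measure α}
    [IsProbabilityMeasure Q] {h : α → ℝ} (hh : MemLp h 2 Q) (h0 : ∫ z, h z ∂Q = 0) :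
    ∫⁻ z, ENNReal.ofReal ((∑ i, h (z i)) ^ 2) ∂(Measure.pi fun _ : ι => Q)
      = Fintype.card ι * ∫⁻ z, ENNReal.ofReal (h z ^ 2) ∂Q := by
  have hi : ∀ i, MemLp (fun z : ι → α => h (z i)) 2 (Measure.pi fun _ : ι => Q) := fun i =>
    hh.comp_measurePreserving (measurePreserving_eval (fun _ : ι => Q) i)
  have hsum : MemLp (∑ i : ι, fun z : ι → α => h (z i)) 2 (Measure.pi fun _ : ι => Q) :=
    memLp_finsetSum' _ fun i _ => hi i
  have hmean : ∫ z, (∑ i : ι, fun z : ι → α => h (z i)) z ∂(Measure.pi fun _ : ι => Q) = 0 := by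
    simp only [Finset.sum_apply]
    rw [integral_finsetSum _ fun i _ => (hi i).integrable one_le_two]
    refine Finset.sum_eq_zero fun i _ => ?_
    have hmap := (measurePreserving_eval (fun _ : ι => Q) i).map_eq
    refine Eq.trans ?_ h0
    have := integral_map (μ := Measure.pi fun _ : ι => Q) (measurable_pi_apply i).aemeasurable
      (f := h) (by rw [hmap]; exact hh.aestronglyMeasurable)
    rw [hmap] at this
    exact this.symm
  have hvar := variance_sum_pi (ι := ι) (μ := fun _ => Q) (X := fun _ => h) fun _ => hh
  have h1 := evariance_eq_lintegral_ofReal (∑ i : ι, fun z : ι → α => h (z i))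
    (Measure.pi fun _ : ι => Q)
  rw [hmean] at h1
  have h2 := evariance_eq_lintegral_ofReal h Q
  simp only [h0, sub_zero, Finset.sum_apply] at h1 h2
  rw [← h1, ← h2, ← ofReal_variance hsum, ← ofReal_variance hh, hvar]
  simp [ENNReal.ofReal_mul]

variable {α : Type*} [MeasurableSpace α] {K N : ℕ}

/-- Fubini's theorem for a fixed assignment of the sample to folds: if `U` of the training data
bounds the mean of `W` over the held-out data, then `W` has mean at most `u` on `{U ≤ u}`. -/
theorem setLIntegral_heldOut_le {Q : Measure α} [IsProbabilityMeasure Q]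
    (κ : Fin N → Fin K) (k : Fin K)
    {U : ({i // κ i ≠ k} → α) → ℝ≥0∞} (hU : Measurable U)
    {W : ({i // κ i ≠ k} → α) × ({i // ¬ κ i ≠ k} → α) → ℝ≥0∞} (hW : Measurable W)
    (h : ∀ s, U s ≠ ⊤ → ∫⁻ z, W (s, z) ∂(Measure.pi fun _ => Q) ≤ U s)
    {u : ℝ≥0∞} (hu : u ≠ ⊤) :
    ∫⁻ d in {d : Fin N → α | U (fun i => d i) ≤ u}, W (fun i => d i, fun i => d i)
      ∂(Measure.pi fun _ => Q) ≤ u := by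
  have hmp := measurePreserving_piEquivPiSubtypeProd (α := fun _ : Fin N => α)
    (fun _ : Fin N => Q) (fun i => κ i ≠ k)
  let F : ({i // κ i ≠ k} → α) × ({i // ¬ κ i ≠ k} → α) → ℝ≥0∞ :=
    {q | U q.1 ≤ u}.indicator W
  have hS : MeasurableSet {q : ({i // κ i ≠ k} → α) × ({i // ¬ κ i ≠ k} → α) | U q.1 ≤ u} :=
    measurableSet_le (hU.comp measurable_fst) measurable_const
  have hF : Measurable F := hW.indicator hS
  have hS' : MeasurableSet {d : Fin N → α | U (fun i => d i) ≤ u} :=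
    measurableSet_le (hU.comp (by fun_prop)) measurable_const
  calc ∫⁻ d in {d : Fin N → α | U (fun i => d i) ≤ u}, W (fun i => d i, fun i => d i)
        ∂(Measure.pi fun _ => Q)
      = ∫⁻ d, F (MeasurableEquiv.piEquivPiSubtypeProd (fun _ : Fin N => α) (fun i => κ i ≠ k) d)
        ∂(Measure.pi fun _ => Q) := by
        rw [← lintegral_indicator hS']
        rfl
    _ = ∫⁻ q, F q ∂((Measure.pi fun _ : {i // κ i ≠ k} => Q).prod
          (Measure.pi fun _ : {i // ¬ κ i ≠ k} => Q)) := hmp.lintegral_comp hF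
    _ = ∫⁻ s, ∫⁻ z, F (s, z) ∂(Measure.pi fun _ => Q) ∂(Measure.pi fun _ => Q) :=
        lintegral_prod _ hF.aemeasurable
    _ ≤ ∫⁻ _, u ∂(Measure.pi fun _ : {i // κ i ≠ k} => Q) := by
        refine lintegral_mono fun s => ?_
        by_cases hs : U s ≤ u
        · have : ∀ z, F (s, z) = W (s, z) := fun z => Set.indicator_of_mem (by exact hs) _
          simp only [this]
          exact (h s (ne_top_of_le_ne_top hu hs)).trans hs
        · have : ∀ z, F (s, z) = 0 := fun z => Set.indicator_of_notMem (by exact hs) _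
          simp [this]
    _ = u := by simp

/-- A random assignment to folds that is independent of the sample may be held fixed. -/
theorem setLIntegral_fold_le {Ω : Type*} [MeasurableSpace Ω] {P : Measure Ω}
    [IsProbabilityMeasure P] {Q : Measure α} [IsProbabilityMeasure Q] {D : Fin N → Ω → α}
    (hD_meas : ∀ i, Measurable (D i)) (hD_law : ∀ i, P.map (D i) = Q) (hD_indep : iIndepFun D P)
    {fold : Ω → Fin N → Fin K} (hfold_meas : Measurable fold)
    (hfold_indep : IndepFun fold (fun ω i => D i ω) P)
    {U W : (Fin N → Fin K) → (Fin N → α) → ℝ≥0∞} (hU : ∀ κ, Measurable (U κ))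
    (hW : ∀ κ, Measurable (W κ)) {u : ℝ≥0∞}
    (h : ∀ κ, ∫⁻ d in {d | U κ d ≤ u}, W κ d ∂(Measure.pi fun _ => Q) ≤ u) :
    ∫⁻ ω in {ω | U (fold ω) (fun i => D i ω) ≤ u}, W (fold ω) (fun i => D i ω) ∂P ≤ u := by
  have hDm : Measurable (fun ω i => D i ω) := measurable_pi_lambda _ hD_meas
  have hlaw : P.map (fun ω i => D i ω) = Measure.pi fun _ => Q := by
    rw [(iIndepFun_iff_map_fun_eq_pi_map fun i => (hD_meas i).aemeasurable).1 hD_indep]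
    simp only [hD_law]
  have hjoint := (indepFun_iff_map_prod_eq_prod_map_map hfold_meas.aemeasurable
    hDm.aemeasurable).1 hfold_indep
  rw [hlaw] at hjoint
  have hprob : IsProbabilityMeasure (P.map fold) :=
    Measure.isProbabilityMeasure_map hfold_meas.aemeasurable
  have hU' : Measurable (fun q : (Fin N → Fin K) × (Fin N → α) => U q.1 q.2) :=
    measurable_from_prod_countable_right hU
  have hW' : Measurable (fun q : (Fin N → Fin K) × (Fin N → α) => W q.1 q.2) :=
    measurable_from_prod_countable_right hW
  have hS : MeasurableSet {q : (Fin N → Fin K) × (Fin N → α) | U q.1 q.2 ≤ u} :=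
    measurableSet_le hU' measurable_const
  let F : (Fin N → Fin K) × (Fin N → α) → ℝ≥0∞ :=
    {q | U q.1 q.2 ≤ u}.indicator fun q => W q.1 q.2
  have hF : Measurable F := hW'.indicator hS
  calc ∫⁻ ω in {ω | U (fold ω) (fun i => D i ω) ≤ u}, W (fold ω) (fun i => D i ω) ∂P
      = ∫⁻ ω, F (fold ω, fun i => D i ω) ∂P := by
        have hS' : MeasurableSet {ω | U (fold ω) (fun i => D i ω) ≤ u} :=
          (hfold_meas.prodMk hDm) hS
        rw [← lintegral_indicator hS']
        rfl
    _ = ∫⁻ q, F q ∂((P.map fold).prod (Measure.pi fun _ => Q)) := by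
        rw [← hjoint, lintegral_map hF (hfold_meas.prodMk hDm)]
    _ = ∫⁻ κ, ∫⁻ d, F (κ, d) ∂(Measure.pi fun _ => Q) ∂(P.map fold) :=
        lintegral_prod _ hF.aemeasurable
    _ ≤ ∫⁻ _, u ∂(P.map fold) := by
        refine lintegral_mono fun κ => ?_
        refine le_trans (le_of_eq ?_) (h κ)
        rw [← lintegral_indicator (measurableSet_le (hU κ) measurable_const)]
        rfl
    _ = u := by simp

/-- `N⁻¹ ∑ g(Zᵢ)` over the data points `Zᵢ` of fold `k`, for a function `g` that may depend on the
training data of that fold. The normalization is by the sample size and not by the size of the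
fold, so that the means over the folds add up to the mean over the sample. -/
noncomputable def foldMean {k : Fin K}
    (g : ∀ κ : Fin N → Fin K, ({i // κ i ≠ k} → α) → α → ℝ) (κ : Fin N → Fin K)
    (d : Fin N → α) : ℝ :=
  (N : ℝ)⁻¹ * ∑ i with κ i = k, g κ (fun j => d j) (d i)

theorem measurable_foldMean {k : Fin K} {g : ∀ κ : Fin N → Fin K, ({i // κ i ≠ k} → α) → α → ℝ}
    (hg : ∀ κ, Measurable (Function.uncurry (g κ))) (κ : Fin N → Fin K) :
    Measurable (foldMean g κ) := by
  refine (Finset.measurable_sum _ fun i _ => ?_).const_mul _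
  have htrain : Measurable fun (d : Fin N → α) (j : {i // κ i ≠ k}) => d j :=
    measurable_pi_lambda _ fun j => measurable_pi_apply _
  exact (hg κ).comp (htrain.prodMk (measurable_pi_apply i))

/-- The mean over a fold as a sum over the complement of the index type of the training data. -/
theorem foldMean_eq {β : Type*} {k : Fin K} (g : ∀ κ : Fin N → Fin K, ({i // κ i ≠ k} → β) → β → ℝ)
    (κ : Fin N → Fin K) (d : Fin N → β) :
    foldMean g κ d = (N : ℝ)⁻¹ * ∑ i : {i // ¬ κ i ≠ k}, g κ (fun j => d j) (d i) := by
  rw [foldMean]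
  congr 1
  exact Finset.sum_subtype _ (by simp) fun i => g κ (fun j => d j) (d i)

variable {Ω : Type*} [MeasurableSpace Ω] {P : Measure Ω}
    [IsProbabilityMeasure P] {Q : Measure α} [IsProbabilityMeasure Q] {D : Fin N → Ω → α}

/-- The conditional second moment of a cross-fitted mean of conditionally centered terms is at most
`N⁻¹ E[g(Z)²]`, in the form required by `BigOPENN.of_setLIntegral_le`. -/
theorem setLIntegral_foldMean_sq_le
    (hD_meas : ∀ i, Measurable (D i)) (hD_law : ∀ i, P.map (D i) = Q) (hD_indep : iIndepFun D P)
    {fold : Ω → Fin N → Fin K} (hfold_meas : Measurable fold)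
    (hfold_indep : IndepFun fold (fun ω i => D i ω) P) {k : Fin K}
    {g : ∀ κ : Fin N → Fin K, ({i // κ i ≠ k} → α) → α → ℝ}
    (hg : ∀ κ, Measurable (Function.uncurry (g κ))) (h0 : ∀ κ s, ∫ z, g κ s z ∂Q = 0)
    (hN : 0 < N) {u : ℝ≥0∞} (hu : u ≠ ⊤) :
    ∫⁻ ω in {ω | ENNReal.ofReal (N : ℝ)⁻¹ *
        ∫⁻ z, ENNReal.ofReal (g (fold ω) (fun j => D j ω) z ^ 2) ∂Q ≤ u},
      ENNReal.ofReal (foldMean g (fold ω) (fun i => D i ω) ^ 2) ∂P ≤ u := by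
  have hU : ∀ κ, Measurable fun s => ENNReal.ofReal (N : ℝ)⁻¹ *
      ∫⁻ z, ENNReal.ofReal (g κ s z ^ 2) ∂Q := fun κ =>
    (((hg κ).pow_const 2).ennreal_ofReal.lintegral_prod_right').const_mul _
  refine setLIntegral_fold_le hD_meas hD_law hD_indep hfold_meas hfold_indep
    (U := fun κ d => ENNReal.ofReal (N : ℝ)⁻¹ *
      ∫⁻ z, ENNReal.ofReal (g κ (fun j => d j) z ^ 2) ∂Q)
    (W := fun κ d => ENNReal.ofReal (foldMean g κ d ^ 2))
    (fun κ => (hU κ).comp (measurable_pi_lambda _ fun j => measurable_pi_apply _))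
    (fun κ => ((measurable_foldMean hg κ).pow_const 2).ennreal_ofReal) fun κ => ?_
  simp only [foldMean_eq]
  have hNpos : (0 : ℝ) < N := by exact_mod_cast hN
  refine setLIntegral_heldOut_le (Q := Q) κ k (hU κ)
    (W := fun q => ENNReal.ofReal (((N : ℝ)⁻¹ * ∑ i, g κ q.1 (q.2 i)) ^ 2)) ?_ (fun s hs => ?_) hu
  · refine ((Finset.measurable_sum _ fun i _ => ?_).const_mul _ |>.pow_const 2).ennreal_ofReal
    exact (hg κ).comp (measurable_fst.prodMk ((measurable_pi_apply i).comp measurable_snd))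
  · have hgs : Measurable (g κ s) := (hg κ).comp measurable_prodMk_left
    have hfin : ∫⁻ z, ENNReal.ofReal (g κ s z ^ 2) ∂Q ≠ ⊤ := by
      intro htop
      refine hs ?_
      rw [htop, ENNReal.mul_top]
      simpa using hN.ne'
    have hmem : MemLp (g κ s) 2 Q := by
      rw [memLp_two_iff_integrable_sq hgs.aestronglyMeasurable]
      refine ⟨(hgs.pow_const 2).aestronglyMeasurable, ?_⟩
      rw [hasFiniteIntegral_iff_ofReal (ae_of_all _ fun z => sq_nonneg _)]
      exact hfin.lt_top
    have hcard : (Fintype.card {i // ¬ κ i ≠ k} : ℝ≥0∞) ≤ N := by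
      have := Fintype.card_subtype_le fun i : Fin N => ¬ κ i ≠ k
      rw [Fintype.card_fin] at this
      exact_mod_cast this
    calc ∫⁻ z, ENNReal.ofReal (((N : ℝ)⁻¹ * ∑ i, g κ s (z i)) ^ 2)
          ∂(Measure.pi fun _ : {i // ¬ κ i ≠ k} => Q)
        = ENNReal.ofReal ((N : ℝ)⁻¹ ^ 2) *
          ∫⁻ z, ENNReal.ofReal ((∑ i, g κ s (z i)) ^ 2)
          ∂(Measure.pi fun _ : {i // ¬ κ i ≠ k} => Q) := by
          rw [← lintegral_const_mul' _ _ ENNReal.ofReal_ne_top]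
          simp only [mul_pow, ENNReal.ofReal_mul (sq_nonneg (N : ℝ)⁻¹)]
      _ = ENNReal.ofReal ((N : ℝ)⁻¹ ^ 2) * (Fintype.card {i // ¬ κ i ≠ k} *
          ∫⁻ z, ENNReal.ofReal (g κ s z ^ 2) ∂Q) := by rw [lintegral_pi_sum_sq hmem (h0 κ s)]
      _ ≤ ENNReal.ofReal ((N : ℝ)⁻¹ ^ 2) * (ENNReal.ofReal N *
          ∫⁻ z, ENNReal.ofReal (g κ s z ^ 2) ∂Q) := by
          rw [ENNReal.ofReal_natCast]
          gcongr
      _ = ENNReal.ofReal (N : ℝ)⁻¹ * ∫⁻ z, ENNReal.ofReal (g κ s z ^ 2) ∂Q := by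
          rw [← mul_assoc, ← ENNReal.ofReal_mul (by positivity)]
          congr 2
          field_simp

/-- The conditional first absolute moment of a cross-fitted mean is at most `E|g(Z)|`, in the form
required by `BigOPENN.of_setLIntegral_le`. -/
theorem setLIntegral_foldMean_abs_le
    (hD_meas : ∀ i, Measurable (D i)) (hD_law : ∀ i, P.map (D i) = Q) (hD_indep : iIndepFun D P)
    {fold : Ω → Fin N → Fin K} (hfold_meas : Measurable fold)
    (hfold_indep : IndepFun fold (fun ω i => D i ω) P) {k : Fin K}
    {g : ∀ κ : Fin N → Fin K, ({i // κ i ≠ k} → α) → α → ℝ}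
    (hg : ∀ κ, Measurable (Function.uncurry (g κ))) (hN : 0 < N) {u : ℝ≥0∞} (hu : u ≠ ⊤) :
    ∫⁻ ω in {ω | ∫⁻ z, ENNReal.ofReal |g (fold ω) (fun j => D j ω) z| ∂Q ≤ u},
      ENNReal.ofReal |foldMean g (fold ω) (fun i => D i ω)| ∂P ≤ u := by
  have hU : ∀ κ, Measurable fun s => ∫⁻ z, ENNReal.ofReal |g κ s z| ∂Q := fun κ =>
    ((continuous_abs.measurable.comp (hg κ)).ennreal_ofReal.lintegral_prod_right')
  refine setLIntegral_fold_le hD_meas hD_law hD_indep hfold_meas hfold_indep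
    (U := fun κ d => ∫⁻ z, ENNReal.ofReal |g κ (fun j => d j) z| ∂Q)
    (W := fun κ d => ENNReal.ofReal |foldMean g κ d|)
    (fun κ => (hU κ).comp (measurable_pi_lambda _ fun j => measurable_pi_apply _))
    (fun κ => (continuous_abs.measurable.comp (measurable_foldMean hg κ)).ennreal_ofReal)
    fun κ => ?_
  simp only [foldMean_eq]
  have hNpos : (0 : ℝ) < N := by exact_mod_cast hN
  refine setLIntegral_heldOut_le (Q := Q) κ k (hU κ)
    (W := fun q => ENNReal.ofReal |(N : ℝ)⁻¹ * ∑ i, g κ q.1 (q.2 i)|) ?_ (fun s hs => ?_) hu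
  · refine (continuous_abs.measurable.comp
      ((Finset.measurable_sum _ fun i _ => ?_).const_mul _)).ennreal_ofReal
    exact (hg κ).comp (measurable_fst.prodMk ((measurable_pi_apply i).comp measurable_snd))
  · have hgs : Measurable (g κ s) := (hg κ).comp measurable_prodMk_left
    have habs : Measurable fun z => ENNReal.ofReal |g κ s z| :=
      (continuous_abs.measurable.comp hgs).ennreal_ofReal
    have hcard : (Fintype.card {i // ¬ κ i ≠ k} : ℝ≥0∞) ≤ N := by
      have := Fintype.card_subtype_le fun i : Fin N => ¬ κ i ≠ k
      rw [Fintype.card_fin] at this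
      exact_mod_cast this
    calc ∫⁻ z, ENNReal.ofReal |(N : ℝ)⁻¹ * ∑ i, g κ s (z i)| ∂(Measure.pi fun _ => Q)
        ≤ ∫⁻ z, ENNReal.ofReal (N : ℝ)⁻¹ * ∑ i : {i // ¬ κ i ≠ k},
            ENNReal.ofReal |g κ s (z i)| ∂(Measure.pi fun _ => Q) := by
          refine lintegral_mono fun z => ?_
          simp only []
          rw [abs_mul, abs_of_pos (inv_pos.2 hNpos), ENNReal.ofReal_mul (by positivity),
            ← ENNReal.ofReal_sum_of_nonneg fun i _ => abs_nonneg _]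
          gcongr
          exact Finset.abs_sum_le_sum_abs _ _
      _ = ENNReal.ofReal (N : ℝ)⁻¹ * ∑ i : {i // ¬ κ i ≠ k},
            ∫⁻ z, ENNReal.ofReal |g κ s (z i)| ∂(Measure.pi fun _ => Q) := by
          rw [lintegral_const_mul' _ _ ENNReal.ofReal_ne_top, lintegral_finsetSum]
          exact fun i _ => habs.comp (measurable_pi_apply i)
      _ = ENNReal.ofReal (N : ℝ)⁻¹ * (Fintype.card {i // ¬ κ i ≠ k} *
            ∫⁻ z, ENNReal.ofReal |g κ s z| ∂Q) := by
          have : ∀ i : {i // ¬ κ i ≠ k},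
              ∫⁻ z, ENNReal.ofReal |g κ s (z i)| ∂(Measure.pi fun _ => Q)
                = ∫⁻ z, ENNReal.ofReal |g κ s z| ∂Q := fun i =>
            (measurePreserving_eval (fun _ : {i // ¬ κ i ≠ k} => Q) i).lintegral_comp habs
          simp [this]
      _ ≤ ENNReal.ofReal (N : ℝ)⁻¹ * (ENNReal.ofReal N *
            ∫⁻ z, ENNReal.ofReal |g κ s z| ∂Q) := by
          rw [ENNReal.ofReal_natCast]
          gcongr
      _ = ∫⁻ z, ENNReal.ofReal |g κ s z| ∂Q := by
          rw [← mul_assoc, ← ENNReal.ofReal_mul (by positivity), inv_mul_cancel₀ hNpos.ne']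
          simp

end CrossFitting

/-! ### Conditional laws given the covariates -/

section Disintegration

variable {p : ℕ}

@[fun_prop]
theorem measurable_labelR : Measurable (labelR (p := p)) := measurable_fst

@[fun_prop]
theorem measurable_outcome : Measurable (outcome (p := p)) := measurable_fst.comp measurable_snd

attribute [fun_prop] measurable_covar

variable {Q : Measure (Triple p)} [IsProbabilityMeasure Q]

instance isProbabilityMeasure_lawX : IsProbabilityMeasure (lawX Q) :=
  Measure.isProbabilityMeasure_map measurable_covar.aemeasurable

@[fun_prop]
theorem measurable_propensity : Measurable (propensity Q) :=
  (StronglyMeasurable.integral_condDistrib (f := fun q : Cov p × ℝ => q.2)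
    measurable_snd.stronglyMeasurable).measurable

@[fun_prop]
theorem measurable_outcomeMean : Measurable (outcomeMean Q) :=
  (StronglyMeasurable.integral_condDistrib (f := fun q : Cov p × ℝ => q.2)
    measurable_snd.stronglyMeasurable).measurable

theorem ae_covar {Q : Measure (Triple p)} {q : Cov p → Prop} (h : ∀ᵐ x ∂(lawX Q), q x) :
    ∀ᵐ z ∂Q, q (covar z) :=
  ae_of_ae_map measurable_covar.aemeasurable h

theorem lintegral_covar {Q : Measure (Triple p)} {F : Cov p → ℝ≥0∞} (hF : Measurable F) :
    ∫⁻ z, F (covar z) ∂Q = ∫⁻ x, F x ∂(lawX Q) := (lintegral_map hF measurable_covar).symm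

/-- The law of total expectation for nonnegative functions of `X` and a further variable. -/
theorem lintegral_covar_comp {Y : Triple p → ℝ} (hY : Measurable Y) {F : Cov p → ℝ → ℝ≥0∞}
    (hF : Measurable (Function.uncurry F)) :
    ∫⁻ z, F (covar z) (Y z) ∂Q
      = ∫⁻ x, ∫⁻ y, F x y ∂(condDistrib Y covar Q x) ∂(lawX Q) := by
  have h := compProd_map_condDistrib (μ := Q) (mβ := inferInstance) (X := covar) (Y := Y)
    hY.aemeasurable
  have h1 := Measure.lintegral_compProd (μ := Q.map covar) (κ := condDistrib Y covar Q) hF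
  rw [h, lintegral_map hF (measurable_covar.prodMk hY)] at h1
  exact h1

/-- A function with vanishing conditional mean given `X` has integral zero; without integrability
this holds because the integral is then zero by convention. -/
theorem integral_covar_comp_eq_zero {Y : Triple p → ℝ} (hY : Measurable Y) {F : Cov p → ℝ → ℝ}
    (hF : Measurable (Function.uncurry F))
    (h0 : ∀ᵐ x ∂(lawX Q), ∫ y, F x y ∂(condDistrib Y covar Q x) = 0) :
    ∫ z, F (covar z) (Y z) ∂Q = 0 := by
  by_cases hint : Integrable (fun z => F (covar z) (Y z)) Q
  swap
  · exact integral_undef hint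
  have h := compProd_map_condDistrib (μ := Q) (mβ := inferInstance) (X := covar) (Y := Y)
    hY.aemeasurable
  have hXY : AEMeasurable (fun z => (covar z, Y z)) Q :=
    (measurable_covar.prodMk hY).aemeasurable
  have hint' : Integrable (Function.uncurry F) (Q.map fun z => (covar z, Y z)) :=
    (integrable_map_measure hF.aestronglyMeasurable hXY).2 hint
  have h1 := integral_map hXY (f := Function.uncurry F) hF.aestronglyMeasurable
  rw [← h] at hint' h1
  rw [Measure.integral_compProd hint'] at h1
  refine h1.symm.trans ?_
  exact integral_eq_zero_of_ae h0

/-- Ignorability as a disintegration: given `X`, the law of `(R, Y)` is a product. -/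
theorem map_covar_label_outcome (h_ign : Ignorability Q) :
    Q.map (fun z => (covar z, labelR z, outcome z)) =
      lawX Q ⊗ₘ (condDistrib labelR covar Q ×ₖ condDistrib outcome covar Q) := by
  rw [Measure.compProd_eq_comp_prod]
  exact (condIndepFun_iff_map_prod_eq_prod_condDistrib_prod_condDistrib measurable_labelR
    measurable_outcome measurable_covar).1 h_ign

theorem ae_condDistrib_label (hR : ∀ᵐ z ∂Q, labelR z = 0 ∨ labelR z = 1) :
    ∀ᵐ x ∂(lawX Q), ∀ᵐ r ∂(condDistrib labelR covar Q x), r = 0 ∨ r = 1 := by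
  have h := compProd_map_condDistrib (μ := Q) (mβ := inferInstance) (X := covar) (Y := labelR)
    measurable_labelR.aemeasurable
  refine Measure.ae_ae_of_ae_compProd (p := fun q : Cov p × ℝ => q.2 = 0 ∨ q.2 = 1) ?_
  have hs : MeasurableSet {q : Cov p × ℝ | q.2 = 0 ∨ q.2 = 1} :=
    (measurableSet_eq_fun measurable_snd measurable_const).union
      (measurableSet_eq_fun measurable_snd measurable_const)
  rw [lawX, h, ae_map_iff (by fun_prop) hs]
  exact hR

theorem ae_integrable_label (hR : ∀ᵐ z ∂Q, labelR z = 0 ∨ labelR z = 1) :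
    ∀ᵐ x ∂(lawX Q), Integrable (fun r : ℝ => r) (condDistrib labelR covar Q x) := by
  filter_upwards [ae_condDistrib_label hR] with x hx
  refine Integrable.of_bound measurable_id.aestronglyMeasurable 1 ?_
  filter_upwards [hx] with r hr
  rcases hr with rfl | rfl <;> simp

theorem ae_lintegral_label (hR : ∀ᵐ z ∂Q, labelR z = 0 ∨ labelR z = 1) :
    ∀ᵐ x ∂(lawX Q), ∫⁻ r, ENNReal.ofReal r ∂(condDistrib labelR covar Q x)
      = ENNReal.ofReal (propensity Q x) := by
  filter_upwards [ae_condDistrib_label hR, ae_integrable_label hR] with x hx hi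
  refine (ofReal_integral_eq_lintegral_ofReal hi ?_).symm
  filter_upwards [hx] with r hr
  rcases hr with rfl | rfl <;> simp

theorem ae_propensity_le_one (hR : ∀ᵐ z ∂Q, labelR z = 0 ∨ labelR z = 1) :
    ∀ᵐ x ∂(lawX Q), propensity Q x ≤ 1 := by
  filter_upwards [ae_condDistrib_label hR, ae_integrable_label hR] with x hx hi
  have : ∫ r, r ∂(condDistrib labelR covar Q x) ≤ ∫ _, (1 : ℝ) ∂(condDistrib labelR covar Q x) := by
    refine integral_mono_ae hi (integrable_const _) ?_
    filter_upwards [hx] with r hr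
    rcases hr with rfl | rfl <;> simp
  simpa [propensity] using this

/-- Ignorability in integrated form: `E[R F(X, Y)] = E[π(X) E[F(X, Y) | X]]`. -/
theorem lintegral_label_mul (hR : ∀ᵐ z ∂Q, labelR z = 0 ∨ labelR z = 1) (h_ign : Ignorability Q)
    {F : Cov p → ℝ → ℝ≥0∞} (hF : Measurable (Function.uncurry F)) :
    ∫⁻ z, ENNReal.ofReal (labelR z) * F (covar z) (outcome z) ∂Q
      = ∫⁻ x, ENNReal.ofReal (propensity Q x) *
          ∫⁻ y, F x y ∂(condDistrib outcome covar Q x) ∂(lawX Q) := by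
  let G : Cov p × ℝ × ℝ → ℝ≥0∞ := fun q => ENNReal.ofReal q.2.1 * F q.1 q.2.2
  have hG : Measurable G :=
    (measurable_fst.comp measurable_snd).ennreal_ofReal.mul
      (hF.comp (measurable_fst.prodMk (measurable_snd.comp measurable_snd)))
  have h1 := lintegral_map (μ := Q) hG
    (measurable_covar.prodMk (measurable_labelR.prodMk measurable_outcome))
  rw [map_covar_label_outcome h_ign, Measure.lintegral_compProd hG] at h1
  refine h1.symm.trans (lintegral_congr_ae ?_)
  filter_upwards [ae_lintegral_label hR] with x hx
  simp only [G, Kernel.prod_apply]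
  rw [lintegral_prod_mul (f := fun r => ENNReal.ofReal r) (g := fun y => F x y) (by fun_prop)
    (hF.comp measurable_prodMk_left).aemeasurable, hx]

theorem lintegral_label_mul_covar (hR : ∀ᵐ z ∂Q, labelR z = 0 ∨ labelR z = 1)
    (h_ign : Ignorability Q) {F : Cov p → ℝ≥0∞} (hF : Measurable F) :
    ∫⁻ z, ENNReal.ofReal (labelR z) * F (covar z) ∂Q
      = ∫⁻ x, ENNReal.ofReal (propensity Q x) * F x ∂(lawX Q) := by
  rw [lintegral_label_mul hR h_ign (F := fun x _ => F x) (hF.comp measurable_fst)]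
  simp

theorem ae_memLp_outcome (hY : MemLp outcome 2 Q) :
    ∀ᵐ x ∂(lawX Q), MemLp (fun y : ℝ => y) 2 (condDistrib outcome covar Q x) := by
  have hm : Measurable fun q : Cov p × ℝ => ENNReal.ofReal (q.2 ^ 2) := by fun_prop
  have h := lintegral_covar_comp (Q := Q) measurable_outcome
    (F := fun _ y => ENNReal.ofReal (y ^ 2)) hm
  have hfin : ∫⁻ z, ENNReal.ofReal (outcome z ^ 2) ∂Q ≠ ⊤ :=
    ((hasFiniteIntegral_iff_ofReal (ae_of_all _ fun z => sq_nonneg _)).1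
      hY.integrable_sq.hasFiniteIntegral).ne
  rw [h] at hfin
  filter_upwards [ae_lt_top (hm.lintegral_kernel_prod_right') hfin] with x hx
  rw [memLp_two_iff_integrable_sq (by fun_prop)]
  exact ⟨by fun_prop, (hasFiniteIntegral_iff_ofReal (ae_of_all _ fun z => sq_nonneg _)).2 hx⟩

/-- The bias-variance decomposition of the conditional mean squared error of a constant. -/
theorem ae_condSqError_const (hY : MemLp outcome 2 Q) :
    ∀ᵐ x ∂(lawX Q), ∀ c : ℝ,
      ∫⁻ y, ENNReal.ofReal ((y - c) ^ 2) ∂(condDistrib outcome covar Q x)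
        = condSqError Q (outcomeMean Q) x + ENNReal.ofReal ((outcomeMean Q x - c) ^ 2) := by
  filter_upwards [ae_memLp_outcome hY] with x hx c
  set ν := condDistrib outcome covar Q x
  have hy : Integrable (fun y : ℝ => y) ν := hx.integrable one_le_two
  have hsq : ∀ c : ℝ, Integrable (fun y : ℝ => (y - c) ^ 2) ν := fun c =>
    (hx.sub (memLp_const c)).integrable_sq
  have hm : ∫ y, (y - outcomeMean Q x) ∂ν = 0 := by
    rw [integral_sub hy (integrable_const _)]
    simp [outcomeMean, ν]
  have key : ∫ y, (y - c) ^ 2 ∂ν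
      = ∫ y, (y - outcomeMean Q x) ^ 2 ∂ν + (outcomeMean Q x - c) ^ 2 := by
    have : (fun y : ℝ => (y - c) ^ 2) = fun y => (y - outcomeMean Q x) ^ 2 +
        (2 * (outcomeMean Q x - c) * (y - outcomeMean Q x) + (outcomeMean Q x - c) ^ 2) :=
      funext fun y => by ring
    rw [this]
    have hl : Integrable (fun y : ℝ => 2 * (outcomeMean Q x - c) * (y - outcomeMean Q x)) ν :=
      (hy.sub (integrable_const _)).const_mul _
    have hr : Integrable (fun y : ℝ => 2 * (outcomeMean Q x - c) * (y - outcomeMean Q x) +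
        (outcomeMean Q x - c) ^ 2) ν := hl.add (integrable_const _)
    rw [integral_add (hsq _) hr, integral_add hl (integrable_const _),
      integral_const_mul, hm]
    simp
  rw [condSqError, ← ofReal_integral_eq_lintegral_ofReal (hsq c)
    (ae_of_all _ fun y => sq_nonneg _), ← ofReal_integral_eq_lintegral_ofReal (hsq _)
    (ae_of_all _ fun y => sq_nonneg _), key, ENNReal.ofReal_add _ (sq_nonneg _)]
  exact integral_nonneg fun y => sq_nonneg _

theorem integral_resid_eq_zero (hY : MemLp outcome 2 Q) :
    ∫ z, (outcome z - outcomeMean Q (covar z)) ∂Q = 0 := by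
  refine integral_covar_comp_eq_zero measurable_outcome (F := fun x y => y - outcomeMean Q x)
    (by fun_prop) ?_
  filter_upwards [ae_memLp_outcome hY] with x hx
  rw [integral_sub (hx.integrable one_le_two) (integrable_const _)]
  simp [outcomeMean]

theorem integral_one_sub_label_div_eq_zero (hR : ∀ᵐ z ∂Q, labelR z = 0 ∨ labelR z = 1)
    (hπ : ∀ᵐ x ∂(lawX Q), 0 < propensity Q x) {f : Cov p → ℝ} (hf : Measurable f) :
    ∫ z, f (covar z) * (1 - labelR z / propensity Q (covar z)) ∂Q = 0 := by
  refine integral_covar_comp_eq_zero measurable_labelR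
    (F := fun x r => f x * (1 - r / propensity Q x)) (by fun_prop) ?_
  filter_upwards [hπ, ae_integrable_label hR] with x hx hi
  rw [integral_const_mul, integral_sub (integrable_const _) (hi.div_const _), integral_div]
  simp only [integral_const, probReal_univ, smul_eq_mul, mul_one]
  rw [← propensity, div_self hx.ne', sub_self, mul_zero]

/-- Under ignorability the weighted residuals of the labelled data are centered. -/
theorem integral_label_mul_resid_eq_zero (h_ign : Ignorability Q) (hY : MemLp outcome 2 Q)
    {f : Cov p → ℝ} (hf : Measurable f) :
    ∫ z, labelR z * f (covar z) * (outcome z - outcomeMean Q (covar z)) ∂Q = 0 := by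
  let G : Cov p × ℝ × ℝ → ℝ := fun q => q.2.1 * f q.1 * (q.2.2 - outcomeMean Q q.1)
  have hG : Measurable G := by fun_prop
  by_cases hint : Integrable (fun z => G (covar z, labelR z, outcome z)) Q
  swap
  · exact integral_undef hint
  have hmeas : Measurable fun z : Triple p => (covar z, labelR z, outcome z) := by fun_prop
  have hint' := (integrable_map_measure hG.aestronglyMeasurable hmeas.aemeasurable).2 hint
  have h1 := integral_map (μ := Q) hmeas.aemeasurable hG.aestronglyMeasurable
  rw [map_covar_label_outcome h_ign] at hint' h1
  rw [Measure.integral_compProd hint'] at h1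
  refine h1.symm.trans (integral_eq_zero_of_ae ?_)
  filter_upwards [ae_memLp_outcome hY] with x hx
  simp only [G, Kernel.prod_apply]
  rw [integral_prod_mul (fun r => r * f x) (fun y => y - outcomeMean Q x),
    integral_sub (hx.integrable one_le_two) (integrable_const _)]
  simp [outcomeMean]

end Disintegration

/-! ### Moments of the terms of the expansion -/

section Moments

variable {p : ℕ} {Q : Measure (Triple p)} [IsProbabilityMeasure Q]

theorem condSqError_outcomeMean_le (hY : MemLp outcome 2 Q) {μ : Cov p → ℝ} {σ : ℝ}
    (hup : ∀ᵐ x ∂(lawX Q), condSqError Q μ x ≤ ENNReal.ofReal (σ ^ 2)) :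
    ∀ᵐ x ∂(lawX Q), condSqError Q (outcomeMean Q) x ≤ ENNReal.ofReal (σ ^ 2) := by
  filter_upwards [hup, ae_condSqError_const hY] with x hx h
  exact le_trans (le_of_le_of_eq le_self_add (h (μ x)).symm) hx

/-- By the bias-variance decomposition, a bound on the conditional squared error of `μ` also bounds
the misspecification `μ - m`. -/
theorem sq_sub_outcomeMean_le (hY : MemLp outcome 2 Q) {μ : Cov p → ℝ} {σ : ℝ}
    (hup : ∀ᵐ x ∂(lawX Q), condSqError Q μ x ≤ ENNReal.ofReal (σ ^ 2)) :
    ∀ᵐ x ∂(lawX Q), (μ x - outcomeMean Q x) ^ 2 ≤ σ ^ 2 := by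
  filter_upwards [hup, ae_condSqError_const hY] with x hx h
  have h1 : ENNReal.ofReal ((outcomeMean Q x - μ x) ^ 2) ≤ ENNReal.ofReal (σ ^ 2) :=
    le_trans (le_of_le_of_eq le_add_self (h (μ x)).symm) hx
  rw [ENNReal.ofReal_le_ofReal_iff (sq_nonneg _)] at h1
  linarith [h1, sq_nonneg (outcomeMean Q x - μ x), show (μ x - outcomeMean Q x) ^ 2 =
    (outcomeMean Q x - μ x) ^ 2 by ring]

theorem lintegral_inv_propensity (ha : 0 < aRate Q) :
    ∫⁻ x, (ENNReal.ofReal (propensity Q x))⁻¹ ∂(lawX Q) = ENNReal.ofReal (aRate Q)⁻¹ := by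
  rw [ENNReal.ofReal_inv_of_pos ha, aRate, ENNReal.ofReal_toReal, inv_inv]
  intro h
  simp [aRate, h] at ha

/-- `E{1 / π(X)} < ∞` forces `π(X) > 0` almost surely. -/
theorem ae_propensity_pos (ha : 0 < aRate Q) : ∀ᵐ x ∂(lawX Q), 0 < propensity Q x := by
  have hm : Measurable fun x => (ENNReal.ofReal (propensity Q x))⁻¹ :=
    measurable_propensity.ennreal_ofReal.inv
  have hfin : ∫⁻ x, (ENNReal.ofReal (propensity Q x))⁻¹ ∂(lawX Q) ≠ ⊤ := by
    rw [lintegral_inv_propensity ha]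
    exact ENNReal.ofReal_ne_top
  filter_upwards [ae_lt_top hm hfin] with x hx
  by_contra hcon
  rw [ENNReal.ofReal_of_nonpos (not_lt.1 hcon)] at hx
  simp at hx

theorem aRate_le_one (hR : ∀ᵐ z ∂Q, labelR z = 0 ∨ labelR z = 1) (ha : 0 < aRate Q) :
    aRate Q ≤ 1 := by
  have h1 : (1 : ℝ≥0∞) ≤ ENNReal.ofReal (aRate Q)⁻¹ := by
    rw [← lintegral_inv_propensity ha]
    calc (1 : ℝ≥0∞) = ∫⁻ _, 1 ∂(lawX Q) := by simp
      _ ≤ _ := by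
        refine lintegral_mono_ae ?_
        filter_upwards [ae_propensity_le_one hR] with x hx
        rw [ENNReal.one_le_inv]
        simpa using hx
  rw [ENNReal.one_le_ofReal] at h1
  exact (one_le_inv₀ ha).1 h1

theorem weightedSq_le (ha : 0 < aRate Q) {h : Cov p → ℝ} {B : ℝ} (hB : 0 ≤ B)
    (hh : ∀ᵐ x ∂(lawX Q), h x ^ 2 ≤ B) : weightedSq Q h ≤ ENNReal.ofReal B := by
  calc weightedSq Q h
      ≤ ∫⁻ x, ENNReal.ofReal (aRate Q * B) * (ENNReal.ofReal (propensity Q x))⁻¹ ∂(lawX Q) := by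
        refine lintegral_mono_ae ?_
        filter_upwards [hh, ae_propensity_pos ha] with x hx hπ
        rw [← ENNReal.ofReal_inv_of_pos hπ, ← ENNReal.ofReal_mul (by positivity)]
        refine ENNReal.ofReal_le_ofReal ?_
        calc aRate Q / propensity Q x * h x ^ 2 ≤ aRate Q / propensity Q x * B := by gcongr
          _ = aRate Q * B * (propensity Q x)⁻¹ := by ring
    _ = ENNReal.ofReal B := by
        rw [lintegral_const_mul' _ _ ENNReal.ofReal_ne_top, lintegral_inv_propensity ha,
          ← ENNReal.ofReal_mul (by positivity)]
        congr 1
        field_simp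

/-- Second moment of `h(X) {1 - R / π(X)}`, bounded by means of
`(1 - R / π)² ≤ 1 + R / π²` and `E(R / π² | X) = 1 / π`. -/
theorem lintegral_sq_one_sub_label_div_le (hR : ∀ᵐ z ∂Q, labelR z = 0 ∨ labelR z = 1)
    (h_ign : Ignorability Q) (ha : 0 < aRate Q) {h : Cov p → ℝ} (hh : Measurable h) :
    ∫⁻ z, ENNReal.ofReal ((h (covar z) * (1 - labelR z / propensity Q (covar z))) ^ 2) ∂Q
      ≤ ENNReal.ofReal (2 * (aRate Q)⁻¹) * weightedSq Q h := by
  have hπ := ae_propensity_pos ha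
  calc ∫⁻ z, ENNReal.ofReal ((h (covar z) * (1 - labelR z / propensity Q (covar z))) ^ 2) ∂Q
      ≤ ∫⁻ z, ENNReal.ofReal (h (covar z) ^ 2) + ENNReal.ofReal (labelR z) *
          ENNReal.ofReal (h (covar z) ^ 2 / propensity Q (covar z) ^ 2) ∂Q := by
        refine lintegral_mono_ae ?_
        filter_upwards [hR, ae_covar hπ] with z hz hπz
        have hz0 : 0 ≤ labelR z := by rcases hz with hz | hz <;> simp [hz]
        have hzz : labelR z ^ 2 = labelR z := by rcases hz with hz | hz <;> simp [hz]
        rw [← ENNReal.ofReal_mul hz0, ← ENNReal.ofReal_add (by positivity) (by positivity)]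
        refine ENNReal.ofReal_le_ofReal ?_
        have : (1 - labelR z / propensity Q (covar z)) ^ 2
            ≤ 1 + labelR z / propensity Q (covar z) ^ 2 := by
          have h1 : (labelR z / propensity Q (covar z)) ^ 2
              = labelR z / propensity Q (covar z) ^ 2 := by rw [div_pow, hzz]
          have h2 : 0 ≤ labelR z / propensity Q (covar z) := by positivity
          nlinarith
        calc (h (covar z) * (1 - labelR z / propensity Q (covar z))) ^ 2
            = h (covar z) ^ 2 * (1 - labelR z / propensity Q (covar z)) ^ 2 := by ring
          _ ≤ h (covar z) ^ 2 * (1 + labelR z / propensity Q (covar z) ^ 2) := by gcongr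
          _ = _ := by ring
    _ = ∫⁻ x, ENNReal.ofReal (h x ^ 2) + ENNReal.ofReal (propensity Q x) *
          ENNReal.ofReal (h x ^ 2 / propensity Q x ^ 2) ∂(lawX Q) := by
        rw [lintegral_add_left (by fun_prop), lintegral_add_left (by fun_prop),
          lintegral_covar (F := fun x => ENNReal.ofReal (h x ^ 2)) (by fun_prop),
          lintegral_label_mul_covar hR h_ign
            (F := fun x => ENNReal.ofReal (h x ^ 2 / propensity Q x ^ 2)) (by fun_prop)]
    _ ≤ ∫⁻ x, ENNReal.ofReal (2 * (aRate Q)⁻¹) *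
          ENNReal.ofReal (aRate Q / propensity Q x * h x ^ 2) ∂(lawX Q) := by
        refine lintegral_mono_ae ?_
        filter_upwards [hπ, ae_propensity_le_one hR] with x hx hx1
        rw [← ENNReal.ofReal_mul hx.le, ← ENNReal.ofReal_add (by positivity) (by positivity),
          ← ENNReal.ofReal_mul (by positivity)]
        refine ENNReal.ofReal_le_ofReal ?_
        have h1 : h x ^ 2 ≤ h x ^ 2 / propensity Q x := by
          rw [le_div_iff₀ hx]
          nlinarith [sq_nonneg (h x)]
        have h2 : propensity Q x * (h x ^ 2 / propensity Q x ^ 2) = h x ^ 2 / propensity Q x := by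
          field_simp
        have h3 : 2 * (aRate Q)⁻¹ * (aRate Q / propensity Q x * h x ^ 2)
            = 2 * (h x ^ 2 / propensity Q x) := by field_simp
        linarith
    _ = ENNReal.ofReal (2 * (aRate Q)⁻¹) * weightedSq Q h := by
        rw [lintegral_const_mul' _ _ ENNReal.ofReal_ne_top, weightedSq]

/-- First moment of `R / e(X) |h(X)|`. -/
theorem lintegral_abs_label_div_mul_le (hR : ∀ᵐ z ∂Q, labelR z = 0 ∨ labelR z = 1)
    (h_ign : Ignorability Q) {e : Cov p → ℝ} (he : Measurable e) {C : ℝ} (hC : 0 ≤ C)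
    (hov : ∀ᵐ x ∂(lawX Q), 0 < e x ∧ propensity Q x ≤ C * e x)
    {h : Cov p → ℝ} (hh : Measurable h) :
    ∫⁻ z, ENNReal.ofReal |labelR z / e (covar z) * h (covar z)| ∂Q
      ≤ ENNReal.ofReal C * ∫⁻ x, ENNReal.ofReal |h x| ∂(lawX Q) := by
  have habs : Measurable fun x => |h x| := continuous_abs.measurable.comp hh
  calc ∫⁻ z, ENNReal.ofReal |labelR z / e (covar z) * h (covar z)| ∂Q
      = ∫⁻ z, ENNReal.ofReal (labelR z) *
          ENNReal.ofReal (|h (covar z)| / e (covar z)) ∂Q := by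
        refine lintegral_congr_ae ?_
        filter_upwards [hR, ae_covar hov] with z hz hov
        have hz0 : 0 ≤ labelR z := by rcases hz with hz | hz <;> simp [hz]
        rw [← ENNReal.ofReal_mul hz0, abs_mul, abs_div, abs_of_nonneg hz0, abs_of_pos hov.1]
        congr 1
        ring
    _ = ∫⁻ x, ENNReal.ofReal (propensity Q x) * ENNReal.ofReal (|h x| / e x) ∂(lawX Q) :=
        lintegral_label_mul_covar hR h_ign (F := fun x => ENNReal.ofReal (|h x| / e x))
          (by fun_prop)
    _ ≤ ∫⁻ x, ENNReal.ofReal C * ENNReal.ofReal |h x| ∂(lawX Q) := by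
        refine lintegral_mono_ae ?_
        filter_upwards [hov] with x hx
        rw [← ENNReal.ofReal_mul hC, ← ENNReal.ofReal_mul' (by have := hx.1; positivity)]
        refine ENNReal.ofReal_le_ofReal ?_
        rw [mul_div_assoc', div_le_iff₀ hx.1]
        nlinarith [mul_le_mul_of_nonneg_right hx.2 (abs_nonneg (h x))]
    _ = _ := lintegral_const_mul' _ _ ENNReal.ofReal_ne_top

/-- Second moment of `R / e(X) h(X) {Y - m(X)}`. -/
theorem lintegral_sq_label_div_mul_resid_le (hR : ∀ᵐ z ∂Q, labelR z = 0 ∨ labelR z = 1)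
    (h_ign : Ignorability Q) (ha : 0 < aRate Q) {e : Cov p → ℝ} (he : Measurable e)
    {C σ : ℝ} (hov : ∀ᵐ x ∂(lawX Q), 0 < e x ∧ propensity Q x ≤ C * e x)
    (hup : ∀ᵐ x ∂(lawX Q), condSqError Q (outcomeMean Q) x ≤ ENNReal.ofReal (σ ^ 2))
    {h : Cov p → ℝ} (hh : Measurable h) :
    ∫⁻ z, ENNReal.ofReal ((labelR z / e (covar z) * h (covar z) *
        (outcome z - outcomeMean Q (covar z))) ^ 2) ∂Q
      ≤ ENNReal.ofReal (C ^ 2 * σ ^ 2 * (aRate Q)⁻¹) * weightedSq Q h := by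
  calc ∫⁻ z, ENNReal.ofReal ((labelR z / e (covar z) * h (covar z) *
        (outcome z - outcomeMean Q (covar z))) ^ 2) ∂Q
      = ∫⁻ z, ENNReal.ofReal (labelR z) * (ENNReal.ofReal ((h (covar z) / e (covar z)) ^ 2) *
          ENNReal.ofReal ((outcome z - outcomeMean Q (covar z)) ^ 2)) ∂Q := by
        refine lintegral_congr_ae ?_
        filter_upwards [hR] with z hz
        have hz0 : 0 ≤ labelR z := by rcases hz with hz | hz <;> simp [hz]
        have hzz : labelR z ^ 2 = labelR z := by rcases hz with hz | hz <;> simp [hz]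
        rw [← ENNReal.ofReal_mul (sq_nonneg _), ← ENNReal.ofReal_mul hz0]
        congr 1
        rw [mul_pow, mul_pow, div_pow, hzz]
        ring
    _ = ∫⁻ x, ENNReal.ofReal (propensity Q x) * (ENNReal.ofReal ((h x / e x) ^ 2) *
          condSqError Q (outcomeMean Q) x) ∂(lawX Q) := by
        rw [lintegral_label_mul hR h_ign (F := fun x y => ENNReal.ofReal ((h x / e x) ^ 2) *
          ENNReal.ofReal ((y - outcomeMean Q x) ^ 2)) (by fun_prop)]
        simp only [condSqError, lintegral_const_mul' _ _ ENNReal.ofReal_ne_top]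
    _ ≤ ∫⁻ x, ENNReal.ofReal (C ^ 2 * σ ^ 2 * (aRate Q)⁻¹) *
          ENNReal.ofReal (aRate Q / propensity Q x * h x ^ 2) ∂(lawX Q) := by
        refine lintegral_mono_ae ?_
        filter_upwards [hov, hup, ae_propensity_pos ha] with x hx hσ hπ
        obtain ⟨hex, hCx⟩ := hx
        calc ENNReal.ofReal (propensity Q x) * (ENNReal.ofReal ((h x / e x) ^ 2) *
              condSqError Q (outcomeMean Q) x)
            ≤ ENNReal.ofReal (propensity Q x) * (ENNReal.ofReal ((h x / e x) ^ 2) *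
              ENNReal.ofReal (σ ^ 2)) := by gcongr
          _ ≤ _ := by
            rw [← ENNReal.ofReal_mul (sq_nonneg _), ← ENNReal.ofReal_mul hπ.le,
              ← ENNReal.ofReal_mul (by positivity)]
            refine ENNReal.ofReal_le_ofReal ?_
            have h1 : propensity Q x * ((h x / e x) ^ 2 * σ ^ 2)
                = (propensity Q x / e x) ^ 2 * (σ ^ 2 * h x ^ 2 / propensity Q x) := by
              field_simp
            have h2 : C ^ 2 * σ ^ 2 * (aRate Q)⁻¹ * (aRate Q / propensity Q x * h x ^ 2)
                = C ^ 2 * (σ ^ 2 * h x ^ 2 / propensity Q x) := by field_simp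
            rw [h1, h2]
            have h3 : propensity Q x / e x ≤ C := by rwa [div_le_iff₀ hex]
            gcongr
    _ = _ := by rw [lintegral_const_mul' _ _ ENNReal.ofReal_ne_top, weightedSq]

theorem integral_label_div_mul_resid_eq_zero (h_ign : Ignorability Q) (hY : MemLp outcome 2 Q)
    {e h : Cov p → ℝ} (he : Measurable e) (hh : Measurable h) :
    ∫ z, labelR z / e (covar z) * h (covar z) * (outcome z - outcomeMean Q (covar z)) ∂Q = 0 := by
  rw [← integral_label_mul_resid_eq_zero h_ign hY (f := fun x => h x / e x) (by fun_prop)]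
  congr 1
  ext z
  ring

end Moments

section Score

variable {p : ℕ} {Q : Measure (Triple p)} [IsProbabilityMeasure Q]

theorem memLp_two_of_lintegral_sq_le {α : Type*} [MeasurableSpace α] {ν : Measure α} {f : α → ℝ}
    (hf : Measurable f) {B : ℝ} (h : ∫⁻ z, ENNReal.ofReal (f z ^ 2) ∂ν ≤ ENNReal.ofReal B) :
    MemLp f 2 ν := by
  rw [memLp_two_iff_integrable_sq hf.aestronglyMeasurable]
  refine ⟨(hf.pow_const 2).aestronglyMeasurable, ?_⟩
  rw [hasFiniteIntegral_iff_ofReal (ae_of_all _ fun z => sq_nonneg _)]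
  exact h.trans_lt ENNReal.ofReal_lt_top

theorem integral_sq_le_of_lintegral_sq_le {α : Type*} [MeasurableSpace α] {ν : Measure α}
    {f : α → ℝ} (hf : Measurable f) {B : ℝ} (hB : 0 ≤ B)
    (h : ∫⁻ z, ENNReal.ofReal (f z ^ 2) ∂ν ≤ ENNReal.ofReal B) : ∫ z, f z ^ 2 ∂ν ≤ B := by
  have h1 := ofReal_integral_eq_lintegral_ofReal (memLp_two_of_lintegral_sq_le hf h).integrable_sq
    (ae_of_all _ fun z => sq_nonneg (f z))
  rw [← h1] at h
  exact (ENNReal.ofReal_le_ofReal_iff hB).1 h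

theorem integral_add_add {α : Type*} [MeasurableSpace α] {ν : Measure α} {f g h : α → ℝ}
    (hf : Integrable f ν) (hg : Integrable g ν) (hh : Integrable h ν) :
    ∫ z, (f z + (g z + h z)) ∂ν = ∫ z, f z ∂ν + (∫ z, g z ∂ν + ∫ z, h z ∂ν) := by
  have hgh : Integrable (fun z => g z + h z) ν := hg.add hh
  rw [integral_add hf hgh, integral_add hg hh]

/-- `Var{m(X)} ≤ Var(Y)`. -/
theorem lintegral_sq_outcomeMean_sub_theta0_le (hY : MemLp outcome 2 Q) :
    ∫⁻ z, ENNReal.ofReal ((outcomeMean Q (covar z) - theta0 Q) ^ 2) ∂Q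
      ≤ ENNReal.ofReal Var[outcome; Q] := by
  rw [ofReal_variance hY, evariance_eq_lintegral_ofReal,
    lintegral_covar (F := fun x => ENNReal.ofReal ((outcomeMean Q x - theta0 Q) ^ 2))
      (by fun_prop),
    lintegral_covar_comp measurable_outcome
      (F := fun _ y => ENNReal.ofReal ((y - ∫ z, outcome z ∂Q) ^ 2)) (by fun_prop)]
  refine lintegral_mono_ae ?_
  filter_upwards [ae_condSqError_const hY] with x hx
  rw [hx]
  exact le_add_self

theorem integral_outcomeMean_sub_theta0 (hY : MemLp outcome 2 Q) :
    ∫ z, (outcomeMean Q (covar z) - theta0 Q) ∂Q = 0 := by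
  have hA : MemLp (fun z => outcomeMean Q (covar z) - theta0 Q) 2 Q :=
    memLp_two_of_lintegral_sq_le (by fun_prop) (lintegral_sq_outcomeMean_sub_theta0_le hY)
  have hAi := hA.integrable one_le_two
  have hYi := hY.integrable one_le_two
  have h1 := integral_resid_eq_zero hY
  have h2 : (fun z => outcomeMean Q (covar z) - theta0 Q) =
      fun z => (outcome z - theta0 Q) - (outcome z - outcomeMean Q (covar z)) := by
    ext z; ring
  have hres : Integrable (fun z => outcome z - outcomeMean Q (covar z)) Q := by
    have := (hYi.sub hAi).sub (integrable_const (theta0 Q))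
    refine this.congr (ae_of_all _ fun z => ?_)
    simp only [Pi.sub_apply]
    ring
  have hc : Integrable (fun z => outcome z - theta0 Q) Q := hYi.sub (integrable_const _)
  rw [h2, integral_sub hc hres, h1, integral_sub hYi (integrable_const _)]
  simp [theta0]

@[fun_prop]
theorem measurable_score {Q : Measure (Triple p)} {μ e : Cov p → ℝ} (hμ : Measurable μ)
    (he : Measurable e) : Measurable (score Q μ e) := by
  unfold score
  fun_prop

/-- The score splits into `m(X) - θ₀`, the weighted residual, and the bias of `μ` times
`1 - R / π(X)`, when one of the two models is correct. -/
theorem score_ae_eq {μ e : Cov p → ℝ}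
    (hcase : μ =ᵐ[lawX Q] outcomeMean Q ∨ e =ᵐ[lawX Q] propensity Q) :
    score Q μ e =ᵐ[Q] fun z => (outcomeMean Q (covar z) - theta0 Q) +
      (labelR z / e (covar z) * 1 * (outcome z - outcomeMean Q (covar z)) +
        (μ (covar z) - outcomeMean Q (covar z)) * (1 - labelR z / propensity Q (covar z))) := by
  rcases hcase with h | h
  · filter_upwards [ae_covar h] with z hz
    rw [score, hz]
    ring
  · filter_upwards [ae_covar h] with z hz
    rw [score, hz]
    ring

variable {μ e : Cov p → ℝ} {σ₁ σ₂ C : ℝ}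

/-- Second moments of the three parts of the score in `score_ae_eq`. The factor `1` keeps the middle
part in the form `R / e(X) h(X) {Y - m(X)}` of the moment lemmas, with `h = 1`. -/
theorem lintegral_sq_score_terms_le (hR : ∀ᵐ z ∂Q, labelR z = 0 ∨ labelR z = 1)
    (h_ign : Ignorability Q) (hb : BasicAssumption Q μ σ₁ σ₂) (ha : 0 < aRate Q)
    (hμ : Measurable μ) (he : Measurable e)
    (hov : ∀ᵐ x ∂(lawX Q), 0 < e x ∧ propensity Q x ≤ C * e x) :
    ∫⁻ z, ENNReal.ofReal ((outcomeMean Q (covar z) - theta0 Q) ^ 2) ∂Q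
        ≤ ENNReal.ofReal (σ₂ ^ 2 * (aRate Q)⁻¹) ∧
    ∫⁻ z, ENNReal.ofReal ((labelR z / e (covar z) * 1 *
        (outcome z - outcomeMean Q (covar z))) ^ 2) ∂Q
        ≤ ENNReal.ofReal (C ^ 2 * σ₂ ^ 2 * (aRate Q)⁻¹) ∧
    ∫⁻ z, ENNReal.ofReal (((μ (covar z) - outcomeMean Q (covar z)) *
        (1 - labelR z / propensity Q (covar z))) ^ 2) ∂Q
        ≤ ENNReal.ofReal (2 * σ₂ ^ 2 * (aRate Q)⁻¹) := by
  have hup := condSqError_outcomeMean_le hb.memLp_outcome hb.upper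
  have ha1 : 1 ≤ (aRate Q)⁻¹ := (one_le_inv₀ ha).2 (aRate_le_one hR ha)
  refine ⟨?_, ?_, ?_⟩
  · refine (lintegral_sq_outcomeMean_sub_theta0_le hb.memLp_outcome).trans
      (ENNReal.ofReal_le_ofReal (hb.var_outcome_le.trans ?_))
    nlinarith [sq_nonneg σ₂]
  · refine (lintegral_sq_label_div_mul_resid_le hR h_ign ha he hov hup (h := fun _ => 1)
      measurable_const).trans ?_
    refine (mul_le_mul_right (weightedSq_le ha zero_le_one (by simp)) _).trans ?_
    simp
  · refine (lintegral_sq_one_sub_label_div_le hR h_ign ha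
      (h := fun x => μ x - outcomeMean Q x) (by fun_prop)).trans ?_
    refine (mul_le_mul_right (weightedSq_le ha (sq_nonneg σ₂)
      (sq_sub_outcomeMean_le hb.memLp_outcome hb.upper)) _).trans ?_
    rw [← ENNReal.ofReal_mul (by positivity)]
    exact ENNReal.ofReal_le_ofReal (le_of_eq (by ring))

/-- The score is square integrable and centered, with variance at most a multiple of `a⁻¹`, when one
of the models is correct. -/
theorem score_moments (hR : ∀ᵐ z ∂Q, labelR z = 0 ∨ labelR z = 1)
    (h_ign : Ignorability Q) (hb : BasicAssumption Q μ σ₁ σ₂) (ha : 0 < aRate Q)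
    (hμ : Measurable μ) (he : Measurable e)
    (hov : ∀ᵐ x ∂(lawX Q), 0 < e x ∧ propensity Q x ≤ C * e x)
    (hcase : μ =ᵐ[lawX Q] outcomeMean Q ∨ e =ᵐ[lawX Q] propensity Q) :
    MemLp (score Q μ e) 2 Q ∧ ∫ z, score Q μ e z ∂Q = 0 ∧
      ∫ z, score Q μ e z ^ 2 ∂Q ≤ 3 * (3 + C ^ 2) * σ₂ ^ 2 * (aRate Q)⁻¹ := by
  obtain ⟨hA, hB, hD⟩ := lintegral_sq_score_terms_le hR h_ign hb ha hμ he hov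
  have hAm := memLp_two_of_lintegral_sq_le (by fun_prop) hA
  have hBm := memLp_two_of_lintegral_sq_le (by fun_prop) hB
  have hDm := memLp_two_of_lintegral_sq_le (by fun_prop) hD
  have hA' := integral_sq_le_of_lintegral_sq_le (by fun_prop) (by positivity) hA
  have hB' := integral_sq_le_of_lintegral_sq_le (by fun_prop) (by positivity) hB
  have hD' := integral_sq_le_of_lintegral_sq_le (by fun_prop) (by positivity) hD
  have hA0 := integral_outcomeMean_sub_theta0 hb.memLp_outcome
  have hB0 := integral_label_div_mul_resid_eq_zero h_ign hb.memLp_outcome he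
    (h := fun _ => 1) measurable_const
  have hD0 := integral_one_sub_label_div_eq_zero hR (ae_propensity_pos ha)
    (f := fun x => μ x - outcomeMean Q x) (by fun_prop)
  have hdec := score_ae_eq hcase
  have hmem := (hAm.add (hBm.add hDm)).ae_eq hdec.symm
  refine ⟨hmem, ?_, ?_⟩
  · rw [integral_congr_ae hdec, integral_add_add (hAm.integrable one_le_two)
      (hBm.integrable one_le_two) (hDm.integrable one_le_two), hA0, hB0, hD0]
    simp
  · have hi := hBm.integrable_sq.add hDm.integrable_sq
    calc ∫ z, score Q μ e z ^ 2 ∂Q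
        ≤ ∫ z, 3 * ((outcomeMean Q (covar z) - theta0 Q) ^ 2 +
          ((labelR z / e (covar z) * 1 * (outcome z - outcomeMean Q (covar z))) ^ 2 +
          ((μ (covar z) - outcomeMean Q (covar z)) *
            (1 - labelR z / propensity Q (covar z))) ^ 2)) ∂Q := by
          refine integral_mono_ae hmem.integrable_sq
            ((hAm.integrable_sq.add hi).const_mul 3) ?_
          filter_upwards [hdec] with z hz
          rw [hz]
          generalize outcomeMean Q (covar z) - theta0 Q = a
          generalize labelR z / e (covar z) * 1 * (outcome z - outcomeMean Q (covar z)) = b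
          generalize (μ (covar z) - outcomeMean Q (covar z)) *
            (1 - labelR z / propensity Q (covar z)) = c
          nlinarith [sq_nonneg (a - b), sq_nonneg (b - c), sq_nonneg (a - c)]
      _ = 3 * (∫ z, (outcomeMean Q (covar z) - theta0 Q) ^ 2 ∂Q +
          (∫ z, (labelR z / e (covar z) * 1 * (outcome z - outcomeMean Q (covar z))) ^ 2 ∂Q +
          ∫ z, ((μ (covar z) - outcomeMean Q (covar z)) *
            (1 - labelR z / propensity Q (covar z))) ^ 2 ∂Q)) := by
          rw [integral_const_mul, integral_add_add hAm.integrable_sq hBm.integrable_sq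
            hDm.integrable_sq]
      _ ≤ _ := by linarith

theorem scoreVar_eq {Q : Measure (Triple p)} (hμ : Measurable μ) (he : Measurable e)
    (h0 : ∫ z, score Q μ e z ∂Q = 0) : scoreVar Q μ e = ∫ z, score Q μ e z ^ 2 ∂Q :=
  variance_of_integral_eq_zero (measurable_score hμ he).aemeasurable h0

/-- Lower bound on the variance when both models are correct: the residual term is uncorrelated
with `m(X) - θ₀` and has variance `E[π(X)⁻¹ E{(Y - m(X))² | X}] ≥ σ₁² / a`. -/
theorem le_integral_sq_score (hR : ∀ᵐ z ∂Q, labelR z = 0 ∨ labelR z = 1)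
    (h_ign : Ignorability Q) (hb : BasicAssumption Q μ σ₁ σ₂) (ha : 0 < aRate Q)
    (hμ : Measurable μ) (he : Measurable e)
    (hμm : μ =ᵐ[lawX Q] outcomeMean Q) (heπ : e =ᵐ[lawX Q] propensity Q) :
    σ₁ ^ 2 * (aRate Q)⁻¹ ≤ ∫ z, score Q μ e z ^ 2 ∂Q := by
  have hπ := ae_propensity_pos ha
  have hov : ∀ᵐ x ∂(lawX Q), 0 < e x ∧ propensity Q x ≤ 1 * e x := by
    filter_upwards [hπ, heπ] with x hx h
    rw [h]
    exact ⟨hx, by simp⟩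
  obtain ⟨hA, hB, -⟩ := lintegral_sq_score_terms_le hR h_ign hb ha hμ he hov
  have hAm := memLp_two_of_lintegral_sq_le (by fun_prop) hA
  have hBm := memLp_two_of_lintegral_sq_le (by fun_prop) hB
  have hcross : ∫ z, (outcomeMean Q (covar z) - theta0 Q) *
      (labelR z / e (covar z) * 1 * (outcome z - outcomeMean Q (covar z))) ∂Q = 0 := by
    rw [← integral_label_div_mul_resid_eq_zero h_ign hb.memLp_outcome he
      (h := fun x => outcomeMean Q x - theta0 Q) (by fun_prop)]
    congr 1
    ext z
    ring
  have hcrossI : Integrable (fun z => (outcomeMean Q (covar z) - theta0 Q) *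
      (labelR z / e (covar z) * 1 * (outcome z - outcomeMean Q (covar z)))) Q :=
    hAm.integrable_mul hBm
  have hsq : ∫ z, score Q μ e z ^ 2 ∂Q = ∫ z, (outcomeMean Q (covar z) - theta0 Q) ^ 2 ∂Q +
      ∫ z, (labelR z / e (covar z) * 1 * (outcome z - outcomeMean Q (covar z))) ^ 2 ∂Q := by
    have hi : Integrable (fun z => 2 * ((outcomeMean Q (covar z) - theta0 Q) *
        (labelR z / e (covar z) * 1 * (outcome z - outcomeMean Q (covar z)))) +
        (labelR z / e (covar z) * 1 * (outcome z - outcomeMean Q (covar z))) ^ 2) Q :=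
      (hcrossI.const_mul 2).add hBm.integrable_sq
    calc ∫ z, score Q μ e z ^ 2 ∂Q
        = ∫ z, ((outcomeMean Q (covar z) - theta0 Q) ^ 2 +
          (2 * ((outcomeMean Q (covar z) - theta0 Q) *
          (labelR z / e (covar z) * 1 * (outcome z - outcomeMean Q (covar z)))) +
          (labelR z / e (covar z) * 1 * (outcome z - outcomeMean Q (covar z))) ^ 2)) ∂Q := by
          refine integral_congr_ae ?_
          filter_upwards [ae_covar hμm] with z hz
          rw [score, hz]
          ring
      _ = _ := by
          rw [integral_add hAm.integrable_sq hi, integral_add (hcrossI.const_mul 2)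
            hBm.integrable_sq, integral_const_mul, hcross]
          ring
  have hlow : ENNReal.ofReal (σ₁ ^ 2 * (aRate Q)⁻¹) ≤ ENNReal.ofReal
      (∫ z, (labelR z / e (covar z) * 1 * (outcome z - outcomeMean Q (covar z))) ^ 2 ∂Q) := by
    rw [ofReal_integral_eq_lintegral_ofReal hBm.integrable_sq (ae_of_all _ fun z => sq_nonneg _)]
    calc ENNReal.ofReal (σ₁ ^ 2 * (aRate Q)⁻¹)
        = ∫⁻ x, ENNReal.ofReal (σ₁ ^ 2) * (ENNReal.ofReal (propensity Q x))⁻¹ ∂(lawX Q) := by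
          rw [lintegral_const_mul' _ _ ENNReal.ofReal_ne_top, lintegral_inv_propensity ha,
            ENNReal.ofReal_mul (sq_nonneg _)]
      _ ≤ ∫⁻ x, ENNReal.ofReal (propensity Q x) * (ENNReal.ofReal ((e x)⁻¹ ^ 2) *
          condSqError Q (outcomeMean Q) x) ∂(lawX Q) := by
          refine lintegral_mono_ae ?_
          filter_upwards [hπ, heπ, hb.lower] with x hx hex hl
          rw [hex, ← mul_assoc, ← ENNReal.ofReal_mul hx.le, ← ENNReal.ofReal_inv_of_pos hx,
            mul_comm]
          have : propensity Q x * (propensity Q x)⁻¹ ^ 2 = (propensity Q x)⁻¹ := by field_simp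
          rw [this]
          gcongr
      _ = ∫⁻ z, ENNReal.ofReal (labelR z) * (ENNReal.ofReal ((e (covar z))⁻¹ ^ 2) *
          ENNReal.ofReal ((outcome z - outcomeMean Q (covar z)) ^ 2)) ∂Q := by
          rw [lintegral_label_mul hR h_ign (F := fun x y => ENNReal.ofReal ((e x)⁻¹ ^ 2) *
            ENNReal.ofReal ((y - outcomeMean Q x) ^ 2)) (by fun_prop)]
          simp only [condSqError, lintegral_const_mul' _ _ ENNReal.ofReal_ne_top]
      _ = _ := by
          refine lintegral_congr_ae ?_
          filter_upwards [hR] with z hz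
          have hz0 : 0 ≤ labelR z := by rcases hz with hz | hz <;> simp [hz]
          have hzz : labelR z ^ 2 = labelR z := by rcases hz with hz | hz <;> simp [hz]
          rw [← ENNReal.ofReal_mul (sq_nonneg _), ← ENNReal.ofReal_mul hz0]
          congr 1
          rw [mul_one, mul_pow, div_pow, hzz]
          ring
  rw [ENNReal.ofReal_le_ofReal_iff (integral_nonneg fun z => sq_nonneg _)] at hlow
  have : 0 ≤ ∫ z, (outcomeMean Q (covar z) - theta0 Q) ^ 2 ∂Q :=
    integral_nonneg fun z => sq_nonneg _
  linarith

end Score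

/-! ### The Lindeberg central limit theorem for row-wise i.i.d. arrays -/

section CentralLimit

theorem norm_cexp_sub_taylor_two_le_of_abs_le_one {u : ℝ} (hu : |u| ≤ 1) :
    ‖Complex.exp (u * Complex.I) - 1 - u * Complex.I + u ^ 2 / 2‖ ≤ 4 * |u| ^ 3 := by
  have h := Complex.norm_exp_sub_sum_le_norm_mul_exp (u * Complex.I) 3
  have hn : ‖(u : ℂ) * Complex.I‖ = |u| := by simp
  rw [hn] at h
  have hs : ∑ m ∈ Finset.range 3, ((u : ℂ) * Complex.I) ^ m / (m.factorial : ℂ)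
      = 1 + u * Complex.I - u ^ 2 / 2 := by
    simp [Finset.sum_range_succ, mul_pow, Nat.factorial]
    ring
  rw [hs] at h
  have he : Real.exp |u| ≤ 4 :=
    (Real.exp_le_exp.2 hu).trans (Real.exp_one_lt_d9.le.trans (by norm_num))
  calc ‖Complex.exp (u * Complex.I) - 1 - u * Complex.I + u ^ 2 / 2‖
      = ‖Complex.exp (u * Complex.I) - (1 + u * Complex.I - u ^ 2 / 2)‖ := by congr 1; ring
    _ ≤ |u| ^ 3 * Real.exp |u| := h
    _ ≤ |u| ^ 3 * 4 := by gcongr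
    _ = 4 * |u| ^ 3 := by ring

theorem norm_cexp_sub_taylor_two_le_of_one_le_abs {u : ℝ} (hu : 1 ≤ |u|) :
    ‖Complex.exp (u * Complex.I) - 1 - u * Complex.I + u ^ 2 / 2‖ ≤ 4 * u ^ 2 := by
  have h1 : ‖Complex.exp ((u : ℂ) * Complex.I)‖ = 1 := Complex.norm_exp_ofReal_mul_I u
  have h2 : ‖(u : ℂ) * Complex.I‖ = |u| := by simp
  have h3 : ‖(u : ℂ) ^ 2 / 2‖ = |u| ^ 2 / 2 := by simp
  have h4 := norm_add_le (Complex.exp (u * Complex.I) - 1 - u * Complex.I) ((u : ℂ) ^ 2 / 2)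
  have h5 := norm_sub_le (Complex.exp (u * Complex.I) - 1) (u * Complex.I)
  have h6 := norm_sub_le (Complex.exp ((u : ℂ) * Complex.I)) 1
  rw [h1, norm_one] at h6
  rw [← sq_abs u]
  nlinarith

theorem norm_cexp_sub_taylor_two_le_sq (u : ℝ) :
    ‖Complex.exp (u * Complex.I) - 1 - u * Complex.I + u ^ 2 / 2‖ ≤ 4 * u ^ 2 := by
  rcases le_total |u| 1 with hu | hu
  · refine (norm_cexp_sub_taylor_two_le_of_abs_le_one hu).trans ?_
    rw [← sq_abs u]
    nlinarith [sq_nonneg |u|]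
  · exact norm_cexp_sub_taylor_two_le_of_one_le_abs hu

theorem norm_cexp_sub_taylor_two_le_cube (u : ℝ) :
    ‖Complex.exp (u * Complex.I) - 1 - u * Complex.I + u ^ 2 / 2‖ ≤ 4 * |u| ^ 3 := by
  rcases le_total |u| 1 with hu | hu
  · exact norm_cexp_sub_taylor_two_le_of_abs_le_one hu
  · refine (norm_cexp_sub_taylor_two_le_of_one_le_abs hu).trans ?_
    rw [← sq_abs u]
    nlinarith [sq_nonneg |u|]

/-- Second order expansion of a characteristic function with a truncated second moment as
remainder. -/
theorem norm_charFun_sub_le {ν : Measure ℝ} [IsProbabilityMeasure ν]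
    (hν : MemLp (fun x : ℝ => x) 2 ν) (h0 : ∫ x, x ∂ν = 0) (h1 : ∫ x, x ^ 2 ∂ν = 1)
    {r δ : ℝ} (hr : 0 < r) (hδ : 0 ≤ δ) (t : ℝ) :
    ‖charFun ν (r⁻¹ * t) - (1 - t ^ 2 / (2 * r ^ 2) : ℝ)‖ ≤
      (4 * t ^ 2 * ∫ x in {x | δ * r < |x|}, x ^ 2 ∂ν + 4 * |t| ^ 3 * δ) / r ^ 2 := by
  have hi1 : Integrable (fun x : ℝ => x) ν := hν.integrable one_le_two
  have hi2 : Integrable (fun x : ℝ => x ^ 2) ν := hν.integrable_sq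
  set c : ℝ := r⁻¹ * t
  have hS : MeasurableSet {x : ℝ | δ * r < |x|} :=
    measurableSet_lt measurable_const continuous_abs.measurable
  have hexp : Integrable (fun x : ℝ => Complex.exp ((c * x : ℝ) * Complex.I)) ν := by
    refine Integrable.of_bound (by fun_prop) 1 (ae_of_all _ fun x => ?_)
    rw [Complex.norm_exp_ofReal_mul_I]
  have hlin : Integrable (fun x : ℝ => (c * x : ℝ) * Complex.I) ν :=
    ((hi1.const_mul c).ofReal).mul_const _
  have hquad : Integrable (fun x : ℝ => (((c * x) ^ 2 / 2 : ℝ) : ℂ)) ν := by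
    have : Integrable (fun x : ℝ => (c * x) ^ 2 / 2) ν := by
      simp only [mul_pow]
      exact (hi2.const_mul _).div_const _
    exact this.ofReal
  have hone : Integrable (fun _ : ℝ => (1 : ℂ)) ν := integrable_const _
  have key : charFun ν c - (1 - t ^ 2 / (2 * r ^ 2) : ℝ) = ∫ x : ℝ,
      (Complex.exp ((c * x : ℝ) * Complex.I) - 1 - (c * x : ℝ) * Complex.I
        + (((c * x) ^ 2 / 2 : ℝ) : ℂ)) ∂ν := by
    have e1 : Integrable (fun x : ℝ => Complex.exp ((c * x : ℝ) * Complex.I) - 1) ν :=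
      hexp.sub hone
    have e2 : Integrable (fun x : ℝ => Complex.exp ((c * x : ℝ) * Complex.I) - 1
        - (c * x : ℝ) * Complex.I) ν := e1.sub hlin
    have hc : c ^ 2 = t ^ 2 / r ^ 2 := by simp only [c]; field_simp
    have g1 : ∫ x : ℝ, ((c * x : ℝ) : ℂ) ∂ν = 0 := by
      have : ∫ x : ℝ, ((c * x : ℝ) : ℂ) ∂ν = ((∫ x : ℝ, c * x ∂ν : ℝ) : ℂ) := integral_ofReal
      rw [this, integral_const_mul, h0, mul_zero, Complex.ofReal_zero]
    have g2 : ∫ x : ℝ, (((c * x) ^ 2 / 2 : ℝ) : ℂ) ∂ν = ((t ^ 2 / (2 * r ^ 2) : ℝ) : ℂ) := by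
      have : ∫ x : ℝ, (((c * x) ^ 2 / 2 : ℝ) : ℂ) ∂ν
          = ((∫ x : ℝ, (c * x) ^ 2 / 2 ∂ν : ℝ) : ℂ) := integral_ofReal
      rw [this]
      congr 1
      simp only [mul_pow]
      rw [integral_div, integral_const_mul, h1, hc]
      field_simp
    rw [integral_add e2 hquad, integral_sub e1 hlin, integral_sub hexp hone,
      integral_mul_const, g1, g2, charFun_apply_real]
    push_cast
    simp
    ring
  rw [key]
  calc ‖∫ x : ℝ, (Complex.exp ((c * x : ℝ) * Complex.I) - 1 - (c * x : ℝ) * Complex.I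
        + (((c * x) ^ 2 / 2 : ℝ) : ℂ)) ∂ν‖
      ≤ ∫ x : ℝ, ({x : ℝ | δ * r < |x|}.indicator (fun x => 4 * c ^ 2 * x ^ 2) x
          + 4 * |t| ^ 3 * δ / r ^ 2 * x ^ 2) ∂ν := by
        refine norm_integral_le_of_norm_le
          (((hi2.const_mul _).indicator hS).add (hi2.const_mul _)) (ae_of_all _ fun x => ?_)
        have hcast : (((c * x) ^ 2 / 2 : ℝ) : ℂ) = ((c * x : ℝ) : ℂ) ^ 2 / 2 := by push_cast; ring
        rw [hcast]
        by_cases hx : δ * r < |x|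
        · rw [Set.indicator_of_mem (by exact hx)]
          refine (norm_cexp_sub_taylor_two_le_sq (c * x)).trans ?_
          have hpos : 0 ≤ 4 * |t| ^ 3 * δ / r ^ 2 * x ^ 2 := by positivity
          linarith [mul_pow c x 2]
        · rw [Set.indicator_of_notMem (by exact hx), zero_add]
          refine (norm_cexp_sub_taylor_two_le_cube (c * x)).trans ?_
          have hx' : |x| ≤ δ * r := not_lt.1 hx
          have h3 : |c * x| ^ 3 = |t| ^ 3 / r ^ 3 * (|x| * x ^ 2) := by
            simp only [c]
            rw [abs_mul, abs_mul, abs_inv, abs_of_pos hr, ← sq_abs x]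
            field_simp
          rw [h3]
          calc 4 * (|t| ^ 3 / r ^ 3 * (|x| * x ^ 2))
              ≤ 4 * (|t| ^ 3 / r ^ 3 * ((δ * r) * x ^ 2)) := by gcongr
            _ = 4 * |t| ^ 3 * δ / r ^ 2 * x ^ 2 := by field_simp
    _ = _ := by
        rw [integral_add ((hi2.const_mul _).indicator hS) (hi2.const_mul _),
          integral_indicator hS, integral_const_mul, integral_const_mul, h1]
        have : c ^ 2 = t ^ 2 / r ^ 2 := by simp only [c]; field_simp
        rw [this]
        field_simp

/-- The Lindeberg central limit theorem for row-wise i.i.d. arrays, in terms of characteristic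
functions. -/
theorem tendsto_charFun_of_lindeberg {Ω : ℕ → Type*} [∀ N, MeasurableSpace (Ω N)]
    {P : ∀ N, Measure (Ω N)} [∀ N, IsProbabilityMeasure (P N)] {X : ∀ N, Fin N → Ω N → ℝ}
    (hX : ∀ N i, Measurable (X N i)) (hindep : ∀ N, iIndepFun (X N) (P N))
    {ν : ℕ → Measure ℝ} [∀ N, IsProbabilityMeasure (ν N)]
    (hlaw : ∀ N i, (P N).map (X N i) = ν N)
    (hν : ∀ᶠ N in atTop, MemLp (fun x : ℝ => x) 2 (ν N))
    (h0 : ∀ᶠ N in atTop, ∫ x, x ∂(ν N) = 0) (h1 : ∀ᶠ N in atTop, ∫ x, x ^ 2 ∂(ν N) = 1)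
    (hlin : ∀ δ : ℝ, 0 < δ →
      Tendsto (fun N : ℕ => ∫ x in {x | δ * √N < |x|}, x ^ 2 ∂(ν N)) atTop (𝓝 0)) (t : ℝ) :
    Tendsto (fun N : ℕ => charFun ((P N).map fun ω => (√N)⁻¹ * ∑ i, X N i ω) t) atTop
      (𝓝 (Complex.exp (-t ^ 2 / 2))) := by
  have hchar : ∀ N : ℕ, charFun ((P N).map fun ω => (√N)⁻¹ * ∑ i, X N i ω) t
      = charFun (ν N) ((√N)⁻¹ * t) ^ N := by
    intro N
    rw [charFun_map_mul_comp (Finset.measurable_fun_sum _ fun i _ => hX N i).aemeasurable,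
      iIndepFun.charFun_map_fun_finsetSum_eq_prod (fun i _ => (hX N i).aemeasurable)
        ((hindep N).restrict _)]
    simp [hlaw]
  simp only [hchar]
  refine Complex.tendsto_pow_exp_of_isLittleO_sub_add_div _ ?_
  rw [Asymptotics.isLittleO_iff]
  intro c hc
  -- the cubic part of the remainder is made small by the choice of the truncation level
  set δ : ℝ := c / (2 * (4 * |t| ^ 3 + 1))
  have hδ : 0 < δ := by positivity
  have hδc : 4 * |t| ^ 3 * δ ≤ c / 2 := by
    simp only [δ]
    rw [mul_div_assoc', div_le_div_iff₀ (by positivity) (by positivity)]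
    nlinarith [pow_nonneg (abs_nonneg t) 3]
  have hsmall : ∀ᶠ N : ℕ in atTop,
      4 * t ^ 2 * ∫ x in {x | δ * √N < |x|}, x ^ 2 ∂(ν N) < c / 2 := by
    have := (hlin δ hδ).const_mul (4 * t ^ 2)
    rw [mul_zero] at this
    exact this.eventually_lt_const (half_pos hc)
  filter_upwards [hν, h0, h1, hsmall, eventually_gt_atTop 0] with N hνN h0N h1N hsN hN
  have hNpos : (0 : ℝ) < N := by exact_mod_cast hN
  have hb := norm_charFun_sub_le hνN h0N h1N (Real.sqrt_pos.2 hNpos) hδ.le t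
  rw [Real.sq_sqrt hNpos.le] at hb
  have hrhs : ((1 - t ^ 2 / (2 * N) : ℝ) : ℂ) = 1 + (-(t : ℂ) ^ 2 / 2) / N := by
    push_cast
    field_simp
    ring
  rw [hrhs] at hb
  refine hb.trans ?_
  rw [norm_div, norm_one, Complex.norm_natCast, mul_one_div]
  gcongr
  linarith

theorem norm_cexp_sub_cexp_le (a b : ℝ) :
    ‖Complex.exp (a * Complex.I) - Complex.exp (b * Complex.I)‖ ≤ |a - b| := by
  have h : Complex.exp (a * Complex.I) - Complex.exp (b * Complex.I)
      = Complex.exp (b * Complex.I) * (Complex.exp (Complex.I * (a - b : ℝ)) - 1) := by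
    rw [mul_sub, ← Complex.exp_add, mul_one]
    congr 2
    push_cast
    ring
  rw [h, norm_mul, Complex.norm_exp_ofReal_mul_I, one_mul]
  exact Real.norm_exp_I_mul_ofReal_sub_one_le

/-- Slutsky's lemma for characteristic functions, on probability spaces that vary with the index. -/
theorem tendsto_charFun_of_sub_tendsto_zero {Ω : ℕ → Type*} [∀ N, MeasurableSpace (Ω N)]
    {P : ∀ N, Measure (Ω N)} [∀ N, IsProbabilityMeasure (P N)] {X Y : ∀ N, Ω N → ℝ}
    (hX : ∀ N, Measurable (X N)) (hY : ∀ N, Measurable (Y N))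
    (hXY : ∀ ε : ℝ, 0 < ε → Tendsto (fun N => (P N).real {ω | ε < |Y N ω - X N ω|}) atTop (𝓝 0))
    {t : ℝ} {c : ℂ} (h : Tendsto (fun N => charFun ((P N).map (X N)) t) atTop (𝓝 c)) :
    Tendsto (fun N => charFun ((P N).map (Y N)) t) atTop (𝓝 c) := by
  have hdiff : Tendsto (fun N => charFun ((P N).map (Y N)) t - charFun ((P N).map (X N)) t)
      atTop (𝓝 0) := by
    rw [tendsto_zero_iff_norm_tendsto_zero, Metric.tendsto_nhds]
    intro η hη
    set ε : ℝ := η / (2 * (|t| + 1))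
    have hε : 0 < ε := by positivity
    have hεη : |t| * ε ≤ η / 2 := by
      simp only [ε]
      rw [mul_div_assoc', div_le_div_iff₀ (by positivity) (by positivity)]
      nlinarith [abs_nonneg t]
    have hs := (hXY ε hε).const_mul 2
    rw [mul_zero] at hs
    filter_upwards [hs.eventually_lt_const (half_pos hη)] with N hN
    rw [dist_zero_right, norm_norm]
    have hc : ∀ Z : Ω N → ℝ, Measurable Z → charFun ((P N).map Z) t
        = ∫ ω, Complex.exp ((t * Z ω : ℝ) * Complex.I) ∂(P N) := by
      intro Z hZ
      rw [charFun_apply_real, integral_map hZ.aemeasurable (by fun_prop)]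
      simp
    have hi : ∀ Z : Ω N → ℝ, Measurable Z →
        Integrable (fun ω => Complex.exp ((t * Z ω : ℝ) * Complex.I)) (P N) := by
      intro Z hZ
      refine Integrable.of_bound (by fun_prop) 1 (ae_of_all _ fun x => ?_)
      rw [Complex.norm_exp_ofReal_mul_I]
    have hS : MeasurableSet {ω | ε < |Y N ω - X N ω|} :=
      measurableSet_lt measurable_const
        (continuous_abs.measurable.comp ((hY N).sub (hX N)))
    rw [hc _ (hY N), hc _ (hX N), ← integral_sub (hi _ (hY N)) (hi _ (hX N))]
    calc ‖∫ ω, (Complex.exp ((t * Y N ω : ℝ) * Complex.I)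
          - Complex.exp ((t * X N ω : ℝ) * Complex.I)) ∂(P N)‖
        ≤ ∫ ω, (|t| * ε + {ω | ε < |Y N ω - X N ω|}.indicator (fun _ => 2) ω) ∂(P N) := by
          refine norm_integral_le_of_norm_le
            ((integrable_const _).add ((integrable_const _).indicator hS)) (ae_of_all _ fun ω => ?_)
          by_cases hω : ε < |Y N ω - X N ω|
          · rw [Set.indicator_of_mem (by exact hω)]
            have h1 := norm_sub_le (Complex.exp ((t * Y N ω : ℝ) * Complex.I))
              (Complex.exp ((t * X N ω : ℝ) * Complex.I))
            rw [Complex.norm_exp_ofReal_mul_I, Complex.norm_exp_ofReal_mul_I] at h1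
            have : 0 ≤ |t| * ε := by positivity
            linarith
          · rw [Set.indicator_of_notMem (by exact hω), add_zero]
            refine (norm_cexp_sub_cexp_le _ _).trans ?_
            rw [← mul_sub, abs_mul]
            gcongr
            exact not_lt.1 hω
      _ = |t| * ε + 2 * (P N).real {ω | ε < |Y N ω - X N ω|} := by
          rw [integral_add (integrable_const _) ((integrable_const _).indicator hS),
            integral_indicator hS]
          simp [mul_comm]
      _ < η := by linarith
  simpa using hdiff.add h

end CentralLimit

/-! ### Stochastic orders of cross-fitted means -/

section FoldOrders

/-- The sampling scheme: for each `N` an i.i.d. sample of size `N` from `Q N`, and a random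
assignment to `K` folds that is independent of the sample. -/
structure CrossFitSample {K : ℕ} {p : ℕ → ℕ} (Q : ∀ N, Measure (Triple (p N)))
    {Ω : ℕ → Type*} [∀ N, MeasurableSpace (Ω N)] (P : ∀ N, Measure (Ω N))
    (D : ∀ N, Fin N → Ω N → Triple (p N)) (fold : ∀ N, Ω N → Fin N → Fin K) : Prop where
  meas : ∀ N i, Measurable (D N i)
  law : ∀ N i, (P N).map (D N i) = Q N
  indep : ∀ N, iIndepFun (D N) (P N)
  fold_meas : ∀ N, Measurable (fold N)
  fold_indep : ∀ N, IndepFun (fold N) (fun ω i => D N i ω) (P N)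

variable {K : ℕ} {p : ℕ → ℕ} {Q : ∀ N, Measure (Triple (p N))}
  {Ω : ℕ → Type*} [∀ N, MeasurableSpace (Ω N)] {P : ∀ N, Measure (Ω N)}
  {D : ∀ N, Fin N → Ω N → Triple (p N)} {fold : ∀ N, Ω N → Fin N → Fin K}

theorem CrossFitSample.ae_forall (hs : CrossFitSample Q P D fold) {N : ℕ}
    {q : Triple (p N) → Prop} (hq : ∀ᵐ z ∂(Q N), q z) : ∀ᵐ ω ∂(P N), ∀ i, q (D N i ω) := by
  rw [ae_all_iff]
  intro i
  rw [← hs.law N i] at hq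
  exact ae_of_ae_map (hs.meas N i).aemeasurable hq

variable [∀ N, IsProbabilityMeasure (Q N)] [∀ N, IsProbabilityMeasure (P N)]

/-- Measurability of a function of the sample and of the assignment to folds need only be checked for
each of the finitely many assignments. -/
theorem measurable_comp_fold {α β Ω : Type*} [MeasurableSpace α] [MeasurableSpace β]
    [MeasurableSpace Ω] {N : ℕ} {D : Fin N → Ω → α} {fold : Ω → Fin N → Fin K}
    (hD : ∀ i, Measurable (D i)) (hfold : Measurable fold)
    {G : (Fin N → Fin K) → (Fin N → α) → β} (hG : ∀ κ, Measurable (G κ)) :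
    Measurable fun ω => G (fold ω) (fun i => D i ω) := by
  have h : Measurable (fun q : (Fin N → Fin K) × (Fin N → α) => G q.1 q.2) :=
    measurable_from_prod_countable_right hG
  exact h.comp (hfold.prodMk (measurable_pi_lambda _ hD))

theorem aRate_nonneg {p : ℕ} {Q : Measure (Triple p)} [IsProbabilityMeasure Q] : 0 ≤ aRate Q :=
  ENNReal.toReal_nonneg

/-- A cross-fitted mean of conditionally centered terms is of the order of the root of `N⁻¹` times
the conditional second moment. -/
theorem CrossFitSample.bigOP_foldMean_of_sq (hs : CrossFitSample Q P D fold) {k : Fin K}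
    {g : ∀ (N : ℕ) (κ : Fin N → Fin K), ({i // κ i ≠ k} → Triple (p N)) → Triple (p N) → ℝ}
    (hg : ∀ N κ, Measurable (Function.uncurry (g N κ)))
    (h0 : ∀ᶠ N in atTop, ∀ κ s, ∫ z, g N κ s z ∂(Q N) = 0)
    {W : ∀ N, Ω N → ℝ≥0∞} {b : ℕ → ℝ} (hW : BigOPENN P W (fun N => b N ^ 2))
    {B : ℝ} (hB : 0 ≤ B)
    (hle : ∀ᶠ N in atTop, ∀ ω,
      ∫⁻ z, ENNReal.ofReal (g N (fold N ω) (fun j => D N j ω) z ^ 2) ∂(Q N)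
        ≤ ENNReal.ofReal (B * (aRate (Q N))⁻¹) * W N ω) :
    BigOP P (fun N ω => foldMean (g N) (fold N ω) (fun i => D N i ω))
      (fun N => b N / √(N * aRate (Q N))) := by
  have hrate : ∀ N : ℕ, 0 ≤ (N : ℝ)⁻¹ * (B * (aRate (Q N))⁻¹) := fun N => by
    have := aRate_nonneg (Q := Q N)
    positivity
  have hU := hW.of_le_mul (c := fun N => (N : ℝ)⁻¹ * (B * (aRate (Q N))⁻¹))
    (W' := fun N ω => ENNReal.ofReal (N : ℝ)⁻¹ *
      ∫⁻ z, ENNReal.ofReal (g N (fold N ω) (fun j => D N j ω) z ^ 2) ∂(Q N))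
    (Eventually.of_forall hrate) <| by
      filter_upwards [hle] with N hN ω
      rw [ENNReal.ofReal_mul (by positivity), mul_assoc]
      gcongr
      exact hN ω
  have hS : BigOPENN P (fun N ω =>
      ENNReal.ofReal (foldMean (g N) (fold N ω) (fun i => D N i ω) ^ 2))
      (fun N => (√((N : ℝ)⁻¹ * (B * (aRate (Q N))⁻¹)) * b N) ^ 2) := by
    simp only [mul_pow, Real.sq_sqrt (hrate _)]
    refine hU.of_setLIntegral_le (fun N => ?_) ?_
    · exact ((measurable_comp_fold (hs.meas N) (hs.fold_meas N)
        (measurable_foldMean (hg N))).pow_const 2).ennreal_ofReal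
    · filter_upwards [h0, eventually_gt_atTop 0] with N h0N hN u hu
      exact setLIntegral_foldMean_sq_le (hs.meas N) (hs.law N) (hs.indep N) (hs.fold_meas N)
        (hs.fold_indep N) (hg N) h0N hN hu
  refine hS.bigOP_of_sq.mono_rate (√B) (Eventually.of_forall fun N => le_of_eq ?_)
  have : (N : ℝ)⁻¹ * (B * (aRate (Q N))⁻¹) = B / (N * aRate (Q N)) := by
    rw [div_eq_mul_inv, mul_inv]; ring
  rw [this, Real.sqrt_div hB, abs_mul, abs_div, abs_div, abs_of_nonneg (Real.sqrt_nonneg B)]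
  ring

/-- A cross-fitted mean is of the order of the conditional first absolute moment. -/
theorem CrossFitSample.bigOP_foldMean_of_abs (hs : CrossFitSample Q P D fold) {k : Fin K}
    {g : ∀ (N : ℕ) (κ : Fin N → Fin K), ({i // κ i ≠ k} → Triple (p N)) → Triple (p N) → ℝ}
    (hg : ∀ N κ, Measurable (Function.uncurry (g N κ))) {b : ℕ → ℝ}
    (hU : BigOPENN P (fun N ω =>
      ∫⁻ z, ENNReal.ofReal |g N (fold N ω) (fun j => D N j ω) z| ∂(Q N)) b) :
    BigOP P (fun N ω => foldMean (g N) (fold N ω) (fun i => D N i ω)) b := by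
  refine BigOPENN.bigOP_of_abs (hU.of_setLIntegral_le (fun N => ?_) ?_)
  · exact (continuous_abs.measurable.comp (measurable_comp_fold (hs.meas N) (hs.fold_meas N)
      (measurable_foldMean (hg N)))).ennreal_ofReal
  · filter_upwards [eventually_gt_atTop 0] with N hN u hu
    exact setLIntegral_foldMean_abs_le (hs.meas N) (hs.law N) (hs.indep N) (hs.fold_meas N)
      (hs.fold_indep N) (hg N) hN hu

/-- The means over the folds add up to a mean over the sample. -/
theorem sum_foldMean {α : Type*} {N : ℕ}
    (g : ∀ (k : Fin K) (κ : Fin N → Fin K), ({i // κ i ≠ k} → α) → α → ℝ)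
    (κ : Fin N → Fin K) (d : Fin N → α) :
    ∑ k, foldMean (g k) κ d = (N : ℝ)⁻¹ * ∑ i, g (κ i) κ (fun j => d j) (d i) := by
  simp only [foldMean, ← Finset.mul_sum]
  congr 1
  rw [← Finset.sum_fiberwise Finset.univ κ]
  refine Finset.sum_congr rfl fun k _ => Finset.sum_congr rfl fun i hi => ?_
  obtain rfl : κ i = k := (Finset.mem_filter.1 hi).2
  rfl

/-- The Cauchy-Schwarz inequality in `L²(P_X)`. -/
theorem lintegral_abs_mul_le {p : ℕ} {Q : Measure (Triple p)} {f g : Cov p → ℝ}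
    (hf : Measurable f) (hg : Measurable g) :
    ∫⁻ x, ENNReal.ofReal |f x * g x| ∂(lawX Q)
      ≤ plainSq Q f ^ (1 / 2 : ℝ) * plainSq Q g ^ (1 / 2 : ℝ) := by
  have h := ENNReal.lintegral_mul_le_Lp_mul_Lq (lawX Q) Real.HolderConjugate.two_two
    (f := fun x => ENNReal.ofReal |f x|) (g := fun x => ENNReal.ofReal |g x|)
    (continuous_abs.measurable.comp hf).ennreal_ofReal.aemeasurable
    (continuous_abs.measurable.comp hg).ennreal_ofReal.aemeasurable
  have hsq : ∀ y : ℝ, ENNReal.ofReal |y| ^ (2 : ℝ) = ENNReal.ofReal (y ^ 2) := fun y => by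
    rw [ENNReal.ofReal_rpow_of_nonneg (abs_nonneg y) (by norm_num)]
    simp
  simp only [Pi.mul_apply, hsq, ← ENNReal.ofReal_mul (abs_nonneg _), ← abs_mul] at h
  exact h

/-- An average of centered i.i.d. terms whose variance is at most `B / a` is of the order
`(N a)^{-1/2}`. -/
theorem CrossFitSample.bigOP_mean (hs : CrossFitSample Q P D fold)
    {f : ∀ N, Triple (p N) → ℝ} (hf : ∀ N, Measurable (f N)) {B : ℝ} (hB : 0 ≤ B)
    (hmom : ∀ᶠ N in atTop, MemLp (f N) 2 (Q N) ∧ ∫ z, f N z ∂(Q N) = 0 ∧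
      ∫ z, f N z ^ 2 ∂(Q N) ≤ B * (aRate (Q N))⁻¹) :
    BigOP P (fun N ω => (N : ℝ)⁻¹ * ∑ i, f N (D N i ω)) (fun N => 1 / √(N * aRate (Q N))) := by
  have hrate : ∀ N : ℕ, 0 ≤ (N : ℝ)⁻¹ * (B * (aRate (Q N))⁻¹) := fun N => by
    have := aRate_nonneg (Q := Q N)
    positivity
  have hS : BigOPENN P (fun N ω => ENNReal.ofReal (((N : ℝ)⁻¹ * ∑ i, f N (D N i ω)) ^ 2))
      (fun N => √((N : ℝ)⁻¹ * (B * (aRate (Q N))⁻¹)) ^ 2) := by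
    refine BigOPENN.of_lintegral_le (fun N => ?_) ?_
    · exact (((Finset.measurable_sum _ fun i _ => (hf N).comp (hs.meas N i)).const_mul
        _).pow_const 2).ennreal_ofReal
    · filter_upwards [hmom, eventually_gt_atTop 0] with N ⟨hmem, h0, hsq⟩ hN
      have hNpos : (0 : ℝ) < N := by exact_mod_cast hN
      have hlaw : (P N).map (fun ω i => D N i ω) = Measure.pi fun _ => Q N := by
        rw [(iIndepFun_iff_map_fun_eq_pi_map fun i => (hs.meas N i).aemeasurable).1 (hs.indep N)]
        simp only [hs.law]
      have hmeas : Measurable fun d : Fin N → Triple (p N) =>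
          ENNReal.ofReal (((N : ℝ)⁻¹ * ∑ i, f N (d i)) ^ 2) :=
        (((Finset.measurable_sum _ fun i _ => (hf N).comp (measurable_pi_apply i)).const_mul
          _).pow_const 2).ennreal_ofReal
      calc ∫⁻ ω, ENNReal.ofReal (((N : ℝ)⁻¹ * ∑ i, f N (D N i ω)) ^ 2) ∂(P N)
          = ∫⁻ d, ENNReal.ofReal (((N : ℝ)⁻¹ * ∑ i, f N (d i)) ^ 2)
              ∂(Measure.pi fun _ : Fin N => Q N) := by
            rw [← hlaw, lintegral_map hmeas (measurable_pi_lambda _ (hs.meas N))]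
        _ = ENNReal.ofReal ((N : ℝ)⁻¹ ^ 2) * (N * ∫⁻ z, ENNReal.ofReal (f N z ^ 2) ∂(Q N)) := by
            simp only [mul_pow, ENNReal.ofReal_mul (sq_nonneg (N : ℝ)⁻¹)]
            rw [lintegral_const_mul' _ _ ENNReal.ofReal_ne_top, lintegral_pi_sum_sq hmem h0,
              Fintype.card_fin]
        _ ≤ ENNReal.ofReal ((N : ℝ)⁻¹ ^ 2) * (N * ENNReal.ofReal (B * (aRate (Q N))⁻¹)) := by
            rw [← ofReal_integral_eq_lintegral_ofReal hmem.integrable_sq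
              (ae_of_all _ fun z => sq_nonneg _)]
            gcongr
        _ = ENNReal.ofReal (√((N : ℝ)⁻¹ * (B * (aRate (Q N))⁻¹)) ^ 2) := by
            rw [Real.sq_sqrt (hrate N), ← ENNReal.ofReal_natCast N,
              ← ENNReal.ofReal_mul (by positivity), ← ENNReal.ofReal_mul (by positivity)]
            congr 1
            field_simp
  refine hS.bigOP_of_sq.mono_rate (√B) (Eventually.of_forall fun N => le_of_eq ?_)
  have : (N : ℝ)⁻¹ * (B * (aRate (Q N))⁻¹) = B / (N * aRate (Q N)) := by
    rw [div_eq_mul_inv, mul_inv]; ring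
  rw [this, Real.sqrt_div hB, abs_div, abs_div, abs_of_nonneg (Real.sqrt_nonneg B), abs_one]
  ring

end FoldOrders

/-! ### The stochastic expansion of the estimator -/

section Expansion

/-- The function fitted outside fold `k`, as a function of the full training data alone. -/
def trainFit {K N p : ℕ} (f : Learner K N p) (k : Fin K) (κ : Fin N → Fin K)
    (s : {i // κ i ≠ k} → Triple p) : Cov p → ℝ :=
  f κ k (fun i => obs (s i))

theorem measurable_obs {p : ℕ} : Measurable (obs (p := p)) :=
  measurable_labelR.prodMk ((measurable_labelR.mul measurable_outcome).prodMk measurable_covar)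

theorem measurable_trainFit {K N p : ℕ} {f : Learner K N p}
    (hf : ∀ κ k, Measurable (Function.uncurry (f κ k))) (k : Fin K) (κ : Fin N → Fin K) :
    Measurable fun q : ({i // κ i ≠ k} → Triple p) × Triple p =>
      trainFit f k κ q.1 (covar q.2) := by
  have h : Measurable fun (q : ({i // κ i ≠ k} → Triple p) × Triple p) i => obs (q.1 i) :=
    measurable_pi_lambda _ fun i => measurable_obs.comp
      ((measurable_pi_apply i).comp measurable_fst)
  exact (hf κ k).comp (h.prodMk (measurable_covar.comp measurable_snd))

theorem measurable_trainFit_apply {K N p : ℕ} {f : Learner K N p}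
    (hf : ∀ κ k, Measurable (Function.uncurry (f κ k))) (k : Fin K) (κ : Fin N → Fin K)
    (s : {i // κ i ≠ k} → Triple p) : Measurable (trainFit f k κ s) :=
  (hf κ k).comp measurable_prodMk_left

variable {K : ℕ} {p : ℕ → ℕ} {Q : ∀ N, Measure (Triple (p N))} [∀ N, IsProbabilityMeasure (Q N)]
  {Ω : ℕ → Type*} [∀ N, MeasurableSpace (Ω N)] {P : ∀ N, Measure (Ω N)}
  [∀ N, IsProbabilityMeasure (P N)] {D : ∀ N, Fin N → Ω N → Triple (p N)}
  {fold : ∀ N, Ω N → Fin N → Fin K} {mhat pihat : ∀ N, Learner K N (p N)}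
  {μ e : ∀ N, Cov (p N) → ℝ} {σ₁ σ₂ C : ℝ} {cμ ce rμ re : ℕ → ℝ}

theorem CrossFitSample.bigOP_outcome_term (hs : CrossFitSample Q P D fold)
    (hR : ∀ N, ∀ᵐ z ∂(Q N), labelR z = 0 ∨ labelR z = 1) (h_ign : ∀ N, Ignorability (Q N))
    (ha : ∀ᶠ N in atTop, 0 < aRate (Q N))
    (hmhat : ∀ N κ k, Measurable (Function.uncurry (mhat N κ k))) (hμ : ∀ N, Measurable (μ N))
    {k : Fin K}
    (h_cμ : BigOPENN P (fun N ω => weightedSq (Q N) (fun x =>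
      fit (mhat N) (fold N ω) (fun i => D N i ω) k x - μ N x)) (fun N => cμ N ^ 2)) :
    BigOP P (fun N ω => foldMean (k := k) (fun κ s z =>
      (trainFit (mhat N) k κ s (covar z) - μ N (covar z)) *
        (1 - labelR z / propensity (Q N) (covar z))) (fold N ω) (fun i => D N i ω))
      (fun N => cμ N / √(N * aRate (Q N))) := by
  refine hs.bigOP_foldMean_of_sq (fun N κ => ?_) ?_ h_cμ zero_le_two ?_
  · have := measurable_trainFit (hmhat N) k κ
    have := hμ N
    simp only [Function.uncurry_def]
    fun_prop
  · filter_upwards [ha] with N haN κ s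
    have := measurable_trainFit_apply (hmhat N) k κ s
    have := hμ N
    exact integral_one_sub_label_div_eq_zero (hR N) (ae_propensity_pos haN)
      (f := fun x => trainFit (mhat N) k κ s x - μ N x) (by fun_prop)
  · filter_upwards [ha] with N haN ω
    have := measurable_trainFit_apply (hmhat N) k (fold N ω) (fun j => D N j ω)
    have := hμ N
    exact lintegral_sq_one_sub_label_div_le (hR N) (h_ign N) haN
      (h := fun x => trainFit (mhat N) k (fold N ω) (fun j => D N j ω) x - μ N x) (by fun_prop)

theorem CrossFitSample.bigOP_propensity_term (hs : CrossFitSample Q P D fold)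
    (hR : ∀ N, ∀ᵐ z ∂(Q N), labelR z = 0 ∨ labelR z = 1) (h_ign : ∀ N, Ignorability (Q N))
    (h_basic : ∀ N, BasicAssumption (Q N) (μ N) σ₁ σ₂)
    (ha : ∀ᶠ N in atTop, 0 < aRate (Q N))
    (hpihat : ∀ N κ k, Measurable (Function.uncurry (pihat N κ k))) (he : ∀ N, Measurable (e N))
    (hov : ∀ᶠ N in atTop, ∀ᵐ x ∂(lawX (Q N)), 0 < e N x ∧ propensity (Q N) x ≤ C * e N x)
    {k : Fin K}
    (h_ce : BigOPENN P (fun N ω => weightedSq (Q N) (fun x =>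
      1 - e N x / fit (pihat N) (fold N ω) (fun i => D N i ω) k x)) (fun N => ce N ^ 2)) :
    BigOP P (fun N ω => foldMean (k := k) (fun κ s z =>
      labelR z / e N (covar z) * (1 - e N (covar z) / trainFit (pihat N) k κ s (covar z)) *
        (outcome z - outcomeMean (Q N) (covar z))) (fold N ω) (fun i => D N i ω))
      (fun N => ce N / √(N * aRate (Q N))) := by
  refine hs.bigOP_foldMean_of_sq (fun N κ => ?_) (Eventually.of_forall fun N κ s => ?_) h_ce
    (B := C ^ 2 * σ₂ ^ 2) (by positivity) ?_
  · have := measurable_trainFit (hpihat N) k κ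
    have := he N
    simp only [Function.uncurry_def]
    fun_prop
  · have := measurable_trainFit_apply (hpihat N) k κ s
    have := he N
    exact integral_label_div_mul_resid_eq_zero (h_ign N) (h_basic N).memLp_outcome (he N)
      (h := fun x => 1 - e N x / trainFit (pihat N) k κ s x) (by fun_prop)
  · filter_upwards [ha, hov] with N haN hovN ω
    have := measurable_trainFit_apply (hpihat N) k (fold N ω) (fun j => D N j ω)
    have := he N
    exact lintegral_sq_label_div_mul_resid_le (hR N) (h_ign N) haN (he N) hovN
      (condSqError_outcomeMean_le (h_basic N).memLp_outcome (h_basic N).upper)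
      (h := fun x => 1 - e N x / trainFit (pihat N) k (fold N ω) (fun j => D N j ω) x)
      (by fun_prop)

/-- Cross-fitted means of `R / e(X) f(X) g(X)` are of the order of the product of the `L²` norms
of `f` and `g`, by the Cauchy-Schwarz inequality. -/
theorem CrossFitSample.bigOP_product_term (hs : CrossFitSample Q P D fold)
    (hR : ∀ N, ∀ᵐ z ∂(Q N), labelR z = 0 ∨ labelR z = 1) (h_ign : ∀ N, Ignorability (Q N))
    (he : ∀ N, Measurable (e N)) (hC : 0 ≤ C)
    (hov : ∀ᶠ N in atTop, ∀ᵐ x ∂(lawX (Q N)), 0 < e N x ∧ propensity (Q N) x ≤ C * e N x)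
    {k : Fin K}
    {f g : ∀ (N : ℕ) (κ : Fin N → Fin K), ({i // κ i ≠ k} → Triple (p N)) → Cov (p N) → ℝ}
    (hf : ∀ N κ, Measurable fun q : ({i // κ i ≠ k} → Triple (p N)) × Triple (p N) =>
      f N κ q.1 (covar q.2))
    (hf' : ∀ N κ s, Measurable (f N κ s))
    (hg : ∀ N κ, Measurable fun q : ({i // κ i ≠ k} → Triple (p N)) × Triple (p N) =>
      g N κ q.1 (covar q.2))
    (hg' : ∀ N κ s, Measurable (g N κ s)) {b₁ b₂ : ℕ → ℝ}
    (h₁ : BigOPENN P (fun N ω => plainSq (Q N) (f N (fold N ω) (fun j => D N j ω)))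
      (fun N => b₁ N ^ 2))
    (h₂ : BigOPENN P (fun N ω => plainSq (Q N) (g N (fold N ω) (fun j => D N j ω)))
      (fun N => b₂ N ^ 2)) :
    BigOP P (fun N ω => foldMean (k := k) (fun κ s z =>
      labelR z / e N (covar z) * (f N κ s (covar z) * g N κ s (covar z)))
      (fold N ω) (fun i => D N i ω)) (fun N => b₁ N * b₂ N) := by
  refine hs.bigOP_foldMean_of_abs (fun N κ => ?_) (h₁.sqrt_mul_sqrt h₂ hC ?_)
  · exact ((measurable_labelR.comp measurable_snd).div
      ((he N).comp (measurable_covar.comp measurable_snd))).mul ((hf N κ).mul (hg N κ))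
  · filter_upwards [hov] with N hovN ω
    have hf'' := hf' N (fold N ω) (fun j => D N j ω)
    have hg'' := hg' N (fold N ω) (fun j => D N j ω)
    refine (lintegral_abs_label_div_mul_le (hR N) (h_ign N) (he N) hC hovN
      (h := fun x => f N (fold N ω) (fun j => D N j ω) x *
        g N (fold N ω) (fun j => D N j ω) x) (by fun_prop)).trans ?_
    gcongr
    exact lintegral_abs_mul_le hf'' hg''

/-- The part of the expansion that is due to a misspecified model: its first summand vanishes when
`e = π` and its second when `μ = m`. -/
noncomputable def bias {K N p : ℕ} (Q : Measure (Triple p)) [IsProbabilityMeasure Q]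
    (μ e : Cov p → ℝ) (mhat pihat : Learner K N p) (κ : Fin N → Fin K)
    (d : Fin N → Triple p) : ℝ :=
  (N : ℝ)⁻¹ * ∑ i,
    ((crossFit mhat κ d i - μ (covar (d i))) *
        (labelR (d i) / propensity Q (covar (d i)) - labelR (d i) / e (covar (d i)))
      - labelR (d i) / e (covar (d i)) * (1 - e (covar (d i)) / crossFit pihat κ d i) *
        (outcomeMean Q (covar (d i)) - μ (covar (d i))))

/-- The estimation error minus the average score and the bias is the sum of a centered term for
each nuisance estimator and a product of the two nuisance errors. -/
theorem estimator_sub_scoreMean_sub_bias {N p : ℕ} {Q : Measure (Triple p)}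
    [IsProbabilityMeasure Q] {μ e : Cov p → ℝ} (mhat pihat : Learner K N p) (κ : Fin N → Fin K)
    {d : Fin N → Triple p} (hN : 0 < N) (hd : ∀ i, e (covar (d i)) ≠ 0) :
    estimator mhat pihat κ d - theta0 Q - scoreMean Q μ e d - bias Q μ e mhat pihat κ d
      = ∑ k, foldMean (k := k) (fun κ s z => (trainFit mhat k κ s (covar z) - μ (covar z)) *
          (1 - labelR z / propensity Q (covar z))) κ d
        + ∑ k, foldMean (k := k) (fun κ s z => labelR z / e (covar z) *
          ((trainFit mhat k κ s (covar z) - μ (covar z)) *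
            (1 - e (covar z) / trainFit pihat k κ s (covar z)))) κ d
        + -∑ k, foldMean (k := k) (fun κ s z => labelR z / e (covar z) *
          (1 - e (covar z) / trainFit pihat k κ s (covar z)) *
          (outcome z - outcomeMean Q (covar z))) κ d := by
  rw [sum_foldMean (fun k κ s z => (trainFit mhat k κ s (covar z) - μ (covar z)) *
      (1 - labelR z / propensity Q (covar z))),
    sum_foldMean (fun k κ s z => labelR z / e (covar z) *
      ((trainFit mhat k κ s (covar z) - μ (covar z)) *
        (1 - e (covar z) / trainFit pihat k κ s (covar z)))),
    sum_foldMean (fun k κ s z => labelR z / e (covar z) *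
      (1 - e (covar z) / trainFit pihat k κ s (covar z)) *
      (outcome z - outcomeMean Q (covar z)))]
  have hNpos : (0 : ℝ) < N := by exact_mod_cast hN
  have hθ : theta0 Q = (N : ℝ)⁻¹ * ∑ _i : Fin N, theta0 Q := by
    simp [hNpos.ne']
  simp only [estimator, scoreMean, bias]
  nth_rewrite 1 [hθ]
  simp only [← mul_add, ← mul_sub, ← mul_neg, ← Finset.sum_add_distrib, ← Finset.sum_sub_distrib,
    ← Finset.sum_neg_distrib]
  congr 1
  refine Finset.sum_congr rfl fun i _ => ?_
  have hi := hd i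
  have hm : trainFit mhat (κ i) κ (fun j => d j) (covar (d i)) = crossFit mhat κ d i := rfl
  have hp : trainFit pihat (κ i) κ (fun j => d j) (covar (d i)) = crossFit pihat κ d i := rfl
  rw [hm, hp]
  have hcancel : labelR (d i) / e (covar (d i)) *
      (1 - e (covar (d i)) / crossFit pihat κ d i)
      = labelR (d i) / e (covar (d i)) - labelR (d i) / crossFit pihat κ d i := by
    rw [mul_sub, mul_one, div_mul_div_cancel₀ hi]
  have hcancel' : labelR (d i) / e (covar (d i)) *
      ((crossFit mhat κ d i - μ (covar (d i))) *
        (1 - e (covar (d i)) / crossFit pihat κ d i))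
      = (crossFit mhat κ d i - μ (covar (d i))) *
        (labelR (d i) / e (covar (d i)) - labelR (d i) / crossFit pihat κ d i) := by
    rw [← hcancel]; ring
  rw [hcancel, hcancel', score]
  ring

/-- The expansion of the estimator under overlap: beyond the average score and the bias, a centered
term for each nuisance estimator and the product of the two nuisance errors remain. -/
theorem CrossFitSample.bigOP_remainder (hs : CrossFitSample Q P D fold)
    (hR : ∀ N, ∀ᵐ z ∂(Q N), labelR z = 0 ∨ labelR z = 1) (h_ign : ∀ N, Ignorability (Q N))
    (h_basic : ∀ N, BasicAssumption (Q N) (μ N) σ₁ σ₂)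
    (ha : ∀ᶠ N in atTop, 0 < aRate (Q N))
    (hmhat : ∀ N κ k, Measurable (Function.uncurry (mhat N κ k)))
    (hpihat : ∀ N κ k, Measurable (Function.uncurry (pihat N κ k)))
    (hμ : ∀ N, Measurable (μ N)) (he : ∀ N, Measurable (e N)) (hC : 0 ≤ C)
    (hov : ∀ᶠ N in atTop, ∀ᵐ x ∂(lawX (Q N)), 0 < e N x ∧ propensity (Q N) x ≤ C * e N x)
    (hcμ0 : ∀ N, 0 ≤ cμ N) (hce0 : ∀ N, 0 ≤ ce N)
    (hrμ0 : ∀ N, 0 ≤ rμ N) (hre0 : ∀ N, 0 ≤ re N)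
    (h_cμ : ∀ k : Fin K, BigOPENN P (fun N ω => weightedSq (Q N) (fun x =>
      fit (mhat N) (fold N ω) (fun i => D N i ω) k x - μ N x)) (fun N => cμ N ^ 2))
    (h_ce : ∀ k : Fin K, BigOPENN P (fun N ω => weightedSq (Q N) (fun x =>
      1 - e N x / fit (pihat N) (fold N ω) (fun i => D N i ω) k x)) (fun N => ce N ^ 2))
    (h_rμ : ∀ k : Fin K, BigOPENN P (fun N ω => plainSq (Q N) (fun x =>
      fit (mhat N) (fold N ω) (fun i => D N i ω) k x - μ N x)) (fun N => rμ N ^ 2))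
    (h_re : ∀ k : Fin K, BigOPENN P (fun N ω => plainSq (Q N) (fun x =>
      1 - e N x / fit (pihat N) (fold N ω) (fun i => D N i ω) k x)) (fun N => re N ^ 2)) :
    BigOP P (fun N ω => estimator (mhat N) (pihat N) (fold N ω) (fun i => D N i ω)
        - theta0 (Q N) - scoreMean (Q N) (μ N) (e N) (fun i => D N i ω)
        - bias (Q N) (μ N) (e N) (mhat N) (pihat N) (fold N ω) (fun i => D N i ω))
      (fun N => cμ N / √(N * aRate (Q N)) + ce N / √(N * aRate (Q N)) + rμ N * re N) := by
  have h1 := BigOP.sum Finset.univ fun k =>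
    hs.bigOP_outcome_term hR h_ign ha hmhat hμ (h_cμ k)
  have h2 := BigOP.sum Finset.univ fun k => hs.bigOP_product_term (k := k) hR h_ign he hC hov
    (f := fun N κ s x => trainFit (mhat N) k κ s x - μ N x)
    (g := fun N κ s x => 1 - e N x / trainFit (pihat N) k κ s x)
    (fun N κ => (measurable_trainFit (hmhat N) k κ).sub
      ((hμ N).comp (measurable_covar.comp measurable_snd)))
    (fun N κ s => (measurable_trainFit_apply (hmhat N) k κ s).sub (hμ N))
    (fun N κ => (((he N).comp (measurable_covar.comp measurable_snd)).div
      (measurable_trainFit (hpihat N) k κ)).const_sub 1)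
    (fun N κ s => ((he N).div (measurable_trainFit_apply (hpihat N) k κ s)).const_sub 1)
    (h_rμ k) (h_re k)
  have h3 := BigOP.sum Finset.univ fun k =>
    hs.bigOP_propensity_term hR h_ign h_basic ha hpihat he hov (h_ce k)
  have hnn : ∀ N, 0 ≤ cμ N / √(N * aRate (Q N)) ∧ 0 ≤ ce N / √(N * aRate (Q N)) ∧
      0 ≤ rμ N * re N := fun N =>
    ⟨div_nonneg (hcμ0 N) (Real.sqrt_nonneg _), div_nonneg (hce0 N) (Real.sqrt_nonneg _),
      mul_nonneg (hrμ0 N) (hre0 N)⟩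
  have key : ∀ {W : ∀ N, Ω N → ℝ} {b : ℕ → ℝ}, BigOP P W b → (∀ N, 0 ≤ b N) →
      (∀ N, b N ≤ cμ N / √(N * aRate (Q N)) + ce N / √(N * aRate (Q N)) + rμ N * re N) →
      BigOP P W
        (fun N => cμ N / √(N * aRate (Q N)) + ce N / √(N * aRate (Q N)) + rμ N * re N) := by
    intro W b h hb hle
    refine h.mono_rate 1 (Eventually.of_forall fun N => ?_)
    rw [abs_of_nonneg (hb N), abs_of_nonneg ((hb N).trans (hle N)), one_mul]
    exact hle N
  have h1' := key h1 (fun N => (hnn N).1) fun N => by linarith [hnn N]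
  have h2' := key h2 (fun N => (hnn N).2.2) fun N => by linarith [hnn N]
  have h3' := key h3 (fun N => (hnn N).2.1) fun N => by linarith [hnn N]
  refine ((h1'.add_same h2').add_same h3'.neg).congr ?_
  filter_upwards [hov, eventually_gt_atTop 0] with N hovN hN
  filter_upwards [hs.ae_forall (ae_covar hovN)] with ω hω
  exact estimator_sub_scoreMean_sub_bias (mhat N) (pihat N) (fold N ω) hN fun i => (hω i).1.ne'

end Expansion

/-! ### The bias under misspecification of one model -/

section Bias

theorem neInd_nonneg {p : ℕ} (ν : Measure (Cov p)) (f g : Cov p → ℝ) : 0 ≤ neInd ν f g := by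
  unfold neInd
  split_ifs <;> simp

theorem bias_eq_deltaPS {K N p : ℕ} {Q : Measure (Triple p)} [IsProbabilityMeasure Q]
    {μ e : Cov p → ℝ} (mhat pihat : Learner K N p) (κ : Fin N → Fin K) {d : Fin N → Triple p}
    (hd : ∀ i, e (covar (d i)) ≠ 0) (he : ∀ i, e (covar (d i)) = propensity Q (covar (d i))) :
    bias Q μ e mhat pihat κ d = deltaPS Q μ pihat κ d := by
  simp only [bias, deltaPS]
  congr 1
  refine Finset.sum_congr rfl fun i _ => ?_
  have hcancel : labelR (d i) / e (covar (d i)) * (1 - e (covar (d i)) / crossFit pihat κ d i)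
      = labelR (d i) / e (covar (d i)) - labelR (d i) / crossFit pihat κ d i := by
    rw [mul_sub, mul_one, div_mul_div_cancel₀ (hd i)]
  rw [hcancel, he i]
  ring

theorem bias_eq_deltaOR {K N p : ℕ} {Q : Measure (Triple p)} [IsProbabilityMeasure Q]
    {μ e : Cov p → ℝ} (mhat pihat : Learner K N p) (κ : Fin N → Fin K) {d : Fin N → Triple p}
    (hμ : ∀ i, μ (covar (d i)) = outcomeMean Q (covar (d i))) :
    bias Q μ e mhat pihat κ d = deltaOR Q e mhat κ d := by
  simp only [bias, deltaOR]
  congr 1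
  refine Finset.sum_congr rfl fun i _ => ?_
  rw [hμ i]
  ring

variable {K : ℕ} {p : ℕ → ℕ} {Q : ∀ N, Measure (Triple (p N))} [∀ N, IsProbabilityMeasure (Q N)]
  {Ω : ℕ → Type*} [∀ N, MeasurableSpace (Ω N)] {P : ∀ N, Measure (Ω N)}
  [∀ N, IsProbabilityMeasure (P N)] {D : ∀ N, Fin N → Ω N → Triple (p N)}
  {fold : ∀ N, Ω N → Fin N → Fin K} {mhat pihat : ∀ N, Learner K N (p N)}
  {μ e : ∀ N, Cov (p N) → ℝ} {σ₁ σ₂ C : ℝ} {rμ re : ℕ → ℝ}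

theorem overlap_of_correct_propensity (ha : ∀ᶠ N in atTop, 0 < aRate (Q N))
    (heπ : ∀ N, e N =ᵐ[lawX (Q N)] propensity (Q N)) :
    ∀ᶠ N in atTop, ∀ᵐ x ∂(lawX (Q N)), 0 < e N x ∧ propensity (Q N) x ≤ 1 * e N x := by
  filter_upwards [ha] with N haN
  filter_upwards [ae_propensity_pos haN, heπ N] with x hx h
  rw [h]
  exact ⟨hx, by simp⟩

/-- The constant `max 1 C` also covers the indices with `e = π`, where the ratio is `1`; the lower
bound on the ratio rules out nonpositive values of `e`. -/
theorem overlap_of_ratio_bounds (ha : ∀ᶠ N in atTop, 0 < aRate (Q N)) {c : ℝ} (hc : 0 < c)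
    (hov : ∀ N, ¬ e N =ᵐ[lawX (Q N)] propensity (Q N) →
      ∀ᵐ x ∂(lawX (Q N)), c ≤ propensity (Q N) x / e N x ∧ propensity (Q N) x / e N x ≤ C) :
    ∀ᶠ N in atTop, ∀ᵐ x ∂(lawX (Q N)),
      0 < e N x ∧ propensity (Q N) x ≤ max 1 C * e N x := by
  filter_upwards [ha] with N haN
  by_cases heπ : e N =ᵐ[lawX (Q N)] propensity (Q N)
  · filter_upwards [ae_propensity_pos haN, heπ] with x hx h
    rw [h]
    exact ⟨hx, le_mul_of_one_le_left hx.le (le_max_left _ _)⟩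
  · filter_upwards [ae_propensity_pos haN, hov N heπ] with x hx h
    have he : 0 < e N x := by
      have hpos : 0 < propensity (Q N) x / e N x := lt_of_lt_of_le hc h.1
      rcases div_pos_iff.1 hpos with h' | h'
      · exact h'.2
      · exact absurd h'.1 (not_lt.2 hx.le)
    refine ⟨he, ?_⟩
    rw [← div_le_iff₀ he]
    exact h.2.trans (le_max_right _ _)

/-- When `e = π` the bias is an average of products of the error of the propensity estimator with
`μ - m`, which is bounded by `σ₂` and vanishes when the outcome model is correct as well. -/
theorem CrossFitSample.bigOP_bias_of_correct_propensity (hs : CrossFitSample Q P D fold)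
    (hR : ∀ N, ∀ᵐ z ∂(Q N), labelR z = 0 ∨ labelR z = 1) (h_ign : ∀ N, Ignorability (Q N))
    (h_basic : ∀ N, BasicAssumption (Q N) (μ N) σ₁ σ₂)
    (ha : ∀ᶠ N in atTop, 0 < aRate (Q N))
    (hpihat : ∀ N κ k, Measurable (Function.uncurry (pihat N κ k)))
    (hμ : ∀ N, Measurable (μ N)) (he : ∀ N, Measurable (e N))
    (heπ : ∀ N, e N =ᵐ[lawX (Q N)] propensity (Q N))
    (h_re : ∀ k : Fin K, BigOPENN P (fun N ω => plainSq (Q N) (fun x =>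
      1 - e N x / fit (pihat N) (fold N ω) (fun i => D N i ω) k x)) (fun N => re N ^ 2)) :
    BigOP P (fun N ω =>
        bias (Q N) (μ N) (e N) (mhat N) (pihat N) (fold N ω) (fun i => D N i ω))
      (fun N => re N * neInd (lawX (Q N)) (μ N) (outcomeMean (Q N))) := by
  have hconst : BigOPENN P (fun N _ => plainSq (Q N) (fun x => μ N x - outcomeMean (Q N) x))
      (fun N => neInd (lawX (Q N)) (μ N) (outcomeMean (Q N)) ^ 2) := by
    refine BigOPENN.of_le_ofReal (M := σ₂ ^ 2) (Eventually.of_forall fun N ω => ?_) (sq_nonneg _)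
    calc plainSq (Q N) (fun x => μ N x - outcomeMean (Q N) x)
        ≤ ∫⁻ _, ENNReal.ofReal (σ₂ ^ 2 *
            neInd (lawX (Q N)) (μ N) (outcomeMean (Q N)) ^ 2) ∂(lawX (Q N)) := by
          refine lintegral_mono_ae ?_
          by_cases h : μ N =ᵐ[lawX (Q N)] outcomeMean (Q N)
          · filter_upwards [h] with x hx
            simp [hx]
          · filter_upwards [sq_sub_outcomeMean_le (h_basic N).memLp_outcome (h_basic N).upper]
              with x hx
            refine ENNReal.ofReal_le_ofReal ?_
            simpa [neInd, h] using hx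
      _ = _ := by simp
  have hov := overlap_of_correct_propensity ha heπ
  have h := BigOP.sum Finset.univ fun k => hs.bigOP_product_term (k := k) hR h_ign he
    zero_le_one hov
    (f := fun N κ s x => 1 - e N x / trainFit (pihat N) k κ s x)
    (g := fun N κ s x => μ N x - outcomeMean (Q N) x)
    (fun N κ => (((he N).comp (measurable_covar.comp measurable_snd)).div
      (measurable_trainFit (hpihat N) k κ)).const_sub 1)
    (fun N κ s => ((he N).div (measurable_trainFit_apply (hpihat N) k κ s)).const_sub 1)
    (fun N κ => ((hμ N).comp (measurable_covar.comp measurable_snd)).sub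
      (measurable_outcomeMean.comp (measurable_covar.comp measurable_snd)))
    (fun N κ s => (hμ N).sub measurable_outcomeMean) (h_re k) hconst
  refine h.congr ?_
  filter_upwards [hov] with N hovN
  filter_upwards [hs.ae_forall (ae_covar hovN), hs.ae_forall (ae_covar (heπ N))] with ω h1 h2
  rw [sum_foldMean (fun k κ s z => labelR z / e N (covar z) *
    ((1 - e N (covar z) / trainFit (pihat N) k κ s (covar z)) *
      (μ N (covar z) - outcomeMean (Q N) (covar z))))]
  simp only [bias]
  congr 1
  refine Finset.sum_congr rfl fun i _ => ?_
  have hp : trainFit (pihat N) (fold N ω i) (fold N ω) (fun j => D N j ω) (covar (D N i ω))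
    = crossFit (pihat N) (fold N ω) (fun i => D N i ω) i := rfl
  rw [hp, ← h2 i]
  ring

/-- When `μ = m` the bias is an average of products of the error of the outcome estimator with
`1 - π / e`, which is bounded under overlap and vanishes when the propensity model is correct as
well. -/
theorem CrossFitSample.bigOP_bias_of_correct_outcome (hs : CrossFitSample Q P D fold)
    (hR : ∀ N, ∀ᵐ z ∂(Q N), labelR z = 0 ∨ labelR z = 1) (h_ign : ∀ N, Ignorability (Q N))
    (ha : ∀ᶠ N in atTop, 0 < aRate (Q N))
    (hmhat : ∀ N κ k, Measurable (Function.uncurry (mhat N κ k)))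
    (hμ : ∀ N, Measurable (μ N)) (he : ∀ N, Measurable (e N)) (hC : 0 ≤ C)
    (hov : ∀ᶠ N in atTop, ∀ᵐ x ∂(lawX (Q N)), 0 < e N x ∧ propensity (Q N) x ≤ C * e N x)
    (hμm : ∀ N, μ N =ᵐ[lawX (Q N)] outcomeMean (Q N))
    (h_rμ : ∀ k : Fin K, BigOPENN P (fun N ω => plainSq (Q N) (fun x =>
      fit (mhat N) (fold N ω) (fun i => D N i ω) k x - μ N x)) (fun N => rμ N ^ 2)) :
    BigOP P (fun N ω =>
        bias (Q N) (μ N) (e N) (mhat N) (pihat N) (fold N ω) (fun i => D N i ω))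
      (fun N => rμ N * neInd (lawX (Q N)) (e N) (propensity (Q N))) := by
  have hconst : BigOPENN P (fun N _ => plainSq (Q N) (fun x => 1 - propensity (Q N) x / e N x))
      (fun N => neInd (lawX (Q N)) (e N) (propensity (Q N)) ^ 2) := by
    refine BigOPENN.of_le_ofReal (M := (1 + C) ^ 2) ?_ (sq_nonneg _)
    filter_upwards [hov, ha] with N hovN haN ω
    calc plainSq (Q N) (fun x => 1 - propensity (Q N) x / e N x)
        ≤ ∫⁻ _, ENNReal.ofReal ((1 + C) ^ 2 *
            neInd (lawX (Q N)) (e N) (propensity (Q N)) ^ 2) ∂(lawX (Q N)) := by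
          refine lintegral_mono_ae ?_
          by_cases h : e N =ᵐ[lawX (Q N)] propensity (Q N)
          · filter_upwards [h, hovN] with x hx hx'
            rw [← hx, div_self hx'.1.ne']
            simp
          · filter_upwards [hovN, ae_propensity_pos haN] with x hx hπ
            refine ENNReal.ofReal_le_ofReal ?_
            have h1 : propensity (Q N) x / e N x ≤ C := by rw [div_le_iff₀ hx.1]; exact hx.2
            have h2 : 0 ≤ propensity (Q N) x / e N x := div_nonneg hπ.le hx.1.le
            simp only [neInd, h, if_false, one_pow, mul_one]
            exact sq_le_sq' (by linarith) (by linarith)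
      _ = _ := by simp
  -- the bias is `R / π (m̂ - μ) (1 - π / e)`: here `π` itself serves as the working propensity
  have hself : ∀ᶠ N in atTop, ∀ᵐ x ∂(lawX (Q N)),
      0 < propensity (Q N) x ∧ propensity (Q N) x ≤ 1 * propensity (Q N) x :=
    ha.mono fun N haN => (ae_propensity_pos haN).mono fun x hx => ⟨hx, by simp⟩
  have h := BigOP.sum Finset.univ fun k => hs.bigOP_product_term (k := k) hR h_ign
    (e := fun N => propensity (Q N)) (fun N => measurable_propensity) zero_le_one hself
    (f := fun N κ s x => trainFit (mhat N) k κ s x - μ N x)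
    (g := fun N κ s x => 1 - propensity (Q N) x / e N x)
    (fun N κ => (measurable_trainFit (hmhat N) k κ).sub
      ((hμ N).comp (measurable_covar.comp measurable_snd)))
    (fun N κ s => (measurable_trainFit_apply (hmhat N) k κ s).sub (hμ N))
    (fun N κ => ((measurable_propensity.comp (measurable_covar.comp measurable_snd)).div
      ((he N).comp (measurable_covar.comp measurable_snd))).const_sub 1)
    (fun N κ s => (measurable_propensity.div (he N)).const_sub 1) (h_rμ k) hconst
  refine h.congr ?_
  filter_upwards [hself] with N hselfN
  filter_upwards [hs.ae_forall (ae_covar hselfN), hs.ae_forall (ae_covar (hμm N))] with ω h1 h2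
  rw [sum_foldMean (fun k κ s z => labelR z / propensity (Q N) (covar z) *
    ((trainFit (mhat N) k κ s (covar z) - μ N (covar z)) *
      (1 - propensity (Q N) (covar z) / e N (covar z))))]
  simp only [bias]
  congr 1
  refine Finset.sum_congr rfl fun i _ => ?_
  have hm : trainFit (mhat N) (fold N ω i) (fold N ω) (fun j => D N j ω) (covar (D N i ω))
    = crossFit (mhat N) (fold N ω) (fun i => D N i ω) i := rfl
  have hcancel : labelR (D N i ω) / propensity (Q N) (covar (D N i ω)) *
      (1 - propensity (Q N) (covar (D N i ω)) / e N (covar (D N i ω)))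
      = labelR (D N i ω) / propensity (Q N) (covar (D N i ω))
        - labelR (D N i ω) / e N (covar (D N i ω)) := by
    rw [mul_sub, mul_one, div_mul_div_cancel₀ (h1 i).1.ne']
  rw [hm, ← hcancel, h2 i]
  ring

end Bias

/-! ### Asymptotic normality of the average score -/

section AsymptoticNormality

variable {K : ℕ} {p : ℕ → ℕ} {Q : ∀ N, Measure (Triple (p N))} [∀ N, IsProbabilityMeasure (Q N)]
  {Ω : ℕ → Type*} [∀ N, MeasurableSpace (Ω N)] {P : ∀ N, Measure (Ω N)}
  [∀ N, IsProbabilityMeasure (P N)] {D : ∀ N, Fin N → Ω N → Triple (p N)}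
  {fold : ∀ N, Ω N → Fin N → Fin K}

/-- The Lindeberg central limit theorem for averages of functions of the sample, standardized by
their variance `V`. -/
theorem CrossFitSample.tendsto_charFun_mean (hs : CrossFitSample Q P D fold)
    {f : ∀ N, Triple (p N) → ℝ} (hf : ∀ N, Measurable (f N)) {V : ℕ → ℝ}
    (hmom : ∀ᶠ N in atTop, 0 < V N ∧ MemLp (f N) 2 (Q N) ∧ ∫ z, f N z ∂(Q N) = 0 ∧
      ∫ z, f N z ^ 2 ∂(Q N) = V N)
    (hlin : ∀ δ : ℝ, 0 < δ → Tendsto (fun N : ℕ => (V N)⁻¹ *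
      ∫ z in {z | δ * √N * √(V N) < |f N z|}, f N z ^ 2 ∂(Q N)) atTop (𝓝 0)) (t : ℝ) :
    Tendsto (fun N : ℕ => charFun ((P N).map fun ω =>
        √N * (√(V N))⁻¹ * ((N : ℝ)⁻¹ * ∑ i, f N (D N i ω))) t) atTop
      (𝓝 (Complex.exp (-t ^ 2 / 2))) := by
  have hfm : ∀ N, Measurable fun z => f N z / √(V N) := fun N => (hf N).div_const _
  have hprob : ∀ N, IsProbabilityMeasure ((Q N).map fun z => f N z / √(V N)) := fun N =>
    Measure.isProbabilityMeasure_map (hfm N).aemeasurable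
  have hclt := tendsto_charFun_of_lindeberg (P := P)
    (X := fun N i ω => f N (D N i ω) / √(V N))
    (ν := fun N => (Q N).map fun z => f N z / √(V N))
    (fun N i => (hfm N).comp (hs.meas N i)) (fun N => (hs.indep N).comp _ fun _ => hfm N)
    (fun N i => by rw [← hs.law N i, Measure.map_map (hfm N) (hs.meas N i)]; rfl)
    ?_ ?_ ?_ ?_ t
  · refine hclt.congr fun N => ?_
    congr 2
    ext ω
    rw [← Finset.sum_div]
    rcases Nat.eq_zero_or_pos N with rfl | hN
    · simp
    have hNpos : (0 : ℝ) < N := by exact_mod_cast hN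
    have : √(N : ℝ) * (N : ℝ)⁻¹ = (√(N : ℝ))⁻¹ := by
      rw [← div_eq_mul_inv, Real.sqrt_div_self', one_div]
    rw [← this]
    ring
  · filter_upwards [hmom] with N ⟨hV, hmem, _, _⟩
    rw [memLp_map_measure_iff (by fun_prop) (hfm N).aemeasurable]
    have := hmem.const_mul (√(V N))⁻¹
    refine this.ae_eq (ae_of_all _ fun z => ?_)
    simp only [Function.comp_apply]
    ring
  · filter_upwards [hmom] with N ⟨hV, hmem, h0, _⟩
    rw [integral_map (hfm N).aemeasurable (by fun_prop), integral_div, h0, zero_div]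
  · filter_upwards [hmom] with N ⟨hV, hmem, _, hsq⟩
    rw [integral_map (hfm N).aemeasurable (by fun_prop)]
    simp only [div_pow, Real.sq_sqrt hV.le]
    rw [integral_div, hsq, div_self hV.ne']
  · intro δ hδ
    refine (hlin δ hδ).congr' ?_
    filter_upwards [hmom] with N ⟨hV, _, _, _⟩
    have hS : MeasurableSet {x : ℝ | δ * √N < |x|} :=
      measurableSet_lt measurable_const continuous_abs.measurable
    rw [setIntegral_map hS (by fun_prop) (hfm N).aemeasurable]
    have hset : (fun z => f N z / √(V N)) ⁻¹' {x : ℝ | δ * √N < |x|}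
        = {z | δ * √N * √(V N) < |f N z|} := by
      ext z
      simp only [Set.mem_preimage, Set.mem_ofPred_eq]
      rw [abs_div, abs_of_nonneg (Real.sqrt_nonneg (V N)), lt_div_iff₀ (Real.sqrt_pos.2 hV)]
    rw [hset]
    simp only [div_pow, Real.sq_sqrt hV.le]
    rw [integral_div, div_eq_inv_mul]

end AsymptoticNormality

/-! ### Rates of convergence and asymptotic normality of the estimator -/

section Conclusion

variable {K : ℕ} {p : ℕ → ℕ} {Q : ∀ N, Measure (Triple (p N))} [∀ N, IsProbabilityMeasure (Q N)]
  {Ω : ℕ → Type*} [∀ N, MeasurableSpace (Ω N)] {P : ∀ N, Measure (Ω N)}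
  [∀ N, IsProbabilityMeasure (P N)] {D : ∀ N, Fin N → Ω N → Triple (p N)}
  {fold : ∀ N, Ω N → Fin N → Fin K} {mhat pihat : ∀ N, Learner K N (p N)}
  {μ e : ∀ N, Cov (p N) → ℝ} {σ₁ σ₂ C : ℝ} {cμ ce rμ re : ℕ → ℝ}

theorem measurable_estimator {K N p : ℕ} {mhat pihat : Learner K N p}
    (hmhat : ∀ κ k, Measurable (Function.uncurry (mhat κ k)))
    (hpihat : ∀ κ k, Measurable (Function.uncurry (pihat κ k))) (κ : Fin N → Fin K) :
    Measurable (estimator mhat pihat κ) := by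
  have hfit : ∀ {f : Learner K N p}, (∀ κ k, Measurable (Function.uncurry (f κ k))) →
      ∀ i, Measurable fun d => crossFit f κ d i := by
    intro f hf i
    have h : Measurable fun (d : Fin N → Triple p) (j : {j // κ j ≠ κ i}) => obs (d j) :=
      measurable_pi_lambda _ fun j => measurable_obs.comp (measurable_pi_apply _)
    exact (hf κ (κ i)).comp (h.prodMk (measurable_covar.comp (measurable_pi_apply i)))
  refine ((Finset.measurable_sum _ fun i _ => hfit hmhat i).const_mul _).add
    ((Finset.measurable_sum _ fun i _ => ?_).const_mul _)
  exact ((measurable_labelR.comp (measurable_pi_apply i)).div (hfit hpihat i)).mul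
    ((measurable_outcome.comp (measurable_pi_apply i)).sub (hfit hmhat i))

/-- When both models are correct, the variance of the score is of the order `a⁻¹`. -/
theorem scoreVar_bounds {p : ℕ} {Q : Measure (Triple p)} [IsProbabilityMeasure Q]
    {μ e : Cov p → ℝ} (hR : ∀ᵐ z ∂Q, labelR z = 0 ∨ labelR z = 1)
    (h_ign : Ignorability Q) (hb : BasicAssumption Q μ σ₁ σ₂) (ha : 0 < aRate Q)
    (hμ : Measurable μ) (he : Measurable e)
    (hov : ∀ᵐ x ∂(lawX Q), 0 < e x ∧ propensity Q x ≤ 1 * e x)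
    (hμm : μ =ᵐ[lawX Q] outcomeMean Q) (heπ : e =ᵐ[lawX Q] propensity Q) :
    σ₁ ^ 2 * (aRate Q)⁻¹ ≤ scoreVar Q μ e ∧ scoreVar Q μ e ≤ 12 * σ₂ ^ 2 * (aRate Q)⁻¹ := by
  have hm := score_moments hR h_ign hb ha hμ he hov (Or.inl hμm)
  rw [scoreVar_eq hμ he hm.2.1]
  refine ⟨le_integral_sq_score hR h_ign hb ha hμ he hμm heπ, hm.2.2.trans (le_of_eq ?_)⟩
  ring

/-- The rate of the remainder is `o((N a)^{-1/2})` when the product of the rates is. -/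
theorem tendsto_sqrt_mul_remainder_rate {a cμ ce rμ re : ℕ → ℝ}
    (ha : Tendsto (fun N : ℕ => (N : ℝ) * a N) atTop atTop)
    (hcμ : Tendsto cμ atTop (𝓝 0)) (hce : Tendsto ce atTop (𝓝 0))
    (hr : (fun N => rμ N * re N) =o[atTop] (fun N : ℕ => 1 / √(N * a N))) :
    Tendsto (fun N : ℕ => √(N * a N) * (cμ N / √(N * a N) + ce N / √(N * a N) + rμ N * re N))
      atTop (𝓝 0) := by
  have h := (hcμ.add hce).add hr.tendsto_div_nhds_zero
  rw [add_zero, add_zero] at h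
  refine h.congr' ?_
  filter_upwards [ha.eventually_gt_atTop 0] with N hN
  have := Real.sqrt_pos.2 hN
  field_simp

/-- Lindeberg's condition in the scale `√(N / a)` for the score with the true propensity implies
the one in the scale `√(N V)` for the score with the working propensity. -/
theorem lindeberg_score
    (hR : ∀ N, ∀ᵐ z ∂(Q N), labelR z = 0 ∨ labelR z = 1) (h_ign : ∀ N, Ignorability (Q N))
    (h_basic : ∀ N, BasicAssumption (Q N) (μ N) σ₁ σ₂) (hσ₁ : 0 < σ₁)
    (ha : ∀ᶠ N in atTop, 0 < aRate (Q N))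
    (hμ : ∀ N, Measurable (μ N)) (he : ∀ N, Measurable (e N))
    (hμm : ∀ N, μ N =ᵐ[lawX (Q N)] outcomeMean (Q N))
    (heπ : ∀ N, e N =ᵐ[lawX (Q N)] propensity (Q N))
    (hlin : ∀ c : ℝ, 0 < c → Tendsto (fun N : ℕ => aRate (Q N) *
      ∫ z in {z | c * √(N / aRate (Q N)) < |score (Q N) (μ N) (propensity (Q N)) z|},
        score (Q N) (μ N) (propensity (Q N)) z ^ 2 ∂(Q N)) atTop (𝓝 0))
    {δ : ℝ} (hδ : 0 < δ) :
    Tendsto (fun N : ℕ => (scoreVar (Q N) (μ N) (e N))⁻¹ *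
      ∫ z in {z | δ * √N * √(scoreVar (Q N) (μ N) (e N)) < |score (Q N) (μ N) (e N) z|},
        score (Q N) (μ N) (e N) z ^ 2 ∂(Q N)) atTop (𝓝 0) := by
  have hov := overlap_of_correct_propensity ha heπ
  have hlim := (hlin (δ * σ₁) (mul_pos hδ hσ₁)).const_mul (σ₁ ^ 2)⁻¹
  rw [mul_zero] at hlim
  refine tendsto_of_tendsto_of_tendsto_of_le_of_le' tendsto_const_nhds hlim ?_ ?_
  · refine Eventually.of_forall fun N => mul_nonneg (inv_nonneg.2 (variance_nonneg _ _)) ?_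
    exact integral_nonneg fun z => sq_nonneg _
  filter_upwards [ha, hov] with N haN hovN
  obtain ⟨hV, -⟩ := scoreVar_bounds (hR N) (h_ign N) (h_basic N) haN (hμ N) (he N) hovN
    (hμm N) (heπ N)
  have hmem := (score_moments (hR N) (h_ign N) (h_basic N) haN (hμ N) (he N) hovN
    (Or.inl (hμm N))).1
  set V := scoreVar (Q N) (μ N) (e N)
  have hV0 : 0 < σ₁ ^ 2 * (aRate (Q N))⁻¹ := by positivity
  have hfg : score (Q N) (μ N) (e N) =ᵐ[Q N] score (Q N) (μ N) (propensity (Q N)) := by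
    filter_upwards [ae_covar (heπ N)] with z hz
    simp only [score, hz]
  have hthr : δ * σ₁ * √(N / aRate (Q N)) ≤ δ * √N * √V := by
    have : σ₁ * √(N / aRate (Q N)) ≤ √N * √V := by
      rw [← Real.sqrt_mul (Nat.cast_nonneg N)]
      refine Real.le_sqrt_of_sq_le ?_
      rw [mul_pow, Real.sq_sqrt (by positivity)]
      calc σ₁ ^ 2 * (N / aRate (Q N)) = N * (σ₁ ^ 2 * (aRate (Q N))⁻¹) := by
            rw [div_eq_mul_inv]; ring
        _ ≤ N * V := by gcongr
    calc δ * σ₁ * √(N / aRate (Q N)) = δ * (σ₁ * √(N / aRate (Q N))) := by ring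
      _ ≤ δ * (√N * √V) := by gcongr
      _ = δ * √N * √V := by ring
  have hint : ∫ z in {z | δ * √N * √V < |score (Q N) (μ N) (e N) z|},
        score (Q N) (μ N) (e N) z ^ 2 ∂(Q N)
      ≤ ∫ z in {z | δ * σ₁ * √(N / aRate (Q N)) <
          |score (Q N) (μ N) (propensity (Q N)) z|},
        score (Q N) (μ N) (propensity (Q N)) z ^ 2 ∂(Q N) := by
    have hsq : (fun z => score (Q N) (μ N) (e N) z ^ 2)
        =ᵐ[Q N] fun z => score (Q N) (μ N) (propensity (Q N)) z ^ 2 := by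
      filter_upwards [hfg] with z hz
      rw [hz]
    rw [integral_congr_ae (ae_restrict_of_ae hsq)]
    refine setIntegral_mono_set (hmem.ae_eq hfg).integrable_sq.integrableOn
      (ae_of_all _ fun z => sq_nonneg _) ?_
    filter_upwards [hfg] with z hz h
    have h' : δ * √N * √V < |score (Q N) (μ N) (e N) z| := h
    rw [hz] at h'
    exact hthr.trans_lt h'
  calc V⁻¹ * ∫ z in {z | δ * √N * √V < |score (Q N) (μ N) (e N) z|},
        score (Q N) (μ N) (e N) z ^ 2 ∂(Q N)
      ≤ (σ₁ ^ 2 * (aRate (Q N))⁻¹)⁻¹ *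
        ∫ z in {z | δ * σ₁ * √(N / aRate (Q N)) <
          |score (Q N) (μ N) (propensity (Q N)) z|},
        score (Q N) (μ N) (propensity (Q N)) z ^ 2 ∂(Q N) := by
        refine mul_le_mul (inv_anti₀ hV0 hV) hint (integral_nonneg fun z => sq_nonneg _)
          (by positivity)
    _ = _ := by rw [mul_inv, inv_inv, mul_assoc]

/-- Slutsky's step: an estimation error whose distance to the average score is negligible at the
scale `√(N a)` inherits the asymptotic normality of the average score. -/
theorem CrossFitSample.tendstoInDistribution_of_expansion (hs : CrossFitSample Q P D fold)
    (hR : ∀ N, ∀ᵐ z ∂(Q N), labelR z = 0 ∨ labelR z = 1) (h_ign : ∀ N, Ignorability (Q N))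
    (h_basic : ∀ N, BasicAssumption (Q N) (μ N) σ₁ σ₂) (hσ₁ : 0 < σ₁)
    (ha : ∀ᶠ N in atTop, 0 < aRate (Q N))
    (hμ : ∀ N, Measurable (μ N)) (he : ∀ N, Measurable (e N))
    (hμm : ∀ N, μ N =ᵐ[lawX (Q N)] outcomeMean (Q N))
    (heπ : ∀ N, e N =ᵐ[lawX (Q N)] propensity (Q N))
    (hlin : ∀ c : ℝ, 0 < c → Tendsto (fun N : ℕ => aRate (Q N) *
      ∫ z in {z | c * √(N / aRate (Q N)) < |score (Q N) (μ N) (propensity (Q N)) z|},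
        score (Q N) (μ N) (propensity (Q N)) z ^ 2 ∂(Q N)) atTop (𝓝 0))
    {err : ∀ N, Ω N → ℝ} (herr : ∀ N, Measurable (err N)) {rem : ℕ → ℝ}
    (hexp : BigOP P (fun N ω => err N ω - scoreMean (Q N) (μ N) (e N) (fun i => D N i ω)) rem)
    (hrem : Tendsto (fun N : ℕ => √(N * aRate (Q N)) * rem N) atTop (𝓝 0)) :
    TendstoInDistribution
      (fun (N : ℕ) ω => √N * (√(scoreVar (Q N) (μ N) (e N)))⁻¹ * err N ω)
      atTop id P (gaussianReal 0 1) := by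
  have hov := overlap_of_correct_propensity ha heπ
  have hmeas : ∀ N : ℕ, Measurable
      (fun ω => √N * (√(scoreVar (Q N) (μ N) (e N)))⁻¹ * err N ω) := fun N =>
    (herr N).const_mul _
  have hmeas' : ∀ N : ℕ, Measurable (fun ω => √N * (√(scoreVar (Q N) (μ N) (e N)))⁻¹ *
      scoreMean (Q N) (μ N) (e N) (fun i => D N i ω)) := fun N =>
    ((Finset.measurable_sum _ fun i _ => (measurable_score (hμ N) (he N)).comp
      (hs.meas N i)).const_mul _).const_mul _
  have hscale : Tendsto (fun N : ℕ => √N * (√(scoreVar (Q N) (μ N) (e N)))⁻¹ * rem N)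
      atTop (𝓝 0) := by
    have hlim := hrem.abs.const_mul σ₁⁻¹
    rw [abs_zero, mul_zero] at hlim
    refine squeeze_zero_norm' ?_ hlim
    filter_upwards [ha, hov] with N haN hovN
    obtain ⟨hV, -⟩ := scoreVar_bounds (hR N) (h_ign N) (h_basic N) haN (hμ N) (he N) hovN
      (hμm N) (heπ N)
    have hinv : (√(scoreVar (Q N) (μ N) (e N)))⁻¹ ≤ σ₁⁻¹ * √(aRate (Q N)) := by
      have h0 : 0 < σ₁ * (√(aRate (Q N)))⁻¹ := mul_pos hσ₁ (inv_pos.2 (Real.sqrt_pos.2 haN))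
      have h1 : σ₁ * (√(aRate (Q N)))⁻¹ ≤ √(scoreVar (Q N) (μ N) (e N)) := by
        refine Real.le_sqrt_of_sq_le ?_
        rwa [mul_pow, inv_pow, Real.sq_sqrt haN.le]
      calc (√(scoreVar (Q N) (μ N) (e N)))⁻¹ ≤ (σ₁ * (√(aRate (Q N)))⁻¹)⁻¹ := inv_anti₀ h0 h1
        _ = _ := by rw [mul_inv, inv_inv]
    rw [Real.norm_eq_abs, abs_mul, abs_mul, abs_mul, abs_of_nonneg (Real.sqrt_nonneg _),
      abs_of_nonneg (inv_nonneg.2 (Real.sqrt_nonneg _)), abs_of_nonneg (Real.sqrt_nonneg _),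
      Real.sqrt_mul (Nat.cast_nonneg N)]
    calc √N * (√(scoreVar (Q N) (μ N) (e N)))⁻¹ * |rem N|
        ≤ √N * (σ₁⁻¹ * √(aRate (Q N))) * |rem N| := by gcongr
      _ = σ₁⁻¹ * (√N * √(aRate (Q N)) * |rem N|) := by ring
  refine ⟨fun N => (hmeas N).aemeasurable, by fun_prop, ?_⟩
  refine ProbabilityMeasure.tendsto_iff_tendsto_charFun.2 fun t => ?_
  have hclt := hs.tendsto_charFun_mean (f := fun N => score (Q N) (μ N) (e N))
    (fun N => measurable_score (hμ N) (he N)) (V := fun N => scoreVar (Q N) (μ N) (e N)) ?_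
    (fun δ hδ => lindeberg_score hR h_ign h_basic hσ₁ ha hμ he hμm heπ hlin hδ) t
  · have h := tendsto_charFun_of_sub_tendsto_zero hmeas' hmeas
      (fun ε hε => ?_) hclt
    · simpa [charFun_gaussianReal, neg_div] using h
    · refine BigOP.tendsto_zero ?_ hscale hε
      exact (hexp.mul_seq fun N : ℕ => √N * (√(scoreVar (Q N) (μ N) (e N)))⁻¹).congr
        (Eventually.of_forall fun N => ae_of_all _ fun ω => by ring)
  · filter_upwards [ha, hov] with N haN hovN
    have hm := score_moments (hR N) (h_ign N) (h_basic N) haN (hμ N) (he N) hovN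
      (Or.inl (hμm N))
    refine ⟨lt_of_lt_of_le ?_ (scoreVar_bounds (hR N) (h_ign N) (h_basic N) haN (hμ N) (he N)
      hovN (hμm N) (heπ N)).1, hm.1, hm.2.1, (scoreVar_eq (hμ N) (he N) hm.2.1).symm⟩
    positivity

end Conclusion

end DRSS

open DRSS in
theorem mainTheorem1
    -- `K` folds, covariate dimensions `p N`, and for each `N` a population law `Q N` of `(R, Y, X)`
    (K : ℕ) (hK : 2 ≤ K) (p : ℕ → ℕ)
    (Q : ∀ N, Measure (Triple (p N))) [∀ N, IsProbabilityMeasure (Q N)]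
    (hR : ∀ N, ∀ᵐ z ∂(Q N), labelR z = 0 ∨ labelR z = 1)
    -- the sample `D N i`, `i < N`: i.i.d. with law `Q N`, and a random partition independent of it
    {Ω : ℕ → Type*} [∀ N, MeasurableSpace (Ω N)]
    (P : ∀ N, Measure (Ω N)) [∀ N, IsProbabilityMeasure (P N)]
    (D : ∀ N, Fin N → Ω N → Triple (p N))
    (hD_meas : ∀ N i, Measurable (D N i))
    (hD_law : ∀ N i, (P N).map (D N i) = Q N)
    (hD_indep : ∀ N, iIndepFun (D N) (P N))
    (fold : ∀ N, Ω N → Fin N → Fin K)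
    (hfold_meas : ∀ N, Measurable (fold N))
    (hfold_indep : ∀ N, IndepFun (fold N) (fun ω i => D N i ω) (P N))
    -- the nuisance estimators and their limits
    (mhat pihat : ∀ N, Learner K N (p N))
    (hmhat : ∀ N κ k, Measurable (Function.uncurry (mhat N κ k)))
    (hpihat : ∀ N κ k, Measurable (Function.uncurry (pihat N κ k)))
    (μ e : ∀ N, Cov (p N) → ℝ)
    (hμ : ∀ N, Measurable (μ N)) (he : ∀ N, Measurable (e N))
    -- ignorability, moment conditions, `N a_N → ∞`
    (h_ign : ∀ N, Ignorability (Q N))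
    (σ₁ σ₂ : ℝ) (hσ₁ : 0 < σ₁) (hσ₂ : 0 < σ₂)
    (h_basic : ∀ N, BasicAssumption (Q N) (μ N) σ₁ σ₂)
    (h_eff : Tendsto (fun N : ℕ => (N : ℝ) * aRate (Q N)) atTop atTop)
    -- rate conditions
    (cμ ce rμ re : ℕ → ℝ)
    (hcμ0 : ∀ N, 0 ≤ cμ N) (hce0 : ∀ N, 0 ≤ ce N)
    (hrμ0 : ∀ N, 0 ≤ rμ N) (hre0 : ∀ N, 0 ≤ re N)
    (hcμ : Tendsto cμ atTop (𝓝 0)) (hce : Tendsto ce atTop (𝓝 0))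
    (hrμ : Tendsto rμ atTop (𝓝 0)) (hre : Tendsto re atTop (𝓝 0))
    (h_cμ : ∀ k : Fin K, BigOPENN P (fun N ω => weightedSq (Q N) (fun x =>
      fit (mhat N) (fold N ω) (fun i => D N i ω) k x - μ N x)) (fun N => cμ N ^ 2))
    (h_ce : ∀ k : Fin K, BigOPENN P (fun N ω => weightedSq (Q N) (fun x =>
      1 - e N x / fit (pihat N) (fold N ω) (fun i => D N i ω) k x)) (fun N => ce N ^ 2))
    (h_rμ : ∀ k : Fin K, BigOPENN P (fun N ω => plainSq (Q N) (fun x =>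
      fit (mhat N) (fold N ω) (fun i => D N i ω) k x - μ N x)) (fun N => rμ N ^ 2))
    (h_re : ∀ k : Fin K, BigOPENN P (fun N ω => plainSq (Q N) (fun x =>
      1 - e N x / fit (pihat N) (fold N ω) (fun i => D N i ω) k x)) (fun N => re N ^ 2)) :
    -- the estimation error and the remainder rate
    let err : ∀ N, Ω N → ℝ := fun N ω =>
      estimator (mhat N) (pihat N) (fold N ω) (fun i => D N i ω) - theta0 (Q N)
    let rem : ℕ → ℝ := fun N =>
      cμ N / √(N * aRate (Q N)) + ce N / √(N * aRate (Q N)) + rμ N * re N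
    -- (a) both models are correct
    ((∀ N, μ N =ᵐ[lawX (Q N)] outcomeMean (Q N)) →
      (∀ N, e N =ᵐ[lawX (Q N)] propensity (Q N)) →
      BigOP P (fun N ω => err N ω - scoreMean (Q N) (μ N) (e N) (fun i => D N i ω)) rem ∧
      SameOrder (fun N => scoreVar (Q N) (μ N) (e N)) (fun N => (aRate (Q N))⁻¹) ∧
      ((fun N => rμ N * re N) =o[atTop] (fun N : ℕ => 1 / √(N * aRate (Q N))) →
        (∀ c : ℝ, 0 < c → Tendsto (fun N : ℕ => aRate (Q N) *
          ∫ z in {z | c * √(N / aRate (Q N)) < |score (Q N) (μ N) (propensity (Q N)) z|},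
            score (Q N) (μ N) (propensity (Q N)) z ^ 2 ∂(Q N)) atTop (𝓝 0)) →
        BigOP P (fun N ω => √(N * aRate (Q N)) * err N ω) (fun _ => 1) ∧
        TendstoInDistribution
          (fun (N : ℕ) ω => √N * (√(scoreVar (Q N) (μ N) (e N)))⁻¹ * err N ω)
          atTop id P (gaussianReal 0 1))) ∧
    -- (b) one of the models is correct
    ((∃ c C : ℝ, 0 < c ∧ 0 < C ∧ ∀ N, ¬ e N =ᵐ[lawX (Q N)] propensity (Q N) →
        ∀ᵐ x ∂(lawX (Q N)), c ≤ propensity (Q N) x / e N x ∧ propensity (Q N) x / e N x ≤ C) →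
      -- correct propensity model
      ((∀ N, e N =ᵐ[lawX (Q N)] propensity (Q N)) →
        BigOP P (fun N ω => err N ω - scoreMean (Q N) (μ N) (e N) (fun i => D N i ω)
          - deltaPS (Q N) (μ N) (pihat N) (fold N ω) (fun i => D N i ω)) rem ∧
        ((∃ C : ℝ, ∀ N, eLpNorm (fun x => outcomeMean (Q N) x - μ N x) 2 (lawX (Q N))
            ≤ ENNReal.ofReal C) →
          BigOP P err (fun N => 1 / √(N * aRate (Q N)) + rem N
            + (re N * neInd (lawX (Q N)) (μ N) (outcomeMean (Q N))
              + rμ N * neInd (lawX (Q N)) (e N) (propensity (Q N)))))) ∧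
      -- correct outcome model
      ((∀ N, μ N =ᵐ[lawX (Q N)] outcomeMean (Q N)) →
        BigOP P (fun N ω => err N ω - scoreMean (Q N) (μ N) (e N) (fun i => D N i ω)
          - deltaOR (Q N) (e N) (mhat N) (fold N ω) (fun i => D N i ω)) rem ∧
        ((∃ C : ℝ, ∀ N, eLpNorm (fun x => 1 - propensity (Q N) x / e N x) 2 (lawX (Q N))
            ≤ ENNReal.ofReal C) →
          BigOP P err (fun N => 1 / √(N * aRate (Q N)) + rem N
            + (re N * neInd (lawX (Q N)) (μ N) (outcomeMean (Q N))
              + rμ N * neInd (lawX (Q N)) (e N) (propensity (Q N))))))) := by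
  intro err rem
  have hs : CrossFitSample Q P D fold := ⟨hD_meas, hD_law, hD_indep, hfold_meas, hfold_indep⟩
  have ha : ∀ᶠ N in atTop, 0 < aRate (Q N) := by
    filter_upwards [h_eff.eventually_gt_atTop 0] with N hN
    exact pos_of_mul_pos_right hN (Nat.cast_nonneg N)
  have hrem0 : ∀ N, 0 ≤ rem N := fun N => add_nonneg (add_nonneg
    (div_nonneg (hcμ0 N) (Real.sqrt_nonneg _)) (div_nonneg (hce0 N) (Real.sqrt_nonneg _)))
    (mul_nonneg (hrμ0 N) (hre0 N))
  have hsqrt0 : ∀ N : ℕ, 0 ≤ 1 / √(N * aRate (Q N)) := fun N =>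
    one_div_nonneg.2 (Real.sqrt_nonneg _)
  have hμ0 : ∀ N, 0 ≤ re N * neInd (lawX (Q N)) (μ N) (outcomeMean (Q N)) := fun N =>
    mul_nonneg (hre0 N) (neInd_nonneg _ _ _)
  have he0 : ∀ N, 0 ≤ rμ N * neInd (lawX (Q N)) (e N) (propensity (Q N)) := fun N =>
    mul_nonneg (hrμ0 N) (neInd_nonneg _ _ _)
  -- the expansion and the order of the average score, under overlap with a constant `C`
  have hexp : ∀ C : ℝ, 0 ≤ C →
      (∀ᶠ N in atTop, ∀ᵐ x ∂(lawX (Q N)), 0 < e N x ∧ propensity (Q N) x ≤ C * e N x) →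
      BigOP P (fun N ω => err N ω - scoreMean (Q N) (μ N) (e N) (fun i => D N i ω)
        - bias (Q N) (μ N) (e N) (mhat N) (pihat N) (fold N ω) (fun i => D N i ω)) rem :=
    fun C hC hov => hs.bigOP_remainder hR h_ign h_basic ha hmhat hpihat hμ he hC hov hcμ0 hce0
      hrμ0 hre0 h_cμ h_ce h_rμ h_re
  have hscore : ∀ C : ℝ,
      (∀ᶠ N in atTop, ∀ᵐ x ∂(lawX (Q N)), 0 < e N x ∧ propensity (Q N) x ≤ C * e N x) →
      (∀ N, μ N =ᵐ[lawX (Q N)] outcomeMean (Q N) ∨ e N =ᵐ[lawX (Q N)] propensity (Q N)) →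
      BigOP P (fun N ω => scoreMean (Q N) (μ N) (e N) (fun i => D N i ω))
        (fun N => 1 / √(N * aRate (Q N))) := by
    intro C hov hcase
    refine hs.bigOP_mean (f := fun N => score (Q N) (μ N) (e N))
      (fun N => measurable_score (hμ N) (he N)) (B := 3 * (3 + C ^ 2) * σ₂ ^ 2) (by positivity) ?_
    filter_upwards [ha, hov] with N haN hovN
    exact score_moments (hR N) (h_ign N) (h_basic N) haN (hμ N) (he N) hovN (hcase N)
  refine ⟨fun hμm heπ => ?_, fun ⟨c, C, hc, hC, hratio⟩ => ⟨fun heπ => ⟨?_, fun _ => ?_⟩,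
    fun hμm => ⟨?_, fun _ => ?_⟩⟩⟩
  · have hov := overlap_of_correct_propensity ha heπ
    have hmain : BigOP P
        (fun N ω => err N ω - scoreMean (Q N) (μ N) (e N) (fun i => D N i ω)) rem := by
      refine (hexp 1 zero_le_one hov).congr (Eventually.of_forall fun N => ?_)
      filter_upwards [hs.ae_forall (ae_covar (hμm N)), hs.ae_forall (ae_covar (heπ N))]
        with ω h1 h2
      have hzero : bias (Q N) (μ N) (e N) (mhat N) (pihat N) (fold N ω)
          (fun i => D N i ω) = 0 := by
        simp only [bias, h1, h2, sub_self, mul_zero, Finset.sum_const_zero]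
      rw [hzero, sub_zero]
    -- halving `σ₁ ^ 2` and adding `1` to the upper constant make the inequalities strict
    refine ⟨hmain, ⟨σ₁ ^ 2 / 2, 12 * σ₂ ^ 2 + 1, by positivity, by positivity, ?_⟩,
      fun ho hlin => ?_⟩
    · filter_upwards [ha, hov] with N haN hovN
      have hb := scoreVar_bounds (hR N) (h_ign N) (h_basic N) haN (hμ N) (he N) hovN (hμm N)
        (heπ N)
      have hinv : 0 < (aRate (Q N))⁻¹ := inv_pos.2 haN
      have h1 : 0 < σ₁ ^ 2 * (aRate (Q N))⁻¹ := by positivity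
      constructor <;> linarith
    · have hlim := tendsto_sqrt_mul_remainder_rate h_eff hcμ hce ho
      refine ⟨?_, hs.tendstoInDistribution_of_expansion hR h_ign h_basic hσ₁ ha hμ he hμm heπ
        hlin (fun N => (measurable_comp_fold (hD_meas N) (hfold_meas N)
          (measurable_estimator (hmhat N) (hpihat N))).sub_const _) hmain hlim⟩
      have herr : BigOP P err (fun N => 1 / √(N * aRate (Q N)) + rem N) :=
        ((hscore 1 hov fun N => Or.inl (hμm N)).add hmain (Eventually.of_forall hsqrt0)
          (Eventually.of_forall hrem0)).congr
          (Eventually.of_forall fun N => ae_of_all _ fun ω => by ring)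
      refine (herr.mul_seq fun N : ℕ => √(N * aRate (Q N))).mono_rate 2 ?_
      filter_upwards [h_eff.eventually_gt_atTop 0, hlim.eventually_le_const zero_lt_one]
        with N hN hle
      have hpos := Real.sqrt_pos.2 hN
      have hrem : 0 ≤ √(N * aRate (Q N)) * rem N := mul_nonneg hpos.le (hrem0 N)
      rw [mul_add, mul_one_div, div_self hpos.ne', abs_of_nonneg (by linarith), abs_one]
      have hle' : √(N * aRate (Q N)) * rem N ≤ 1 := hle
      linarith
  · have hov := overlap_of_correct_propensity ha heπ
    refine (hexp 1 zero_le_one hov).congr ?_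
    filter_upwards [hov] with N hovN
    filter_upwards [hs.ae_forall (ae_covar hovN), hs.ae_forall (ae_covar (heπ N))] with ω h1 h2
    rw [bias_eq_deltaPS _ _ _ (fun i => (h1 i).1.ne') h2]
  · have hov := overlap_of_correct_propensity ha heπ
    have hbias := hs.bigOP_bias_of_correct_propensity (mhat := mhat) hR h_ign h_basic ha hpihat
      hμ he heπ h_re
    refine ((hexp 1 zero_le_one hov).of_sub_sub (hscore 1 hov fun N => Or.inr (heπ N)) hbias
      hsqrt0 hμ0 hrem0).mono_rate 1 (Eventually.of_forall fun N => ?_)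
    rw [one_mul]
    refine abs_le_abs_of_nonneg ?_ ?_ <;> linarith [hsqrt0 N, hrem0 N, hμ0 N, he0 N]
  · have hov := overlap_of_ratio_bounds ha hc hratio
    refine (hexp _ (zero_le_one.trans (le_max_left 1 C)) hov).congr
      (Eventually.of_forall fun N => ?_)
    filter_upwards [hs.ae_forall (ae_covar (hμm N))] with ω h1
    rw [bias_eq_deltaOR _ _ _ h1]
  · have hov := overlap_of_ratio_bounds ha hc hratio
    have hC0 : 0 ≤ max 1 C := zero_le_one.trans (le_max_left 1 C)
    have hbias := hs.bigOP_bias_of_correct_outcome (pihat := pihat) hR h_ign ha hmhat hμ he hC0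
      hov hμm h_rμ
    refine ((hexp _ hC0 hov).of_sub_sub (hscore _ hov fun N => Or.inl (hμm N)) hbias hsqrt0 he0
      hrem0).mono_rate 1 (Eventually.of_forall fun N => ?_)
    rw [one_mul]
    refine abs_le_abs_of_nonneg ?_ ?_ <;> linarith [hsqrt0 N, hrem0 N, hμ0 N, he0 N]
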